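/- Consider a finite connected graph (loops and multiple edges allowed) nicely embedded in the sphere $S^2$, all of whose vertices have degree $\ge 3$. Here each edge is a simple curve, closed if the edge is a loop, that contains no vertex besides its end points; different edges meet only in vertices; and "nicely" means that every edge is locally flat at each of its non-vertex points $x$, i.e. some homeomorphism from an open neighbourhood of $x$ in $S^2$ onto an open subset of the plane maps the part of the edge in that neighbourhood onto the part of a straight line in that subset. The interiors of the tiles are the connected components of the complement of the graph, and the tiles are the closures of their interiors. The edges of a tile are the edges of the graph contained in its boundary, the boundary being the tile minus its interior. A tile has no boundary points identified if it is the image of the closed unit disk under a continuous injective map that carries the open disk onto the interior of the tile. A spherical tiling by combinatorially congruent pentagons is such a tiling in which every tile has exactly five edges and no boundary points identified. There is a spherical tiling by $12$ combinatorially congruent pentagons, and it is combinatorially unique: every such tiling has the combinatorial structure of the dodecahedron. Explicitly, its tiles can be labelled bijectively as $P_1,\dots,P_{12}$ in such a way that the following holds. Let $\mathcal V$ be the set of the $20$ triples $$\begin{gathered}123,\ 134,\ 145,\ 156,\ 162,\quad 237,\ 348,\ 459,\ 5\,6\,10,\ 6\,2\,11,\\ 378,\ 489,\ 5\,9\,10,\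 6\,10\,11,\ 2\,11\,7,\quad 12\,7\,8,\ 12\,8\,9,\ 12\,9\,10,\ 12\,10\,11,\ 12\,11\,7\end{gathered}$$ (regarded as three-element subsets of $\{1,\dots,12\}$), and let $\mathcal E$ be the set of the $30$ two-element subsets of members of $\mathcal V$. There are bijections $\tau\mapsto V_\tau$ from $\mathcal V$ to the vertices and $\sigma\mapsto E_\sigma$ from $\mathcal E$ to the edges of the tiling such that $E_\sigma\subseteq P_i$ if and only if $i\in\sigma$, $V_\tau\in P_i$ if and only if $i\in\tau$, and $V_\tau\in E_\sigma$ if and only if $\sigma\subseteq\tau$. -/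

import Mathlib

/-- The unit sphere in Euclidean three-space. -/
abbrev Sphere2 : Type := Metric.sphere (0 : EuclideanSpace ℝ (Fin 3)) 1

/-- `e` is the trace of a curve that starts in `a`, ends in `b`, and does not pass twice through
the same point, except that `a = b` is allowed (the curve is then a simple closed curve). -/
def IsSimpleCurve (e : Set Sphere2) (a b : Sphere2) : Prop :=
  ∃ γ : Path a b, Set.range γ = e ∧
    ∀ s t : unitInterval, γ s = γ t → s = t ∨ (s = 0 ∧ t = 1) ∨ (s = 1 ∧ t = 0)

/-- Near its point `x`, the curve `e` looks like a straight line in the plane. -/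
def IsLocallyFlatAt (e : Set Sphere2) (x : Sphere2) : Prop :=
  ∃ φ : OpenPartialHomeomorph Sphere2 ℂ,
    x ∈ φ.source ∧ ∀ y ∈ φ.source, (y ∈ e ↔ (φ y).im = 0)

/-- A finite graph nicely embedded in the sphere. Loops and multiple edges are allowed.
Edges contain their end points. -/
structure SphereGraph where
  /-- the vertices -/
  verts : Set Sphere2
  /-- the (closed) edges -/
  edges : Set (Set Sphere2)
  finite_verts : verts.Finite
  finite_edges : edges.Finite
  /-- an edge is a simple curve that meets the vertex set exactly in its end points -/
  edge_curve : ∀ e ∈ edges, ∃ a b : Sphere2, IsSimpleCurve e a b ∧ e ∩ verts = {a, b}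
  /-- different edges meet only in vertices -/
  edge_inter : ∀ e ∈ edges, ∀ e' ∈ edges, e ≠ e' → e ∩ e' ⊆ verts
  /-- edges are nice curves -/
  edge_flat : ∀ e ∈ edges, ∀ x ∈ e, x ∉ verts → IsLocallyFlatAt e x

namespace SphereGraph

/-- The subset of the sphere covered by the graph. -/
def support (G : SphereGraph) : Set Sphere2 := G.verts ∪ ⋃₀ G.edges

/-- The degree of a vertex: the number of edges at it, loops being counted twice. -/
noncomputable def degree (G : SphereGraph) (v : Sphere2) : ℕ :=
  {e ∈ G.edges | v ∈ e}.ncard + {e ∈ G.edges | e ∩ G.verts = {v}}.ncard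

/-- The interiors of the tiles: the connected components of the complement of the graph. -/
def faces (G : SphereGraph) : Set (Set Sphere2) :=
  {F | ∃ x ∈ G.supportᶜ, F = connectedComponentIn G.supportᶜ x}

/-- The tiles: the closures of their interiors. -/
def tiles (G : SphereGraph) : Set (Set Sphere2) := closure '' G.faces

/-- The edges of the tile with interior `F`: those in the boundary, which is what is between the
tile and its interior. -/
def sides (G : SphereGraph) (F : Set Sphere2) : Set (Set Sphere2) :=
  {e ∈ G.edges | e ⊆ closure F \ F}

end SphereGraph

/-- A tile with interior `F` has no boundary points identified: it is an injective image of a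
closed disk whose open disk is mapped onto the interior of the tile. -/
def NoBoundaryIdentification (F : Set Sphere2) : Prop :=
  ∃ φ : ℂ → Sphere2, ContinuousOn φ (Metric.closedBall 0 1) ∧
    Set.InjOn φ (Metric.closedBall 0 1) ∧
    φ '' Metric.ball 0 1 = F ∧ φ '' Metric.closedBall 0 1 = closure F

/-- An (edge-to-edge, naturally generated) tiling of the sphere. -/
structure SphericalTiling extends SphereGraph where
  connected : IsConnected toSphereGraph.support
  three_le_degree : ∀ v ∈ verts, 3 ≤ toSphereGraph.degree v

namespace SphericalTiling

/-- All tiles are combinatorially congruent `n`-gons. -/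
def IsCombinatoriallyMonohedral (T : SphericalTiling) (n : ℕ) : Prop :=
  ∀ F ∈ T.faces, (T.sides F).ncard = n ∧ NoBoundaryIdentification F

end SphericalTiling

/-- The vertices of the dodecahedron, each given by the three faces that meet in it. Face `0` is
surrounded by the faces `1, …, 5`, and the opposite face `11` by the faces `6, …, 10`. -/
def dodecahedronVertices : Finset (Finset (Fin 12)) :=
  {{0, 1, 2}, {0, 2, 3}, {0, 3, 4}, {0, 4, 5}, {0, 5, 1},
   {1, 2, 6}, {2, 3, 7}, {3, 4, 8}, {4, 5, 9}, {5, 1, 10},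
   {2, 6, 7}, {3, 7, 8}, {4, 8, 9}, {5, 9, 10}, {1, 10, 6},
   {11, 6, 7}, {11, 7, 8}, {11, 8, 9}, {11, 9, 10}, {11, 10, 6}}

/-- The edges of the dodecahedron, each given by the two faces that share it; these are the pairs
of faces that meet in some vertex. -/
def dodecahedronEdges : Finset (Finset (Fin 12)) :=
  dodecahedronVertices.biUnion (Finset.powersetCard 2)

/-- The tiling has the combinatorial structure of the dodecahedron: its tiles, edges and vertices
correspond bijectively to those of the dodecahedron, and all incidences are the same. -/
def SphericalTiling.IsDodecahedral (T : SphericalTiling) : Prop :=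
  ∃ (P : Fin 12 ≃ T.tiles) (E : dodecahedronEdges ≃ T.edges) (V : dodecahedronVertices ≃ T.verts),
    (∀ e i, (E e : Set Sphere2) ⊆ (P i : Set Sphere2) ↔ i ∈ e.1) ∧
    (∀ v i, (V v : Sphere2) ∈ (P i : Set Sphere2) ↔ i ∈ v.1) ∧
    (∀ v e, (V v : Sphere2) ∈ (E e : Set Sphere2) ↔ e.1 ⊆ v.1)

/-!
Uniqueness. Let a tiling by twelve combinatorial pentagons be given. By local flatness, an edge has
two local sides near each of its non-vertex points. They belong to different tiles, since a tile is
an injective image of a disk, whose interior is locally connected at every boundary point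
(`SphereGraph.not_both_sides`). So every edge borders exactly two tiles
(`SphereGraph.exists_faces_of_edge`). The boundary of a tile is a simple closed curve, which the
vertices divide into edges, so that it is a cycle of five different vertices and five different edges
(`SphereGraph.exists_boundary_cycle`). Since a small disk remains connected when its centre is
removed, the tiles around a vertex form a single cycle (`SphereGraph.link_connected`), and therefore
any two tiles are connected by a chain of adjacent tiles (`SphereGraph.dual_connected`).

The only global information about the sphere that is needed is that it has no first cohomology: a
function on the edges with values in `ℤ/2` which around every vertex is the difference of a function
on the tiles is such a difference globally (`SphereGraph.exists_coboundary`). The local functions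
define a covering space of the sphere, which has a section over the complement of a vertex, since
this is a plane. `PentagonalSphere` collects these facts, and what follows is combinatorial. Linear
algebra over `ℤ/2` turns the vanishing of the cohomology into the inequality `|V| - |E| + |F| ≥ 2`
(`PentagonalSphere.euler_le`). As `|F| = 12` and `|E| = 30`, there are at least twenty vertices, and
since the sum of the degrees is `60`, there are exactly twenty and all of them have degree three. Now
the second and third tile at each vertex are determined by the first, and starting from any tile one
finds the tiles of the dodecahedron with their vertices (`PentagonalSphere.exists_development`).
Every vertex of these tiles is in the list, so that there are no other tiles, and counting shows that
no tile, edge or vertex was listed twice (`PentagonalSphere.exists_dodecahedral`).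

Existence. The tiling is the radial projection of the convex dodecahedron with the normals
`(±1, ±2, 0)` and their cyclic permutations, which has integral vertices, so that its combinatorics
is decidable. A point of the sphere is in a closed tile if the linear form of that face is maximal
there. The tiles are disks since the faces are bounded convex sets with interior points
(`Pyritohedron.noBoundaryIdentification_tileInterior`), and edges are locally flat since the
stereographic projection from the antipode of a point on a great circle maps the circle to a line
(`exists_chart_of_greatCircle`).
-/

open Set Topology

/-! ### Faces and edges of an embedded graph -/

theorem IsSimpleCurve.isCompact {e : Set Sphere2} {a b : Sphere2} (h : IsSimpleCurve e a b) :
    IsCompact e := by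
  obtain ⟨γ, rfl, -⟩ := h
  exact isCompact_range γ.continuous

instance : Fact (Module.finrank ℝ (EuclideanSpace ℝ (Fin 3)) = 2 + 1) := ⟨by simp⟩

instance : LocallyConnectedSpace Sphere2 :=
  ChartedSpace.locallyConnectedSpace (EuclideanSpace ℝ (Fin 2)) _

instance : PreconnectedSpace Sphere2 :=
  isPreconnected_iff_preconnectedSpace.1
    (isPreconnected_sphere (by rw [rank_eq_card_basis (PiLp.basisFun 2 ℝ (Fin 3))]; simp) _ _)

namespace SphereGraph

variable {G : SphereGraph} {e e' F F' : Set Sphere2} {x v : Sphere2}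

theorem isClosed_edge (he : e ∈ G.edges) : IsClosed e := by
  obtain ⟨a, b, h, -⟩ := G.edge_curve e he
  exact h.isCompact.isClosed

theorem isClosed_support (G : SphereGraph) : IsClosed G.support :=
  G.finite_verts.isClosed.union (sUnion_eq_biUnion ▸
    G.finite_edges.isClosed_biUnion fun _ he => isClosed_edge he)

theorem edge_subset_support (he : e ∈ G.edges) : e ⊆ G.support :=
  (subset_sUnion_of_mem he).trans subset_union_right

theorem isOpen_face (hF : F ∈ G.faces) : IsOpen F := by
  obtain ⟨x, -, rfl⟩ := hF
  exact G.isClosed_support.isOpen_compl.connectedComponentIn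

theorem isPreconnected_face (hF : F ∈ G.faces) : IsPreconnected F := by
  obtain ⟨x, -, rfl⟩ := hF
  exact isPreconnected_connectedComponentIn

theorem face_nonempty (hF : F ∈ G.faces) : F.Nonempty := by
  obtain ⟨x, hx, rfl⟩ := hF
  exact ⟨x, mem_connectedComponentIn hx⟩

theorem face_subset (hF : F ∈ G.faces) : F ⊆ G.supportᶜ := by
  obtain ⟨x, hx, rfl⟩ := hF
  exact connectedComponentIn_subset _ _

theorem face_eq_of_mem (hF : F ∈ G.faces) (hF' : F' ∈ G.faces) (h : x ∈ F) (h' : x ∈ F') :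
    F = F' := by
  obtain ⟨y, hy, rfl⟩ := hF
  obtain ⟨z, hz, rfl⟩ := hF'
  rw [connectedComponentIn_eq h, connectedComponentIn_eq h']

theorem exists_face_of_isPreconnected {A : Set Sphere2} (hA : IsPreconnected A)
    (hne : A.Nonempty) (hs : A ⊆ G.supportᶜ) : ∃ F ∈ G.faces, A ⊆ F := by
  obtain ⟨x, hx⟩ := hne
  exact ⟨_, ⟨x, hs hx, rfl⟩, hA.subset_connectedComponentIn hx hs⟩

theorem exists_face_of_notMem (hx : x ∉ G.support) : ∃ F ∈ G.faces, x ∈ F :=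
  ⟨_, ⟨x, hx, rfl⟩, mem_connectedComponentIn hx⟩

theorem face_eq_of_mem_closure (hF : F ∈ G.faces) (hF' : F' ∈ G.faces) (h : x ∈ F)
    (h' : x ∈ closure F') : F = F' := by
  obtain ⟨y, hy, hy'⟩ := mem_closure_iff.1 h' F (isOpen_face hF) h
  exact face_eq_of_mem hF hF' hy hy'

theorem closure_diff_subset_support (hF : F ∈ G.faces) : closure F \ F ⊆ G.support := by
  rintro x ⟨hx, hxF⟩
  by_contra hs
  obtain ⟨F', hF', hx'⟩ := exists_face_of_notMem hs
  exact hxF (face_eq_of_mem_closure hF' hF hx' hx ▸ hx')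

theorem closure_injOn_faces (G : SphereGraph) : InjOn closure G.faces := by
  intro F hF F' hF' h
  obtain ⟨x, hx⟩ := face_nonempty hF
  exact face_eq_of_mem_closure hF hF' hx (h ▸ subset_closure hx)

theorem subset_closure_diff_iff (hF : F ∈ G.faces) (he : e ∈ G.edges) :
    e ⊆ closure F \ F ↔ e ⊆ closure F :=
  ⟨fun h => h.trans sdiff_subset, fun h _ hx =>
    ⟨h hx, fun hxF => face_subset hF hxF (edge_subset_support he hx)⟩⟩

/-- An edge has a parametrization under which the vertices on it correspond to the end points of the
unit interval. -/
theorem exists_param (he : e ∈ G.edges) : ∃ a b : Sphere2, ∃ γ : Path a b, range γ = e ∧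
    e ∩ G.verts = {a, b} ∧ e \ G.verts = γ '' Ioo 0 1 := by
  obtain ⟨a, b, ⟨γ, hr, hγ⟩, hv⟩ := G.edge_curve e he
  refine ⟨a, b, γ, hr, hv, ?_⟩
  have ha : a ∈ e ∩ G.verts := hv ▸ mem_insert _ _
  have hb : b ∈ e ∩ G.verts := hv ▸ mem_insert_of_mem _ rfl
  ext x
  constructor
  · rintro ⟨hxe, hxv⟩
    obtain ⟨t, rfl⟩ := hr ▸ hxe
    refine ⟨t, ⟨lt_of_le_of_ne t.2.1 ?_, lt_of_le_of_ne t.2.2 ?_⟩, rfl⟩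
    · intro h
      apply hxv
      rw [show t = 0 from h.symm, γ.source]
      exact ha.2
    · intro h
      apply hxv
      rw [show t = 1 from h, γ.target]
      exact hb.2
  · rintro ⟨t, ⟨h0, h1⟩, rfl⟩
    refine ⟨hr ▸ mem_range_self t, fun hxv => ?_⟩
    have : γ t ∈ e ∩ G.verts := ⟨hr ▸ mem_range_self t, hxv⟩
    rw [hv] at this
    rcases this with h | h
    · rcases hγ t 0 (h.trans γ.source.symm) with h | h | h
      · exact h0.ne' h
      · exact h0.ne' h.1
      · exact h1.ne h.1
    · rcases hγ t 1 ((mem_singleton_iff.1 h).trans γ.target.symm) with h | h | h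
      · exact h1.ne h
      · exact h0.ne' h.1
      · exact h1.ne h.1

theorem isPreconnected_arc (he : e ∈ G.edges) : IsPreconnected (e \ G.verts) := by
  obtain ⟨a, b, γ, -, -, h⟩ := exists_param he
  rw [h]
  exact isPreconnected_Ioo.image _ γ.continuous.continuousOn

theorem arc_nonempty (he : e ∈ G.edges) : (e \ G.verts).Nonempty := by
  obtain ⟨a, b, γ, -, -, h⟩ := exists_param he
  rw [h]
  exact (nonempty_Ioo.2 zero_lt_one).image _

theorem closure_arc (he : e ∈ G.edges) : closure (e \ G.verts) = e := by
  apply subset_antisymm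
  · exact (isClosed_edge he).closure_subset_iff.2 sdiff_subset
  · obtain ⟨a, b, γ, hr, -, h⟩ := exists_param he
    rw [h, ← hr]
    have : closure (Ioo (0 : unitInterval) 1) = univ := by
      rw [closure_Ioo zero_ne_one]
      exact eq_univ_of_forall fun t => ⟨t.2.1, t.2.2⟩
    rw [← image_univ, ← this]
    exact image_closure_subset_closure_image γ.continuous

theorem edge_subset_of_arc_subset {C : Set Sphere2} (he : e ∈ G.edges) (hC : IsClosed C)
    (h : e \ G.verts ⊆ C) : e ⊆ C := by
  rw [← closure_arc he]
  exact hC.closure_subset_iff.2 h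

theorem edge_eq_of_mem (he : e ∈ G.edges) (he' : e' ∈ G.edges) (h : x ∈ e) (h' : x ∈ e')
    (hx : x ∉ G.verts) : e = e' := by
  by_contra hne
  exact hx (G.edge_inter e he e' he' hne ⟨h, h'⟩)

/-! ### The two sides of an edge -/

/-- Points near a point `x` of the arc of an edge `e` are on the edge or on one of its two sides. -/
theorem exists_local_sides (he : e ∈ G.edges) (hx : x ∈ e) (hxv : x ∉ G.verts) :
    ∃ U A B : Set Sphere2, IsOpen U ∧ x ∈ U ∧ IsOpen A ∧ IsOpen B ∧ IsPreconnected A ∧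
      IsPreconnected B ∧ A.Nonempty ∧ B.Nonempty ∧ Disjoint A B ∧ U ⊆ A ∪ B ∪ e ∧
      A ⊆ G.supportᶜ ∧ B ⊆ G.supportᶜ ∧ U ∩ e ⊆ closure A ∩ closure B ∧
      U ∩ G.verts = ∅ := by
  obtain ⟨φ, hxφ, hφ⟩ := G.edge_flat e he x hx hxv
  set O : Set Sphere2 := φ.source ∩ (G.verts ∪ ⋃₀ (G.edges \ {e}))ᶜ with hO
  have hOo : IsOpen O := φ.open_source.inter (G.finite_verts.isClosed.union (sUnion_eq_biUnion ▸
    (G.finite_edges.subset sdiff_subset).isClosed_biUnion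
      fun _ h => isClosed_edge h.1)).isOpen_compl
  have hxO : x ∈ O := by
    refine ⟨hxφ, ?_⟩
    rintro (h | ⟨e', he', h⟩)
    · exact hxv h
    · exact he'.2 (edge_eq_of_mem he'.1 he h hx hxv)
  have hOs : ∀ y ∈ O, y ∈ G.support → y ∈ e := by
    rintro y hy (h | ⟨e', he', h⟩)
    · exact absurd (Or.inl h) hy.2
    · by_contra hne
      refine hy.2 (Or.inr ⟨e', ⟨he', ?_⟩, h⟩)
      rintro rfl
      exact hne h
  have hφO : IsOpen (φ '' O) := φ.isOpen_image_of_subset_source hOo inter_subset_left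
  obtain ⟨r, hr, hball⟩ := Metric.isOpen_iff.1 hφO (φ x) (mem_image_of_mem _ hxO)
  have him : (φ x).im = 0 := (hφ x hxφ).1 hx
  have hsymm : ∀ z ∈ Metric.ball (φ x) r, z ∈ φ.target ∧ φ.symm z ∈ O ∧ φ (φ.symm z) = z := by
    intro z hz
    obtain ⟨y, hy, rfl⟩ := hball hz
    rw [φ.left_inv hy.1]
    exact ⟨φ.map_source hy.1, hy, rfl⟩
  -- properties of the image of a convex part of the ball on which the imaginary part does not vanish
  have key : ∀ H : Set ℂ, IsOpen H → Convex ℝ H → (∀ z ∈ H, z.im ≠ 0) →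
      (∀ z ∈ Metric.ball (φ x) r, z.im = 0 → z ∈ closure (Metric.ball (φ x) r ∩ H)) →
      IsOpen (φ.symm '' (Metric.ball (φ x) r ∩ H)) ∧
      IsPreconnected (φ.symm '' (Metric.ball (φ x) r ∩ H)) ∧
      (φ.symm '' (Metric.ball (φ x) r ∩ H)).Nonempty ∧
      φ.symm '' (Metric.ball (φ x) r ∩ H) ⊆ G.supportᶜ ∧
      (∀ z ∈ Metric.ball (φ x) r, z.im = 0 →
        φ.symm z ∈ closure (φ.symm '' (Metric.ball (φ x) r ∩ H))) := by
    intro H hHo hHc hH hcl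
    have hsub : Metric.ball (φ x) r ∩ H ⊆ φ.target := fun z hz => (hsymm z hz.1).1
    refine ⟨φ.symm.isOpen_image_of_subset_source (Metric.isOpen_ball.inter hHo) hsub,
      (((convex_ball _ _).inter hHc).isPreconnected).image _
        (φ.continuousOn_symm.mono hsub), ?_, ?_, ?_⟩
    · have := hcl (φ x) (Metric.mem_ball_self hr) him
      exact (closure_nonempty_iff.1 ⟨_, this⟩).image _
    · rintro _ ⟨z, hz, rfl⟩ hs
      obtain ⟨h1, h2, h3⟩ := hsymm z hz.1
      have := (hφ _ h2.1).1 (hOs _ h2 hs)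
      rw [h3] at this
      exact hH z hz.2 this
    · intro z hz hz0
      have hcw : ContinuousAt φ.symm z := φ.continuousAt_symm (hsymm z hz).1
      exact hcw.continuousWithinAt.mem_closure_image (hcl z hz hz0)
  have hclos : ∀ s : ℝ, s ≠ 0 → ∀ z ∈ Metric.ball (φ x) r, z.im = 0 →
      z ∈ closure (Metric.ball (φ x) r ∩ {w | 0 < s * w.im}) := by
    intro s hs z hz hz0
    have ht : Filter.Tendsto (fun t : ℝ => z + (t * s : ℝ) * Complex.I) (𝓝[>] 0) (𝓝 z) := by
      have : Continuous fun t : ℝ => z + (t * s : ℝ) * Complex.I := by fun_prop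
      simpa using (this.tendsto 0).mono_left nhdsWithin_le_nhds
    refine mem_closure_of_tendsto ht ?_
    filter_upwards [ht (Metric.isOpen_ball.mem_nhds hz), self_mem_nhdsWithin] with t h1 h2
    refine ⟨h1, ?_⟩
    have h2 : 0 < t := h2
    have : 0 < s * s := mul_self_pos.2 hs
    have h4 : (z + (t * s : ℝ) * Complex.I).im = t * s := by
      rw [Complex.add_im, Complex.im_ofReal_mul]
      simp [hz0]
    change 0 < s * (z + (t * s : ℝ) * Complex.I).im
    rw [h4]
    nlinarith
  have hHo : ∀ s : ℝ, IsOpen {w : ℂ | 0 < s * w.im} := fun s =>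
    isOpen_lt continuous_const (continuous_const.mul Complex.continuous_im)
  have hHc : ∀ s : ℝ, Convex ℝ {w : ℂ | 0 < s * w.im} := fun s =>
    (convex_halfSpace_gt (f := fun w : ℂ => s * w.im)
      ⟨fun x y => by simp [mul_add], fun c x => by simp; ring⟩ 0)
  obtain ⟨a1, a2, a3, a4, a5⟩ := key _ (hHo 1) (hHc 1)
    (fun z hz h => by simp [h] at hz) (hclos 1 one_ne_zero)
  obtain ⟨b1, b2, b3, b4, b5⟩ := key _ (hHo (-1)) (hHc (-1))
    (fun z hz h => by simp [h] at hz) (hclos (-1) (by norm_num))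
  refine ⟨φ.symm '' Metric.ball (φ x) r, _, _,
    φ.symm.isOpen_image_of_subset_source Metric.isOpen_ball fun z hz => (hsymm z hz).1,
    ⟨φ x, Metric.mem_ball_self hr, φ.left_inv hxφ⟩, a1, b1, a2, b2, a3, b3, ?_, ?_, a4, b4, ?_, ?_⟩
  · rw [disjoint_left]
    rintro _ ⟨z, hz, rfl⟩ ⟨w, hw, h⟩
    have h' := congrArg φ h
    rw [(hsymm z hz.1).2.2, (hsymm w hw.1).2.2] at h'
    subst h'
    have h1 := hz.2
    have h2 := hw.2
    simp only [mem_ofPred_eq] at h1 h2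
    linarith
  · rintro _ ⟨z, hz, rfl⟩
    rcases lt_trichotomy z.im 0 with h | h | h
    · exact Or.inl (Or.inr ⟨z, ⟨hz, by simpa using h⟩, rfl⟩)
    · refine Or.inr ((hφ _ (hsymm z hz).2.1.1).2 ?_)
      rw [(hsymm z hz).2.2, h]
    · exact Or.inl (Or.inl ⟨z, ⟨hz, by simpa using h⟩, rfl⟩)
  · rintro _ ⟨⟨z, hz, rfl⟩, hze⟩
    have := (hφ _ (hsymm z hz).2.1.1).1 hze
    rw [(hsymm z hz).2.2] at this
    exact ⟨a5 z hz this, b5 z hz this⟩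
  · rw [eq_empty_iff_forall_notMem]
    rintro _ ⟨⟨z, hz, rfl⟩, h⟩
    exact (hsymm z hz).2.1.2 (Or.inl h)

/-- If both local sides of an edge were in the same face, a closed disk could not be mapped
injectively onto its closure: near the point `x`, which corresponds to a boundary point of the
disk, the open disk is convex, hence connected, and so maps to a single side. -/
theorem not_both_sides (hF : F ∈ G.faces) (hn : NoBoundaryIdentification F) (he : e ∈ G.edges)
    {U A B : Set Sphere2} (hU : IsOpen U) (hxU : x ∈ U) (hA : IsOpen A) (hB : IsOpen B)
    (hAB : Disjoint A B) (hUAB : U ⊆ A ∪ B ∪ e) (hxA : x ∈ closure A) (hxB : x ∈ closure B)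
    (hAF : A ⊆ F) (hBF : B ⊆ F) : False := by
  obtain ⟨φ, hc, hi, hb, hcl⟩ := hn
  obtain ⟨z, hz, rfl⟩ : x ∈ φ '' Metric.closedBall 0 1 := hcl ▸ closure_mono hAF hxA
  obtain ⟨ε, hε, hεU⟩ : ∃ ε > 0, ∀ w ∈ Metric.closedBall (0 : ℂ) 1, dist w z < ε → φ w ∈ U := by
    obtain ⟨ε, hε, h⟩ := Metric.mem_nhdsWithin_iff.1 (hc z hz (hU.mem_nhds hxU))
    exact ⟨ε, hε, fun w hw hwz => h ⟨hwz, hw⟩⟩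
  -- `φ N` is connected and lies on one side, but it contains all points of `F` near `x`
  set N := Metric.ball z ε ∩ Metric.ball (0 : ℂ) 1
  have hNsub : φ '' N ⊆ A ∪ B := by
    rintro _ ⟨w, ⟨hw1, hw2⟩, rfl⟩
    rcases hUAB (hεU w (Metric.ball_subset_closedBall hw2) hw1) with h | h
    · exact h
    · exact absurd (edge_subset_support he h) (face_subset hF (hb ▸ mem_image_of_mem _ hw2))
  have hNc : IsPreconnected (φ '' N) :=
    ((convex_ball _ _).inter (convex_ball _ _)).isPreconnected.image _
      (hc.mono (inter_subset_right.trans Metric.ball_subset_closedBall))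
  set W := (φ '' (Metric.closedBall 0 1 \ Metric.ball z ε))ᶜ
  have hW : IsOpen W := by
    have hK : IsCompact (φ '' (Metric.closedBall 0 1 \ Metric.ball z ε)) :=
      ((isCompact_closedBall _ _).diff Metric.isOpen_ball).image_of_continuousOn
        (hc.mono sdiff_subset)
    exact hK.isClosed.isOpen_compl
  have hxW : φ z ∈ W := by
    rintro ⟨w, hw, h⟩
    have := hi hw.1 hz h
    subst this
    exact hw.2 (Metric.mem_ball_self hε)
  have hWN : ∀ y ∈ W, y ∈ F → y ∈ φ '' N := by
    intro y hy hyF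
    rw [← hb] at hyF
    obtain ⟨w, hw, rfl⟩ := hyF
    refine ⟨w, ⟨?_, hw⟩, rfl⟩
    by_contra h
    exact hy ⟨w, ⟨Metric.ball_subset_closedBall hw, h⟩, rfl⟩
  obtain ⟨a, haW, haA⟩ := mem_closure_iff.1 hxA W hW hxW
  obtain ⟨b, hbW, hbB⟩ := mem_closure_iff.1 hxB W hW hxW
  have haN := hWN a haW (hAF haA)
  have hbN := hWN b hbW (hBF hbB)
  rcases hNc.subset_or_subset hA hB hAB hNsub with h | h
  · exact hAB.le_bot ⟨h hbN, hbB⟩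
  · exact hAB.le_bot ⟨haA, h haN⟩

/-- Near a point of the arc of an edge there are exactly two faces, and all of the edge that is
nearby is in the closure of both. -/
theorem exists_two_faces (hn : ∀ F ∈ G.faces, NoBoundaryIdentification F) (he : e ∈ G.edges)
    (hx : x ∈ e) (hxv : x ∉ G.verts) :
    ∃ U F F', IsOpen U ∧ x ∈ U ∧ F ∈ G.faces ∧ F' ∈ G.faces ∧ F ≠ F' ∧ U ⊆ F ∪ F' ∪ e ∧
      U ∩ e ⊆ closure F ∩ closure F' ∧ U ∩ G.verts = ∅ := by
  obtain ⟨U, A, B, hU, hxU, hA, hB, hAc, hBc, hAn, hBn, hAB, hUAB, hAs, hBs, hcl, hv⟩ :=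
    exists_local_sides he hx hxv
  obtain ⟨F, hF, hAF⟩ := exists_face_of_isPreconnected hAc hAn hAs
  obtain ⟨F', hF', hBF⟩ := exists_face_of_isPreconnected hBc hBn hBs
  refine ⟨U, F, F', hU, hxU, hF, hF', ?_, ?_, ?_, hv⟩
  · rintro rfl
    exact not_both_sides hF (hn F hF) he hU hxU hA hB hAB hUAB (hcl ⟨hxU, hx⟩).1
      (hcl ⟨hxU, hx⟩).2 hAF hBF
  · exact hUAB.trans (union_subset_union_left _ (union_subset_union hAF hBF))
  · exact hcl.trans (inter_subset_inter (closure_mono hAF) (closure_mono hBF))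

theorem face_of_mem_closure {U F₁ F₂ : Set Sphere2} (hU : IsOpen U) (hxU : x ∈ U)
    (hF₁ : F₁ ∈ G.faces) (hF₂ : F₂ ∈ G.faces) (he : e ∈ G.edges) (hUF : U ⊆ F₁ ∪ F₂ ∪ e)
    (hF : F ∈ G.faces) (hx : x ∈ closure F) : F = F₁ ∨ F = F₂ := by
  obtain ⟨y, hyU, hyF⟩ := mem_closure_iff.1 hx U hU hxU
  rcases hUF hyU with (h | h) | h
  · exact Or.inl (face_eq_of_mem hF hF₁ hyF h)
  · exact Or.inr (face_eq_of_mem hF hF₂ hyF h)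
  · exact absurd (edge_subset_support he h) (face_subset hF hyF)

/-- A face whose closure contains a point of the arc of an edge has that edge on its boundary. -/
theorem edge_subset_closure (hn : ∀ F ∈ G.faces, NoBoundaryIdentification F) (he : e ∈ G.edges)
    (hx : x ∈ e) (hxv : x ∉ G.verts) (hF : F ∈ G.faces) (hxF : x ∈ closure F) :
    e ⊆ closure F := by
  apply edge_subset_of_arc_subset he isClosed_closure
  have hop : ∀ y ∈ (e \ G.verts) ∩ closure F, ∃ U, IsOpen U ∧ y ∈ U ∧ U ∩ e ⊆ closure F := by
    rintro y ⟨⟨hye, hyv⟩, hyF⟩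
    obtain ⟨U, F₁, F₂, hU, hyU, hF₁, hF₂, -, hUF, hcl, -⟩ := exists_two_faces hn he hye hyv
    refine ⟨U, hU, hyU, ?_⟩
    rcases face_of_mem_closure hU hyU hF₁ hF₂ he hUF hF hyF with rfl | rfl
    · exact hcl.trans inter_subset_left
    · exact hcl.trans inter_subset_right
  choose! U hU hyU hUe using hop
  -- the points of the arc in `closure F` form a closed and open part of the connected arc
  set O := ⋃ y ∈ (e \ G.verts) ∩ closure F, U y
  have hO : IsOpen O := isOpen_biUnion hU
  have hOsub : O ∩ e ⊆ closure F := by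
    rintro z ⟨hz, hze⟩
    simp only [O, mem_iUnion] at hz
    obtain ⟨y, hy, hz⟩ := hz
    exact hUe y hy ⟨hz, hze⟩
  have hcov : e \ G.verts ⊆ O ∪ (closure F)ᶜ := by
    intro y hy
    by_cases h : y ∈ closure F
    · exact Or.inl (mem_biUnion ⟨hy, h⟩ (hyU y ⟨hy, h⟩))
    · exact Or.inr h
  intro y hy
  by_contra hyF
  obtain ⟨z, hz, hzO, hzF⟩ := isPreconnected_arc he O _ hO isClosed_closure.isOpen_compl hcov
    ⟨x, ⟨hx, hxv⟩, mem_biUnion ⟨⟨hx, hxv⟩, hxF⟩ (hyU x ⟨⟨hx, hxv⟩, hxF⟩)⟩ ⟨y, hy, hyF⟩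
  exact hzF (hOsub ⟨hzO, hz.1⟩)

/-- Every edge is on the boundary of exactly two faces. -/
theorem exists_faces_of_edge (hn : ∀ F ∈ G.faces, NoBoundaryIdentification F)
    (he : e ∈ G.edges) :
    ∃ F₁ ∈ G.faces, ∃ F₂ ∈ G.faces, F₁ ≠ F₂ ∧ ∀ F ∈ G.faces,
      (e ⊆ closure F ↔ F = F₁ ∨ F = F₂) := by
  obtain ⟨x, hx, hxv⟩ := arc_nonempty he
  obtain ⟨U, F₁, F₂, hU, hxU, hF₁, hF₂, hne, hUF, hcl, -⟩ := exists_two_faces hn he hx hxv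
  refine ⟨F₁, hF₁, F₂, hF₂, hne, fun F hF => ⟨fun h =>
    face_of_mem_closure hU hxU hF₁ hF₂ he hUF hF (h hx), ?_⟩⟩
  rintro (rfl | rfl)
  · exact edge_subset_closure hn he hx hxv hF (hcl ⟨hxU, hx⟩).1
  · exact edge_subset_closure hn he hx hxv hF (hcl ⟨hxU, hx⟩).2

end SphereGraph

namespace SphereGraph

variable {G : SphereGraph} {e e' F F' : Set Sphere2} {x y v : Sphere2}

/-! ### Faces and edges around a point -/

/-- The open star of a point: the complement of all faces, edges and vertices whose closure does
not contain it. -/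
def star (G : SphereGraph) (x : Sphere2) : Set Sphere2 :=
  ((⋃ F ∈ {F ∈ G.faces | x ∉ closure F}, closure F) ∪ (⋃ e ∈ {e ∈ G.edges | x ∉ e}, e) ∪
    (G.verts \ {x}))ᶜ

theorem isOpen_star (hfin : G.faces.Finite) (x : Sphere2) : IsOpen (G.star x) := by
  refine isOpen_compl_iff.2 ?_
  refine ((Finite.isClosed_biUnion (hfin.subset (sep_subset _ _)) fun _ _ => isClosed_closure).union
    (Finite.isClosed_biUnion (G.finite_edges.subset (sep_subset _ _))
      fun _ h => isClosed_edge h.1)).union (G.finite_verts.subset sdiff_subset).isClosed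

theorem mem_star_self (x : Sphere2) : x ∈ G.star x := by
  simp [star]

theorem mem_closure_of_mem_star (hy : y ∈ G.star x) (hF : F ∈ G.faces) (h : y ∈ closure F) :
    x ∈ closure F := by
  by_contra hx
  exact hy (Or.inl (Or.inl (mem_biUnion (show F ∈ {F ∈ G.faces | x ∉ closure F} from ⟨hF, hx⟩) h)))

theorem mem_edge_of_mem_star (hy : y ∈ G.star x) (he : e ∈ G.edges) (h : y ∈ e) : x ∈ e := by
  by_contra hx
  exact hy (Or.inl (Or.inr (mem_biUnion (show e ∈ {e ∈ G.edges | x ∉ e} from ⟨he, hx⟩) h)))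

theorem eq_of_mem_star (hy : y ∈ G.star x) (h : y ∈ G.verts) : y = x := by
  by_contra hx
  exact hy (Or.inr ⟨h, hx⟩)

theorem exists_mem_closure (hn : ∀ F ∈ G.faces, NoBoundaryIdentification F)
    (hv : ∀ v ∈ G.verts, ∃ e ∈ G.edges, v ∈ e) (x : Sphere2) :
    ∃ F ∈ G.faces, x ∈ closure F := by
  have key : ∀ e ∈ G.edges, x ∈ e → ∃ F ∈ G.faces, x ∈ closure F := by
    intro e he hx
    obtain ⟨F, hF, F₂, -, -, h⟩ := exists_faces_of_edge hn he
    exact ⟨F, hF, (h F hF).2 (Or.inl rfl) hx⟩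
  by_cases hx : x ∈ G.support
  · rcases hx with hx | ⟨e, he, hx⟩
    · obtain ⟨e, he, h⟩ := hv x hx
      exact key e he h
    · exact key e he hx
  · obtain ⟨F, hF, h⟩ := exists_face_of_notMem hx
    exact ⟨F, hF, subset_closure h⟩

theorem exists_common_edge (hn : ∀ F ∈ G.faces, NoBoundaryIdentification F)
    (hF : F ∈ G.faces) (hF' : F' ∈ G.faces) (hne : F ≠ F') (hx : x ∈ closure F)
    (hx' : x ∈ closure F') (hxv : x ∉ G.verts) :
    ∃ e ∈ G.edges, x ∈ e ∧ e ⊆ closure F ∧ e ⊆ closure F' := by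
  have hs : x ∈ G.support := by
    by_contra hs
    obtain ⟨F₀, hF₀, h⟩ := exists_face_of_notMem hs
    exact hne ((face_eq_of_mem_closure hF₀ hF h hx).symm.trans
      (face_eq_of_mem_closure hF₀ hF' h hx'))
  rcases hs with h | ⟨e, he, h⟩
  · exact absurd h hxv
  · exact ⟨e, he, h, edge_subset_closure hn he h hxv hF hx,
      edge_subset_closure hn he h hxv hF' hx'⟩

/-- Points of the sphere have arbitrarily small neighbourhoods that stay connected when the point
is removed. -/
theorem exists_punctured_nhd {O : Set Sphere2} (hO : IsOpen O) (hv : v ∈ O) :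
    ∃ U ⊆ O, IsOpen U ∧ v ∈ U ∧ IsPreconnected (U \ {v}) := by
  let φ := chartAt (EuclideanSpace ℝ (Fin 2)) v
  have hvφ : v ∈ φ.source := mem_chart_source _ v
  have ho : IsOpen (φ '' (φ.source ∩ O)) :=
    φ.isOpen_image_of_subset_source (φ.open_source.inter hO) inter_subset_left
  obtain ⟨r, hr, hb⟩ := Metric.isOpen_iff.1 ho (φ v) (mem_image_of_mem _ ⟨hvφ, hv⟩)
  let ψ := OpenPartialHomeomorph.univBall (φ v) r
  have hψs : ψ.source = univ := OpenPartialHomeomorph.univBall_source _ _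
  have hψt : ψ.target = Metric.ball (φ v) r := OpenPartialHomeomorph.univBall_target _ hr
  have hψ0 : ψ 0 = φ v := OpenPartialHomeomorph.univBall_apply_zero _ _
  have hsub : Metric.ball (φ v) r ⊆ φ.target := fun z hz => by
    obtain ⟨y, hy, rfl⟩ := hb hz
    exact φ.map_source hy.1
  have hmem : ∀ z, ψ z ∈ Metric.ball (φ v) r := fun z => hψt ▸ ψ.map_source (hψs ▸ mem_univ z)
  refine ⟨φ.symm '' Metric.ball (φ v) r, ?_,
    φ.symm.isOpen_image_of_subset_source Metric.isOpen_ball hsub,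
    ⟨φ v, Metric.mem_ball_self hr, φ.left_inv hvφ⟩, ?_⟩
  · rintro _ ⟨z, hz, rfl⟩
    obtain ⟨y, hy, rfl⟩ := hb hz
    rw [φ.left_inv hy.1]
    exact hy.2
  · have heq : φ.symm '' Metric.ball (φ v) r \ {v} = (φ.symm ∘ ψ) '' {0}ᶜ := by
      ext y
      constructor
      · rintro ⟨⟨z, hz, rfl⟩, hne⟩
        rw [← hψt] at hz
        refine ⟨ψ.symm z, ?_, by simp [ψ.right_inv hz]⟩
        intro h0
        apply hne
        rw [mem_singleton_iff] at h0 ⊢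
        rw [← ψ.right_inv hz, h0, hψ0, φ.left_inv hvφ]
      · rintro ⟨z, hz, rfl⟩
        refine ⟨⟨ψ z, hmem z, rfl⟩, fun h => hz ?_⟩
        have h1 : ψ z = φ v := by
          rw [← φ.right_inv (hsub (hmem z))]
          exact congrArg φ h
        exact ψ.injOn (hψs ▸ mem_univ z) (hψs ▸ mem_univ _) (h1.trans hψ0.symm)
    rw [heq]
    refine IsPreconnected.image
      (isConnected_compl_singleton_of_one_lt_rank ?_ 0).isPreconnected _ ?_
    · exact Module.one_lt_rank_of_one_lt_finrank (by simp)
    · refine φ.continuousOn_symm.comp (ψ.continuousOn.mono (hψs ▸ subset_univ _)) ?_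
      exact fun z _ => hsub (hmem z)

/-- If a set `C` of faces is closed under adjacency at the points of a preconnected set `Y`, and `Y`
meets one face of `C`, then it meets no other faces: the closures of the faces in `C` and those of
the other faces would disconnect `Y`. -/
theorem mem_of_adj_of_isPreconnected (hfin : G.faces.Finite)
    (hn : ∀ F ∈ G.faces, NoBoundaryIdentification F)
    (hv : ∀ v ∈ G.verts, ∃ e ∈ G.edges, v ∈ e) {Y : Set Sphere2} (hY : IsPreconnected Y)
    {C : Set (Set Sphere2)} (hC : C ⊆ G.faces)
    (hadj : ∀ y ∈ Y, ∀ F ∈ C, ∀ F' ∈ G.faces, y ∈ closure F → y ∈ closure F' → F' ∈ C)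
    (h1 : ∃ F ∈ C, (Y ∩ F).Nonempty) (hF : F ∈ G.faces) (h2 : (Y ∩ F).Nonempty) : F ∈ C := by
  by_contra hFC
  have hu : IsClosed (⋃ F ∈ C, closure F) :=
    Finite.isClosed_biUnion (hfin.subset hC) fun _ _ => isClosed_closure
  have hw : IsClosed (⋃ F ∈ G.faces \ C, closure F) :=
    Finite.isClosed_biUnion (hfin.subset sdiff_subset) fun _ _ => isClosed_closure
  have hcov : Y ⊆ (⋃ F ∈ C, closure F) ∪ ⋃ F ∈ G.faces \ C, closure F := by
    intro y _
    obtain ⟨F, hF, h⟩ := exists_mem_closure hn hv y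
    by_cases hFC : F ∈ C
    · exact Or.inl (mem_biUnion hFC h)
    · exact Or.inr (mem_biUnion (show F ∈ G.faces \ C from ⟨hF, hFC⟩) h)
  obtain ⟨F₁, hF₁, y, hyY, hy⟩ := h1
  obtain ⟨z, hzY, hz⟩ := h2
  obtain ⟨w, hwY, hwu, hww⟩ := isPreconnected_closed_iff.1 hY _ _ hu hw hcov
    ⟨y, hyY, mem_biUnion hF₁ (subset_closure hy)⟩
    ⟨z, hzY, mem_biUnion (show F ∈ G.faces \ C from ⟨hF, hFC⟩) (subset_closure hz)⟩
  simp only [mem_iUnion] at hwu hww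
  obtain ⟨A, hA, hwA⟩ := hwu
  obtain ⟨B, hB, hwB⟩ := hww
  exact hB.2 (hadj w hwY A hA B hB.1 hwA hwB)

/-- The faces around a vertex form a single cycle: a nonempty set of them that is closed under
adjacency along edges at the vertex contains all of them. -/
theorem link_connected (hfin : G.faces.Finite)
    (hn : ∀ F ∈ G.faces, NoBoundaryIdentification F)
    (hv : ∀ v ∈ G.verts, ∃ e ∈ G.edges, v ∈ e)
    {C : Set (Set Sphere2)} (hC : ∀ F ∈ C, F ∈ G.faces ∧ v ∈ closure F)
    (hadj : ∀ F ∈ C, ∀ F' ∈ G.faces, ∀ e ∈ G.edges, v ∈ e → e ⊆ closure F → e ⊆ closure F' →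
      F' ∈ C) (hne : C.Nonempty) (hvv : v ∈ G.verts) (hF : F ∈ G.faces) (hvF : v ∈ closure F) :
    F ∈ C := by
  obtain ⟨U, hUs, hU, hvU, hUc⟩ := exists_punctured_nhd (isOpen_star hfin v) (mem_star_self v)
  have hmeet : ∀ F ∈ G.faces, v ∈ closure F → ((U \ {v}) ∩ F).Nonempty := by
    intro F hF h
    obtain ⟨y, hyU, hyF⟩ := mem_closure_iff.1 h U hU hvU
    refine ⟨y, ⟨hyU, ?_⟩, hyF⟩
    rintro rfl
    exact face_subset hF hyF (Or.inl hvv)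
  obtain ⟨F₁, hF₁⟩ := hne
  refine mem_of_adj_of_isPreconnected hfin hn hv hUc (fun F hF => (hC F hF).1) ?_
    ⟨F₁, hF₁, hmeet F₁ (hC F₁ hF₁).1 (hC F₁ hF₁).2⟩ hF (hmeet F hF hvF)
  rintro y ⟨hyU, hyv⟩ A hA B hB hyA hyB
  by_cases hAB : A = B
  · exact hAB ▸ hA
  have hyv' : y ∉ G.verts := fun h => hyv (eq_of_mem_star (hUs hyU) h)
  obtain ⟨e, he, hye, h1, h2⟩ := exists_common_edge hn (hC A hA).1 hB hAB hyA hyB hyv'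
  exact hadj A hA B hB e he (mem_edge_of_mem_star (hUs hyU) he hye) h1 h2

/-- Any two faces are connected by a chain of faces with common edges. -/
theorem dual_connected (hfin : G.faces.Finite)
    (hn : ∀ F ∈ G.faces, NoBoundaryIdentification F)
    (hv : ∀ v ∈ G.verts, ∃ e ∈ G.edges, v ∈ e) {C : Set (Set Sphere2)} (hC : C ⊆ G.faces)
    (hadj : ∀ F ∈ C, ∀ F' ∈ G.faces, ∀ e ∈ G.edges, e ⊆ closure F → e ⊆ closure F' → F' ∈ C)
    (hne : C.Nonempty) (hF : F ∈ G.faces) : F ∈ C := by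
  obtain ⟨F₁, hF₁⟩ := hne
  refine mem_of_adj_of_isPreconnected hfin hn hv isPreconnected_univ hC ?_
    ⟨F₁, hF₁, by simpa using face_nonempty (hC hF₁)⟩ hF (by simpa using face_nonempty hF)
  rintro y - A hA B hB hyA hyB
  by_cases hAB : A = B
  · exact hAB ▸ hA
  -- faces that only share a vertex are connected through the faces around it
  by_cases hy : y ∈ G.verts
  · refine (link_connected (C := {F ∈ C | y ∈ closure F}) hfin hn hv (fun F hF => ⟨hC hF.1, hF.2⟩)
      ?_ ⟨A, hA, hyA⟩ hy hB hyB).1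
    exact fun F hF F' hF' e he hye h1 h2 => ⟨hadj F hF.1 F' hF' e he h1 h2, h2 hye⟩
  · obtain ⟨e, he, hye, h1, h2⟩ := exists_common_edge hn (hC hA) hB hAB hyA hyB hy
    exact hadj A hA B hB e he h1 h2

end SphereGraph

/-! ### The boundary of a tile -/

/-- A finite set of reals in `[0, 1]` that contains both end points, in increasing order. -/
theorem exists_strictMono_enum {T : Set ℝ} (hT : T.Finite) (hsub : T ⊆ Icc 0 1) (h0 : (0 : ℝ) ∈ T)
    (h1 : (1 : ℝ) ∈ T) : ∃ (k : ℕ) (t : ℕ → ℝ), 0 < k ∧ t 0 = 0 ∧ t k = 1 ∧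
      (∀ i j, i < j → j ≤ k → t i < t j) ∧ (∀ s, s ∈ T ↔ ∃ i ≤ k, t i = s) := by
  classical
  obtain ⟨S, rfl⟩ := hT.exists_finset_coe
  have hc : 1 < S.card := Finset.one_lt_card.2 ⟨0, h0, 1, h1, zero_ne_one⟩
  obtain ⟨k, hk⟩ : ∃ k, S.card = k + 1 := ⟨S.card - 1, by omega⟩
  have hkpos : 0 < k := by omega
  let f := S.orderEmbOfFin hk
  have hf : ∀ s, s ∈ S ↔ ∃ i, f i = s := fun s => by
    have := S.range_orderEmbOfFin hk
    rw [← Finset.mem_coe, ← this]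
    rfl
  let t : ℕ → ℝ := fun i => f (Fin.ofNat (k + 1) i)
  have hval : ∀ i ≤ k, ((Fin.ofNat (k + 1) i : Fin (k + 1)) : ℕ) = i := fun i hi =>
    Nat.mod_eq_of_lt (by omega)
  have hlt : ∀ i j, i < j → j ≤ k → t i < t j := by
    intro i j hij hj
    apply f.strictMono
    rw [Fin.lt_def, hval i (by omega), hval j hj]
    exact hij
  have hmem : ∀ s, s ∈ (S : Set ℝ) ↔ ∃ i ≤ k, t i = s := by
    intro s
    rw [Finset.mem_coe, hf]
    constructor
    · rintro ⟨i, rfl⟩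
      refine ⟨i, by omega, congrArg f (Fin.ext (hval i (by omega)))⟩
    · rintro ⟨i, hi, rfl⟩
      exact ⟨_, rfl⟩
  refine ⟨k, t, hkpos, ?_, ?_, hlt, hmem⟩
  · obtain ⟨i, hi, h⟩ := (hmem 0).1 h0
    have h00 := (hsub ((hmem _).2 ⟨0, by omega, rfl⟩)).1
    rcases Nat.eq_zero_or_pos i with rfl | h'
    · exact h
    · have := hlt 0 i h' hi
      linarith
  · obtain ⟨i, hi, h⟩ := (hmem 1).1 h1
    have h00 := (hsub ((hmem _).2 ⟨k, le_rfl, rfl⟩)).2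
    rcases hi.eq_or_lt with rfl | h'
    · exact h
    · have := hlt i k h' le_rfl
      linarith

/-- A point of `[0, 1]` is a division point or in the interior of a unique subinterval. -/
theorem exists_mem_Ioo_of_enum {k : ℕ} {t : ℕ → ℝ} (h0 : t 0 = 0) (h1 : t k = 1) {s : ℝ}
    (hs : s ∈ Icc (0 : ℝ) 1) (hne : ∀ i ≤ k, t i ≠ s) : ∃ i < k, s ∈ Ioo (t i) (t (i + 1)) := by
  classical
  have hex : ∃ i, s < t i := ⟨k, lt_of_le_of_ne (h1 ▸ hs.2) (hne k le_rfl).symm⟩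
  have hle : Nat.find hex ≤ k := Nat.find_min' hex (lt_of_le_of_ne (h1 ▸ hs.2) (hne k le_rfl).symm)
  have hpos : 0 < Nat.find hex := by
    rw [Nat.find_pos]
    rw [h0]
    exact not_lt.2 hs.1
  refine ⟨Nat.find hex - 1, by omega, ?_, ?_⟩
  · have := Nat.find_min hex (m := Nat.find hex - 1) (by omega)
    exact lt_of_le_of_ne (not_lt.1 this) (hne _ (by omega))
  · have := Nat.find_spec hex
    rwa [Nat.sub_add_cancel hpos]

namespace SphereGraph

variable {G : SphereGraph} {e e' F F' : Set Sphere2} {x y v : Sphere2}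

/-- The boundary of a tile without identified boundary points is a simple closed curve, which may
be parametrized from any of its points. -/
theorem exists_boundary_loop (hn : NoBoundaryIdentification F) (hv : v ∈ closure F \ F) :
    ∃ γ : ℝ → Sphere2, Continuous γ ∧ γ 0 = v ∧ γ 1 = v ∧ InjOn γ (Ico 0 1) ∧
      γ '' Icc 0 1 = closure F \ F := by
  obtain ⟨φ, hc, hi, hb, hcl⟩ := hn
  have hsph : φ '' Metric.sphere 0 1 = closure F \ F := by
    have h : closure F \ F = φ '' Metric.closedBall 0 1 \ φ '' Metric.ball 0 1 := by rw [hb, hcl]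
    rw [h, ← hi.image_sdiff_subset Metric.ball_subset_closedBall, Metric.closedBall_sdiff_ball]
  obtain ⟨z, hz, rfl⟩ := hsph ▸ hv
  have hz1 : ‖z‖ = 1 := by simpa using hz
  have hz0 : z ≠ 0 := by
    rintro rfl
    simp at hz1
  let c : ℝ → ℂ := fun t => z * Complex.exp ((2 * Real.pi * t : ℝ) * Complex.I)
  have hcm : ∀ t, c t ∈ Metric.sphere (0 : ℂ) 1 := fun t => by
    rw [mem_sphere_zero_iff_norm, norm_mul, hz1, Complex.norm_exp_ofReal_mul_I, mul_one]
  have hcc : Continuous c := by fun_prop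
  have hinj : ∀ s ∈ Ico (0 : ℝ) 1, ∀ t ∈ Ico (0 : ℝ) 1, c s = c t → s = t := by
    intro s hs t ht h
    have h' := mul_left_cancel₀ hz0 h
    rw [Complex.exp_eq_exp_iff_exists_int] at h'
    obtain ⟨n, hn⟩ := h'
    have h2 : s = t + n := by
      have hI : ((2 * Real.pi * s : ℝ) : ℂ) = ((2 * Real.pi * (t + n) : ℝ) : ℂ) := by
        apply mul_right_cancel₀ Complex.I_ne_zero
        rw [hn]
        push_cast
        ring
      have := Complex.ofReal_injective hI
      have hpi := Real.pi_pos
      exact mul_left_cancel₀ (by positivity : 2 * Real.pi ≠ 0) this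
    have h3 : n = 0 := by
      have h4 : (n : ℝ) < 1 := by linarith [hs.1, hs.2, ht.1, ht.2]
      have h5 : (-1 : ℝ) < n := by linarith [hs.1, hs.2, ht.1, ht.2]
      have h4' : n < 1 := by exact_mod_cast h4
      have h5' : -1 < n := by exact_mod_cast h5
      omega
    simpa [h3] using h2
  refine ⟨φ ∘ c, ?_, ?_, ?_, ?_, ?_⟩
  · exact hc.comp_continuous hcc fun t => Metric.sphere_subset_closedBall (hcm t)
  · simp [c]
  · simp [c]
  · intro s hs t ht h
    exact hinj s hs t ht (hi (Metric.sphere_subset_closedBall (hcm s))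
      (Metric.sphere_subset_closedBall (hcm t)) h)
  · rw [image_comp, ← hsph]
    congr 1
    apply subset_antisymm
    · rintro _ ⟨t, -, rfl⟩
      exact hcm t
    · intro w hw
      have hw1 : ‖w / z‖ = 1 := by
        rw [norm_div, hz1, div_one]
        simpa using hw
      obtain ⟨t, ht, h⟩ : ∃ t ∈ Icc (0 : ℝ) 1,
          Complex.exp ((2 * Real.pi * t : ℝ) * Complex.I) = w / z := by
        have hpi := Real.pi_pos
        have ha := Complex.norm_mul_exp_arg_mul_I (w / z)
        rw [hw1, Complex.ofReal_one, one_mul] at ha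
        have hlo := Complex.neg_pi_lt_arg (w / z)
        have hhi := Complex.arg_le_pi (w / z)
        by_cases hneg : 0 ≤ (w / z).arg
        · refine ⟨(w / z).arg / (2 * Real.pi), ⟨by positivity, ?_⟩, ?_⟩
          · rw [div_le_one (by positivity)]
            linarith
          · rw [mul_div_cancel₀ _ (by positivity), ha]
        · push Not at hneg
          refine ⟨(w / z).arg / (2 * Real.pi) + 1, ⟨?_, ?_⟩, ?_⟩
          · have : -1 ≤ (w / z).arg / (2 * Real.pi) := by
              rw [le_div_iff₀ (by positivity)]
              linarith
            linarith
          · have : (w / z).arg / (2 * Real.pi) ≤ 0 :=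
              div_nonpos_of_nonpos_of_nonneg hneg.le (by positivity)
            linarith
          · rw [mul_add, mul_div_cancel₀ _ (by positivity), mul_one]
            push_cast
            rw [add_mul, Complex.exp_add, ha, Complex.exp_two_pi_mul_I, mul_one]
      refine ⟨t, ht, ?_⟩
      simp only [c]
      rw [h, mul_div_cancel₀ _ hz0]

/-- The boundary of a tile with `n > 0` sides is a closed chain of `n` different vertices and `n`
different edges. -/
theorem exists_boundary_cycle (hn : ∀ F ∈ G.faces, NoBoundaryIdentification F) (hF : F ∈ G.faces)
    {n : ℕ} (hcard : (G.sides F).ncard = n) (hn0 : 0 < n) :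
    ∃ (p : ℕ → Sphere2) (q : ℕ → Set Sphere2), p n = p 0 ∧ InjOn p (Iio n) ∧ InjOn q (Iio n) ∧
      q '' Iio n = G.sides F ∧ p '' Iio n = G.verts ∩ closure F ∧
      ∀ i < n, q i ∩ G.verts = {p i, p (i + 1)} := by
  have hsides : ∀ e, e ∈ G.sides F ↔ e ∈ G.edges ∧ e ⊆ closure F \ F := fun e => Iff.rfl
  obtain ⟨e₀, he₀, he₀F⟩ : (G.sides F).Nonempty := nonempty_of_ncard_ne_zero (by omega)
  obtain ⟨v, b, γ₀, -, hv₀, -⟩ := exists_param he₀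
  have hve : v ∈ e₀ ∩ G.verts := hv₀ ▸ mem_insert _ _
  obtain ⟨γ, hγc, hγ0, hγ1, hγi, hγim⟩ := exists_boundary_loop (hn F hF) (he₀F hve.1)
  have hbd : ∀ s ∈ Icc (0 : ℝ) 1, γ s ∈ closure F \ F := fun s hs => hγim ▸ mem_image_of_mem γ hs
  -- the parameters of the vertices
  set T : Set ℝ := {s ∈ Icc (0 : ℝ) 1 | γ s ∈ G.verts} with hT
  have hTfin : T.Finite := by
    have : T ⊆ {s ∈ Ico (0 : ℝ) 1 | γ s ∈ G.verts} ∪ {1} := by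
      rintro s ⟨hs, hsv⟩
      rcases hs.2.eq_or_lt with h | h
      · exact Or.inr h
      · exact Or.inl ⟨⟨hs.1, h⟩, hsv⟩
    refine Finite.subset (Finite.union ?_ (finite_singleton _)) this
    exact Finite.of_finite_image (G.finite_verts.subset (by rintro _ ⟨s, hs, rfl⟩; exact hs.2))
      (hγi.mono (sep_subset _ _))
  obtain ⟨k, t, hk, ht0, htk, htlt, htT⟩ := exists_strictMono_enum hTfin (sep_subset _ _)
    (show (0 : ℝ) ∈ T from ⟨by simp, hγ0 ▸ hve.2⟩) (show (1 : ℝ) ∈ T from ⟨by simp, hγ1 ▸ hve.2⟩)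
  have htle : ∀ i j, i ≤ j → j ≤ k → t i ≤ t j := by
    intro i j hij hj
    rcases hij.eq_or_lt with rfl | h
    · rfl
    · exact (htlt i j h hj).le
  have htI : ∀ i ≤ k, t i ∈ Icc (0 : ℝ) 1 := fun i hi => ((htT (t i)).2 ⟨i, hi, rfl⟩).1
  have htv : ∀ i ≤ k, γ (t i) ∈ G.verts := fun i hi => ((htT (t i)).2 ⟨i, hi, rfl⟩).2
  have hsubI : ∀ i < k, Icc (t i) (t (i + 1)) ⊆ Icc (0 : ℝ) 1 := fun i hi =>
    Icc_subset_Icc (htI i hi.le).1 (htI (i + 1) hi).2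
  have harcv : ∀ i < k, ∀ s ∈ Ioo (t i) (t (i + 1)), γ s ∉ G.verts := by
    intro i hi s hs hsv
    obtain ⟨j, hj, rfl⟩ := (htT s).1 ⟨hsubI i hi (Ioo_subset_Icc_self hs), hsv⟩
    rcases lt_or_ge i j with h | h
    · exact absurd (htle (i + 1) j h hj) (not_le.2 hs.2)
    · exact absurd (htle j i h hi.le) (not_le.2 hs.1)
  have hedge : ∀ y ∈ closure F \ F, y ∉ G.verts → ∃ e ∈ G.sides F, y ∈ e := by
    intro y hy hyv
    rcases closure_diff_subset_support hF hy with h | ⟨e, he, h⟩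
    · exact absurd h hyv
    · exact ⟨e, ⟨he, (subset_closure_diff_iff hF he).2
        (edge_subset_closure hn he h hyv hF hy.1)⟩, h⟩
  have hinj : ∀ s ∈ Icc (0 : ℝ) 1, ∀ s' ∈ Icc (0 : ℝ) 1, γ s ∉ G.verts → γ s = γ s' → s = s' := by
    intro s hs s' hs' hsv h
    have h1 : ∀ r ∈ Icc (0 : ℝ) 1, γ r ∉ G.verts → r ∈ Ico (0 : ℝ) 1 := by
      intro r hr hrv
      refine ⟨hr.1, lt_of_le_of_ne hr.2 ?_⟩
      rintro rfl
      exact hrv (hγ1 ▸ hve.2)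
    exact hγi (h1 s hs hsv) (h1 s' hs' (h ▸ hsv)) h
  -- every open arc between consecutive vertices is the open arc of an edge
  have harc : ∀ i < k, ∃ e ∈ G.sides F, e \ G.verts = γ '' Ioo (t i) (t (i + 1)) := by
    intro i hi
    have hlt := htlt i (i + 1) (Nat.lt_succ_self i) hi
    obtain ⟨s, hs⟩ := nonempty_Ioo.2 hlt
    have hsI := hsubI i hi (Ioo_subset_Icc_self hs)
    obtain ⟨e, he, hse⟩ := hedge (γ s) (hbd s hsI) (harcv i hi s hs)
    refine ⟨e, he, subset_antisymm ?_ ?_⟩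
    · -- the edge cannot leave the arc other than through a vertex
      have hc1 : IsClosed (γ '' Icc (t i) (t (i + 1))) :=
        (isCompact_Icc.image hγc).isClosed
      have hc2 : IsClosed (γ '' (Icc 0 (t i) ∪ Icc (t (i + 1)) 1)) :=
        ((isCompact_Icc.union isCompact_Icc).image hγc).isClosed
      have hcov : e \ G.verts ⊆
          γ '' Icc (t i) (t (i + 1)) ∪ γ '' (Icc 0 (t i) ∪ Icc (t (i + 1)) 1) := by
        intro y hy
        obtain ⟨r, hr, rfl⟩ := hγim ▸ he.2 hy.1
        rcases le_total r (t i) with h | h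
        · exact Or.inr ⟨r, Or.inl ⟨hr.1, h⟩, rfl⟩
        · rcases le_total r (t (i + 1)) with h' | h'
          · exact Or.inl ⟨r, ⟨h, h'⟩, rfl⟩
          · exact Or.inr ⟨r, Or.inr ⟨h', hr.2⟩, rfl⟩
      have hdisj : (e \ G.verts) ∩
          (γ '' Icc (t i) (t (i + 1)) ∩ γ '' (Icc 0 (t i) ∪ Icc (t (i + 1)) 1)) = ∅ := by
        rw [eq_empty_iff_forall_notMem]
        rintro y ⟨⟨-, hyv⟩, ⟨r, hr, rfl⟩, ⟨r', hr', h⟩⟩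
        have hr'I : r' ∈ Icc (0 : ℝ) 1 := by
          rcases hr' with h | h
          · exact ⟨h.1, h.2.trans (htI i hi.le).2⟩
          · exact ⟨(htI (i + 1) hi).1.trans h.1, h.2⟩
        have := hinj r (hsubI i hi hr) r' hr'I hyv h.symm
        subst this
        rcases hr' with h' | h'
        · exact hyv (le_antisymm h'.2 hr.1 ▸ htv i hi.le)
        · exact hyv (le_antisymm h'.1 hr.2 ▸ htv (i + 1) hi)
      have hor := isPreconnected_iff_subset_of_disjoint_closed.1 (isPreconnected_arc he.1)
        _ _ hc1 hc2 hcov hdisj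
      have hse' : γ s ∈ e \ G.verts := ⟨hse, harcv i hi s hs⟩
      rcases hor with h | h
      · intro y hy
        obtain ⟨r, hr, rfl⟩ := h hy
        refine ⟨r, ⟨lt_of_le_of_ne hr.1 ?_, lt_of_le_of_ne hr.2 ?_⟩, rfl⟩
        · rintro rfl
          exact hy.2 (htv i hi.le)
        · rintro rfl
          exact hy.2 (htv (i + 1) hi)
      · exfalso
        have : γ s ∈ (∅ : Set Sphere2) := by
          rw [← hdisj]
          exact ⟨hse', ⟨s, Ioo_subset_Icc_self hs, rfl⟩, h hse'⟩
        exact this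
    · -- the arc cannot pass from one edge to another outside the vertices
      have hpre : IsPreconnected (γ '' Ioo (t i) (t (i + 1))) :=
        isPreconnected_Ioo.image _ hγc.continuousOn
      have hc2 : IsClosed (⋃₀ (G.edges \ {e})) := sUnion_eq_biUnion ▸
        (G.finite_edges.subset sdiff_subset).isClosed_biUnion fun _ h => isClosed_edge h.1
      have hcov : γ '' Ioo (t i) (t (i + 1)) ⊆ e ∪ ⋃₀ (G.edges \ {e}) := by
        rintro _ ⟨r, hr, rfl⟩
        obtain ⟨e', he', h⟩ := hedge (γ r) (hbd r (hsubI i hi (Ioo_subset_Icc_self hr)))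
          (harcv i hi r hr)
        by_cases hee : e' = e
        · exact Or.inl (hee ▸ h)
        · exact Or.inr ⟨e', ⟨he'.1, hee⟩, h⟩
      have hdisj : γ '' Ioo (t i) (t (i + 1)) ∩ (e ∩ ⋃₀ (G.edges \ {e})) = ∅ := by
        rw [eq_empty_iff_forall_notMem]
        rintro _ ⟨⟨r, hr, rfl⟩, h, e', he', h'⟩
        exact he'.2 (edge_eq_of_mem he'.1 he.1 h' h (harcv i hi r hr))
      rcases isPreconnected_iff_subset_of_disjoint_closed.1 hpre _ _ (isClosed_edge he.1) hc2 hcov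
        hdisj with h | h
      · rintro _ ⟨r, hr, rfl⟩
        exact ⟨h ⟨r, hr, rfl⟩, harcv i hi r hr⟩
      · exfalso
        have : γ s ∈ (∅ : Set Sphere2) := by
          rw [← hdisj]
          exact ⟨⟨s, hs, rfl⟩, hse, h ⟨s, hs, rfl⟩⟩
        exact this
  choose! q hqs hq using harc
  have hqclosed : ∀ i < k, q i = γ '' Icc (t i) (t (i + 1)) := by
    intro i hi
    have hlt := htlt i (i + 1) (Nat.lt_succ_self i) hi
    rw [← closure_arc (hqs i hi).1, hq i hi]
    apply subset_antisymm
    · exact ((isCompact_Icc.image hγc).isClosed).closure_subset_iff.2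
        (image_mono Ioo_subset_Icc_self)
    · rw [← closure_Ioo hlt.ne]
      exact image_closure_subset_closure_image hγc
  have hqinj : InjOn q (Iio k) := by
    have key : ∀ i < k, ∀ j < k, q i = q j → ¬ i < j := by
      intro i hi j hj h hij
      obtain ⟨s, hs⟩ := nonempty_Ioo.2 (htlt i (i + 1) (Nat.lt_succ_self i) hi)
      have h1 : γ s ∈ q j \ G.verts := by
        rw [← h, hq i hi]
        exact ⟨s, hs, rfl⟩
      rw [hq j hj] at h1
      obtain ⟨r, hr, hrs⟩ := h1
      have := hinj r (hsubI j hj (Ioo_subset_Icc_self hr)) s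
        (hsubI i hi (Ioo_subset_Icc_self hs)) (harcv j hj r hr) hrs
      subst this
      linarith [htle (i + 1) j hij hj.le, hs.2, hr.1]
    intro i hi j hj h
    rcases lt_trichotomy i j with h' | h' | h'
    · exact absurd h' (key i hi j hj h)
    · exact h'
    · exact absurd h' (key j hj i hi h.symm)
  have hqim : q '' Iio k = G.sides F := by
    apply subset_antisymm
    · rintro _ ⟨i, hi, rfl⟩
      exact hqs i hi
    · intro e he
      obtain ⟨y, hye, hyv⟩ := arc_nonempty he.1
      obtain ⟨s, hs, rfl⟩ := hγim ▸ he.2 hye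
      obtain ⟨i, hi, hsi⟩ := exists_mem_Ioo_of_enum ht0 htk hs
        (fun i hi h => hyv (h ▸ htv i hi))
      refine ⟨i, hi, ?_⟩
      have : γ s ∈ q i \ G.verts := (hq i hi) ▸ ⟨s, hsi, rfl⟩
      exact edge_eq_of_mem (hqs i hi).1 he.1 this.1 hye hyv
  have hkn : k = n := by
    rw [← hcard, ← hqim, hqinj.ncard_image]
    simp
  subst hkn
  refine ⟨γ ∘ t, q, ?_, ?_, hqinj, hqim, ?_, ?_⟩
  · simp [ht0, htk, hγ0, hγ1]
  · have htIco : ∀ i < k, t i ∈ Ico (0 : ℝ) 1 := fun i hi =>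
      ⟨(htI i hi.le).1, htk ▸ htlt i k hi le_rfl⟩
    intro i hi j hj h
    have h' := hγi (htIco i hi) (htIco j hj) h
    rcases lt_trichotomy i j with h1 | h1 | h1
    · exact absurd h' (htlt i j h1 (le_of_lt hj)).ne
    · exact h1
    · exact absurd h' (htlt j i h1 (le_of_lt hi)).ne'
  · apply subset_antisymm
    · rintro _ ⟨i, hi, rfl⟩
      exact ⟨htv i (le_of_lt hi), (hbd _ (htI i (le_of_lt hi))).1⟩
    · rintro y ⟨hyv, hyF⟩
      have hyb : y ∈ closure F \ F := ⟨hyF, fun h => face_subset hF h (Or.inl hyv)⟩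
      rw [← hγim] at hyb
      obtain ⟨s, hs, rfl⟩ := hyb
      obtain ⟨i, hi, rfl⟩ := (htT s).1 ⟨hs, hyv⟩
      rcases hi.eq_or_lt with rfl | h
      · exact ⟨0, hk, by simp [ht0, htk, hγ0, hγ1]⟩
      · exact ⟨i, h, rfl⟩
  · intro i hi
    rw [hqclosed i hi]
    apply subset_antisymm
    · rintro _ ⟨⟨s, hs, rfl⟩, hsv⟩
      rcases hs.1.eq_or_lt with h | h
      · exact Or.inl (by rw [← h]; rfl)
      · rcases hs.2.eq_or_lt with h' | h'
        · exact Or.inr (by rw [h']; rfl)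
        · exact absurd hsv (harcv i hi s ⟨h, h'⟩)
    · have hlt := htlt i (i + 1) (Nat.lt_succ_self i) hi
      rintro _ (rfl | rfl)
      · exact ⟨⟨t i, ⟨le_rfl, hlt.le⟩, rfl⟩, htv i hi.le⟩
      · exact ⟨⟨t (i + 1), ⟨hlt.le, le_rfl⟩, rfl⟩, htv (i + 1) hi⟩

end SphereGraph

/-! ### Cohomology of the sphere -/

/-- Locally constant cocycles are trivial on simply connected spaces: the cocycle
`u y - u x` on `U x ∩ U y` is that of a covering space, and a section of its pullback along `f`
is a function `h` with `h - u x ∘ f` locally constant for all `x`. -/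
theorem exists_sub_locally_constant {X A K : Type} [TopologicalSpace X] [TopologicalSpace A]
    [SimplyConnectedSpace A] [LocallyPathConnectedSpace A] [AddCommGroup K] (f : C(A, X))
    (U : X → Set X) (hU : ∀ x, IsOpen (U x)) (hxU : ∀ x, x ∈ U x) (u : X → X → K)
    (hu : ∀ x y, ∀ z ∈ U x ∩ U y, ∀ᶠ w in 𝓝 z, u y w - u x w = u y z - u x z) :
    ∃ h : A → K, ∀ a x, f a ∈ U x → ∀ᶠ b in 𝓝 a, h b - u x (f b) = h a - u x (f a) := by
  let _ : TopologicalSpace K := ⊥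
  have _ : DiscreteTopology K := ⟨rfl⟩
  -- the fibre is shifted by the cocycle under a change of charts
  let Z : FiberBundleCore X X K :=
    { baseSet := U
      isOpen_baseSet := hU
      indexAt := id
      mem_baseSet_at := hxU
      coordChange := fun x y z v => v + u x z - u y z
      coordChange_self := fun x z _ v => by simp
      continuousOn_coordChange := by
        rintro x y ⟨z, v⟩ ⟨hz, -⟩
        apply ContinuousAt.continuousWithinAt
        have h1 : ∀ᶠ p : X × K in 𝓝 (z, v), u y p.1 - u x p.1 = u y z - u x z :=
          (continuous_fst.tendsto (z, v)).eventually (hu x y z hz)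
        have h2 : ContinuousAt (fun p : X × K => p.2 - (u y z - u x z)) (z, v) := by fun_prop
        refine h2.congr (h1.mono fun p hp => ?_)
        change p.2 - (u y z - u x z) = p.2 + u x p.1 - u y p.1
        rw [← hp]
        abel
      coordChange_comp := fun x y z w _ v => by abel }
  have hcov : IsCoveringMap (Bundle.TotalSpace.proj : Bundle.TotalSpace K Z.Fiber → X) :=
    FiberBundle.isCoveringMap
  obtain ⟨a₀⟩ := (inferInstance : Nonempty A)
  obtain ⟨s, ⟨-, hs⟩, -⟩ :=
    hcov.existsUnique_continuousMap_lifts f a₀ ⟨f a₀, (0 : K)⟩ rfl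
  have hs' : ∀ a, (s a).1 = f a := fun a => congrFun hs a
  let h : A → K := fun a => (show K from (s a).2) + u (s a).1 (s a).1
  refine ⟨h, fun a x hx => ?_⟩
  have hsa : s a ∈ (Z.localTriv x).source := by
    rw [Z.mem_localTriv_source]
    exact (hs' a).symm ▸ hx
  have hcont : ContinuousAt (fun b => ((Z.localTriv x) (s b)).2) a :=
    (continuous_snd.continuousAt.comp ((Z.localTriv x).continuousAt hsa)).comp
      s.continuous.continuousAt
  have hev : ∀ᶠ b in 𝓝 a, ((Z.localTriv x) (s b)).2 = ((Z.localTriv x) (s a)).2 :=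
    hcont (isOpen_discrete {((Z.localTriv x) (s a)).2} |>.mem_nhds rfl)
  refine hev.mono fun b hb => ?_
  have hval : ∀ b, ((Z.localTriv x) (s b)).2 = h b - u x (f b) := fun b => by
    rw [← hs' b]
    rfl
  rw [← hval, ← hval, hb]

namespace SphereGraph

variable {G : SphereGraph} {e e' F F' : Set Sphere2} {x y v : Sphere2}

/-- A function on the edges that is a difference of a function on the faces around every vertex is
globally such a difference. In other words, `H¹(S², ℤ/2) = 0` for the cell complex dual to the
graph. The plane in the proof is the sphere without the vertex `v`; it contains all faces and the
open arcs of all edges. -/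
theorem exists_coboundary (hfin : G.faces.Finite)
    (hn : ∀ F ∈ G.faces, NoBoundaryIdentification F)
    (hv : ∀ v ∈ G.verts, ∃ e ∈ G.edges, v ∈ e) (c : Set Sphere2 → ZMod 2)
    (hloc : ∀ v ∈ G.verts, ∃ g : Set Sphere2 → ZMod 2, ∀ e ∈ G.edges, v ∈ e → ∀ F ∈ G.faces,
      ∀ F' ∈ G.faces, F ≠ F' → e ⊆ closure F → e ⊆ closure F' → g F + g F' = c e) :
    ∃ g : Set Sphere2 → ZMod 2, ∀ e ∈ G.edges, ∀ F ∈ G.faces,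
      ∀ F' ∈ G.faces, F ≠ F' → e ⊆ closure F → e ⊆ closure F' → g F + g F' = c e := by
  classical
  -- near every point of the sphere, `c` is the difference of some function on the faces
  have hgerm : ∀ x, ∃ g : Set Sphere2 → ZMod 2, ∀ e ∈ G.edges, x ∈ e → ∀ F ∈ G.faces,
      ∀ F' ∈ G.faces, F ≠ F' → e ⊆ closure F → e ⊆ closure F' → g F + g F' = c e := by
    intro x
    by_cases hx : x ∈ G.verts
    · exact hloc x hx
    by_cases hxe : ∃ e ∈ G.edges, x ∈ e
    · obtain ⟨e₀, he₀, hxe₀⟩ := hxe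
      obtain ⟨F₁, hF₁, F₂, hF₂, hne, h12⟩ := exists_faces_of_edge hn he₀
      refine ⟨fun F => if F = F₁ then c e₀ else 0, ?_⟩
      intro e he hxe F hF F' hF' hFF' h h'
      obtain rfl := edge_eq_of_mem he he₀ hxe hxe₀ hx
      rcases (h12 F hF).1 h with rfl | rfl <;> rcases (h12 F' hF').1 h' with rfl | rfl
      · exact absurd rfl hFF'
      · simp [hne.symm]
      · simp [hne.symm]
      · exact absurd rfl hFF'
    · exact ⟨0, fun e he hx => absurd ⟨e, he, hx⟩ hxe⟩
  choose g hg using hgerm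
  choose Fz hFz hzF using exists_mem_closure hn hv
  -- `g y - g x` is the same on all faces at `z`, so it defines a locally constant cocycle
  have hcoc : ∀ x y z, z ∈ G.star x → z ∈ G.star y → ∀ F ∈ G.faces, ∀ F' ∈ G.faces,
      z ∈ closure F → z ∈ closure F' → g y F - g x F = g y F' - g x F' := by
    intro x y z hx hy F hF F' hF' h h'
    by_cases hFF' : F = F'
    · rw [hFF']
    by_cases hz : z ∈ G.verts
    · rw [← eq_of_mem_star hx hz, ← eq_of_mem_star hy hz]
      simp
    obtain ⟨e, he, hze, h1, h2⟩ := exists_common_edge hn hF hF' hFF' h h' hz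
    have e1 := hg x e he (mem_edge_of_mem_star hx he hze) F hF F' hF' hFF' h1 h2
    have e2 := hg y e he (mem_edge_of_mem_star hy he hze) F hF F' hF' hFF' h1 h2
    have e3 := e1.trans e2.symm
    generalize g x F = a1, g x F' = a2, g y F = a3, g y F' = a4 at e3 ⊢
    revert a1 a2 a3 a4
    decide
  by_cases hvert : G.verts.Nonempty
  swap
  · refine ⟨0, fun e he => ?_⟩
    obtain ⟨a, b, γ, -, h, -⟩ := exists_param he
    exact absurd ⟨a, (h.symm ▸ mem_insert _ _ : a ∈ e ∩ G.verts).2⟩ hvert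
  obtain ⟨v, hvv⟩ := hvert
  -- the sphere without `v` is simply connected
  let ψ := stereographic' 2 v
  have hψt : ψ.target = univ := stereographic'_target v
  have hψs : ψ.source = {v}ᶜ := stereographic'_source v
  have hψc : Continuous ψ.symm := by
    rw [← continuousOn_univ, ← hψt]
    exact ψ.continuousOn_symm
  obtain ⟨h, hh⟩ := exists_sub_locally_constant (K := ZMod 2) ⟨ψ.symm, hψc⟩ G.star
    (isOpen_star hfin) mem_star_self (fun x z => g x (Fz z)) (by
      rintro x y z ⟨hx, hy⟩
      filter_upwards [(isOpen_star hfin z).mem_nhds (mem_star_self z)] with w hw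
      exact hcoc x y z hx hy _ (hFz w) _ (hFz z)
        (mem_closure_of_mem_star hw (hFz w) (hzF w)) (hzF z))
  have hH : ∀ z, z ≠ v → ∀ᶠ w in 𝓝 z, h (ψ w) - g z (Fz w) = h (ψ z) - g z (Fz z) := by
    intro z hz
    have hzs : z ∈ ψ.source := hψs ▸ hz
    have hca : ContinuousAt ψ z := ψ.continuousAt hzs
    have hleft : ψ.symm (ψ z) = z := ψ.left_inv hzs
    have := hh (ψ z) z (by
      change ψ.symm (ψ z) ∈ _
      rw [hleft]
      exact mem_star_self z)
    filter_upwards [hca.eventually this, ψ.open_source.mem_nhds hzs] with w hw hws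
    change h (ψ w) - g z (Fz (ψ.symm (ψ w))) = h (ψ z) - g z (Fz (ψ.symm (ψ z))) at hw
    rwa [ψ.left_inv hws, hleft] at hw
  have hFzeq : ∀ F ∈ G.faces, ∀ z ∈ F, Fz z = F := fun F hF z hz =>
    (face_eq_of_mem_closure hF (hFz z) hz (hzF z)).symm
  have hnv : ∀ F ∈ G.faces, ∀ z ∈ F, z ≠ v := by
    rintro F hF z hz rfl
    exact face_subset hF hz (Or.inl hvv)
  have hconst : ∀ F ∈ G.faces, ∀ z ∈ F, ∀ w ∈ F, h (ψ z) = h (ψ w) := by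
    intro F hF z hz w hw
    let _ : TopologicalSpace (ZMod 2) := ⊥
    have _ : DiscreteTopology (ZMod 2) := ⟨rfl⟩
    refine (isPreconnected_face hF).constant (f := fun z => h (ψ z)) ?_ hz hw
    intro y hy
    apply ContinuousAt.continuousWithinAt
    refine continuousAt_const.congr (f := fun _ => h (ψ y)) ?_
    filter_upwards [hH y (hnv F hF y hy), (isOpen_face hF).mem_nhds hy] with w hw hwF
    rw [hFzeq F hF w hwF, hFzeq F hF y hy] at hw
    exact (sub_left_injective hw).symm
  have _ : Nonempty Sphere2 := ⟨v⟩
  choose! pt hpt using fun F (hF : F ∈ G.faces) => face_nonempty hF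
  refine ⟨fun F => h (ψ (pt F)), fun e he F hF F' hF' hne h1 h2 => ?_⟩
  obtain ⟨z, hze, hzv⟩ := arc_nonempty he
  have hzne : z ≠ v := by
    rintro rfl
    exact hzv hvv
  have hval : ∀ F ∈ G.faces, z ∈ closure F →
      h (ψ (pt F)) - g z F = h (ψ z) - g z (Fz z) := by
    intro F hF hzF
    obtain ⟨w, hw, hwF⟩ := mem_closure_iff_nhds.1 hzF _ (hH z hzne)
    have hw : h (ψ w) - g z (Fz w) = h (ψ z) - g z (Fz z) := hw
    rw [hconst F hF _ (hpt F hF) w hwF, ← hw, hFzeq F hF w hwF]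
  have e1 := hval F hF (h1 hze)
  have e2 := hval F' hF' (h2 hze)
  have e3 := hg z e he hze F hF F' hF' hne h1 h2
  have e4 := e1.trans e2.symm
  rw [← e3]
  change h (ψ (pt F)) + h (ψ (pt F')) = _
  generalize h (ψ (pt F)) = a1, h (ψ (pt F')) = a2, g z F = a3, g z F' = a4 at e4 ⊢
  revert a1 a2 a3 a4
  decide

end SphereGraph

/-! ### Counting the vertices -/

/-- A predicate that holds for exactly two elements. -/
def IsPair {α : Type*} (p : α → Prop) : Prop :=
  ∃ a b, a ≠ b ∧ ∀ x, p x ↔ x = a ∨ x = b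

namespace IsPair

variable {α : Type*} {p : α → Prop}

theorem filter_eq [Fintype α] [DecidableEq α] [DecidablePred p] (h : IsPair p) :
    ∃ a b, a ≠ b ∧ p a ∧ p b ∧ Finset.univ.filter p = {a, b} := by
  obtain ⟨a, b, hab, h⟩ := h
  refine ⟨a, b, hab, (h a).2 (Or.inl rfl), (h b).2 (Or.inr rfl), ?_⟩
  ext x
  simp [h]

theorem card_filter [Fintype α] [DecidablePred p] (h : IsPair p) :
    (Finset.univ.filter p).card = 2 := by
  classical
  obtain ⟨a, b, hab, -, -, h⟩ := h.filter_eq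
  rw [h, Finset.card_pair hab]

/-- Besides `a`, there is exactly one other element with the property. -/
theorem exists_other (h : IsPair p) {a : α} (ha : p a) :
    ∃ b, b ≠ a ∧ p b ∧ ∀ x, p x → x = a ∨ x = b := by
  obtain ⟨c, d, hcd, h⟩ := h
  rcases (h a).1 ha with rfl | rfl
  · exact ⟨d, hcd.symm, (h d).2 (Or.inr rfl), fun x hx => (h x).1 hx⟩
  · exact ⟨c, hcd, (h c).2 (Or.inl rfl), fun x hx => ((h x).1 hx).symm⟩

theorem eq_of_ne (h : IsPair p) {a b c : α} (ha : p a) (hb : p b) (hc : p c) (hba : b ≠ a)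
    (hca : c ≠ a) : b = c := by
  obtain ⟨d, -, -, h⟩ := h.exists_other ha
  rw [(h b hb).resolve_left hba, (h c hc).resolve_left hca]

theorem eq_or_eq (h : IsPair p) {a b c : α} (ha : p a) (hb : p b) (hc : p c) (hba : b ≠ a) :
    c = a ∨ c = b := by
  by_cases hca : c = a
  · exact Or.inl hca
  · exact Or.inr (h.eq_of_ne ha hc hb hca hba)

end IsPair

section Incidence

variable {A B : Type*} [Fintype B]

open Classical in
/-- The linear map that sums a function over the elements incident with a given one. -/
noncomputable def incidenceMap (R : A → B → Prop) : (B → ZMod 2) →ₗ[ZMod 2] (A → ZMod 2) where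
  toFun g a := ∑ b with R a b, g b
  map_add' g h := by
    ext a
    simp [Finset.sum_add_distrib]
  map_smul' t g := by
    ext a
    simp [Finset.mul_sum]

open Classical in
theorem incidenceMap_apply (R : A → B → Prop) (g : B → ZMod 2) (a : A) :
    incidenceMap R g a = ∑ b with R a b, g b := rfl

theorem incidenceMap_apply_of_ne {R : A → B → Prop} {a : A} (h : IsPair (R a)) {b b' : B}
    (hb : R a b) (hb' : R a b') (hne : b ≠ b') (g : B → ZMod 2) :
    incidenceMap R g a = g b + g b' := by
  classical
  obtain ⟨c, d, hcd, hc, hd, hf⟩ := h.filter_eq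
  rw [incidenceMap_apply, hf, Finset.sum_pair hcd]
  rcases h.eq_or_eq hc hd hb hcd.symm with rfl | rfl
  · rw [h.eq_of_ne hb hd hb' hcd.symm hne.symm]
  · rw [h.eq_of_ne hb hc hb' hcd hne.symm, add_comm]

theorem incidenceMap_const {R : A → B → Prop} (h : ∀ a, IsPair (R a)) :
    incidenceMap R (fun _ => 1) = 0 := by
  ext a
  obtain ⟨c, d, hcd, hR⟩ := h a
  rw [incidenceMap_apply_of_ne (h a) ((hR c).2 (Or.inl rfl)) ((hR d).2 (Or.inr rfl)) hcd]
  rfl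

variable [Fintype A]

open Classical in
theorem card_mul_eq_card_mul {R : A → B → Prop} {m n : ℕ}
    (hA : ∀ a, (Finset.univ.filter (R a)).card = m)
    (hB : ∀ b, (Finset.univ.filter fun a => R a b).card = n) :
    Fintype.card A * m = Fintype.card B * n := by
  have := Finset.sum_card_bipartiteAbove_eq_sum_card_bipartiteBelow (s := Finset.univ)
    (t := Finset.univ) R
  simp only [Finset.bipartiteAbove, Finset.bipartiteBelow, hA, hB] at this
  simpa using this

/-- The sum over all elements, as a linear form. -/
noncomputable def sumMap (A : Type*) [Fintype A] : (A → ZMod 2) →ₗ[ZMod 2] ZMod 2 where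
  toFun c := ∑ a, c a
  map_add' g h := by simp [Finset.sum_add_distrib]
  map_smul' t g := by simp [Finset.mul_sum]

theorem finrank_ker_sumMap [Nonempty A] :
    Module.finrank (ZMod 2) (LinearMap.ker (sumMap A)) + 1 = Fintype.card A := by
  classical
  have h := LinearMap.finrank_range_add_finrank_ker (sumMap A)
  have hs : LinearMap.range (sumMap A) = ⊤ := by
    rw [LinearMap.range_eq_top]
    intro t
    obtain ⟨a⟩ := (inferInstance : Nonempty A)
    exact ⟨Pi.single a t, by simp [sumMap]⟩
  rw [hs, finrank_top, Module.finrank_self, Module.finrank_fintype_fun_eq_card] at h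
  omega

theorem range_incidenceMap_le {R : A → B → Prop} (h : ∀ b, IsPair fun a => R a b) :
    LinearMap.range (incidenceMap R) ≤ LinearMap.ker (sumMap A) := by
  classical
  rintro _ ⟨g, rfl⟩
  rw [LinearMap.mem_ker]
  change ∑ a, ∑ b with R a b, g b = 0
  simp only [Finset.sum_filter]
  rw [Finset.sum_comm]
  refine Finset.sum_eq_zero fun b _ => ?_
  rw [← Finset.sum_filter, Finset.sum_const, (h b).card_filter]
  simp only [nsmul_eq_mul]
  rw [show ((2 : ℕ) : ZMod 2) = 0 from rfl, zero_mul]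

/-- On a cycle, given as a connected incidence relation in which every element is incident with
exactly two others, functions with sum zero are differences. -/
theorem exists_incidenceMap_eq [Nonempty A] {R : A → B → Prop} (hA : ∀ a, IsPair (R a))
    (hB : ∀ b, IsPair fun a => R a b)
    (hconn : ∀ C : Set B, C.Nonempty → (∀ a, ∀ b ∈ C, ∀ b', R a b → R a b' → b' ∈ C) →
      ∀ b, b ∈ C) {c : A → ZMod 2} (hc : ∑ a, c a = 0) :
    ∃ g, incidenceMap R g = c := by
  classical
  have hcard : Fintype.card A = Fintype.card B := by
    have := card_mul_eq_card_mul (R := R) (fun a => (hA a).card_filter)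
      (fun b => (hB b).card_filter)
    omega
  -- by connectedness only constants are in the kernel, which bounds the rank from below
  have hker : LinearMap.ker (incidenceMap R) ≤ Submodule.span (ZMod 2) {fun _ => 1} := by
    intro g hg
    rw [LinearMap.mem_ker] at hg
    obtain ⟨a₀⟩ := (inferInstance : Nonempty A)
    obtain ⟨b₀, -⟩ := hA a₀
    have hconst : ∀ b, b ∈ {b | g b = g b₀} := by
      refine hconn _ ⟨b₀, rfl⟩ ?_
      intro a b hb b' h h'
      by_cases hbb : b = b'
      · exact hbb ▸ hb
      have := incidenceMap_apply_of_ne (hA a) h h' hbb g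
      have h0 : g b + g b' = 0 := by
        rw [← this, hg]
        rfl
      have hb : g b = g b₀ := hb
      change g b' = g b₀
      rw [← hb]
      clear this
      generalize g b = s, g b' = t at h0 ⊢
      revert s t
      decide
    rw [Submodule.mem_span_singleton]
    exact ⟨g b₀, by ext b; simpa using (hconst b).symm⟩
  have h1 : Module.finrank (ZMod 2) (LinearMap.ker (incidenceMap R)) ≤ 1 :=
    (Submodule.finrank_mono hker).trans ((finrank_span_le_card _).trans (by simp))
  have h2 := LinearMap.finrank_range_add_finrank_ker (incidenceMap R)
  rw [Module.finrank_fintype_fun_eq_card] at h2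
  have h3 := finrank_ker_sumMap (A := A)
  have heq := Submodule.eq_of_le_of_finrank_le (range_incidenceMap_le hB) (by omega)
  have : c ∈ LinearMap.ker (sumMap A) := hc
  rw [← heq] at this
  exact this

end Incidence

/-- The incidences of a spherical tiling by combinatorial pentagons, together with what the
topology of the sphere says about them: the faces around a vertex form a cycle, the dual graph is
connected, and the first cohomology group with coefficients `ℤ/2` is trivial. -/
structure PentagonalSphere (V E F : Type*) where
  /-- incidence of vertices and edges -/
  ve : V → E → Prop
  /-- incidence of edges and faces -/
  ef : E → F → Prop
  exists_cycle : ∀ f, ∃ (p : ZMod 5 → V) (q : ZMod 5 → E), p.Injective ∧ q.Injective ∧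
    (∀ e, ef e f ↔ ∃ i, q i = e) ∧ ∀ i v, ve v (q i) ↔ v = p i ∨ v = p (i + 1)
  isPair_faces : ∀ e, IsPair (ef e)
  link_connected : ∀ v, ∀ C : Set F, C.Nonempty → (∀ f ∈ C, ∃ e, ve v e ∧ ef e f) →
    (∀ e, ve v e → ∀ f ∈ C, ∀ f', ef e f → ef e f' → f' ∈ C) →
    ∀ f, (∃ e, ve v e ∧ ef e f) → f ∈ C
  dual_connected : ∀ C : Set F, C.Nonempty → (∀ e, ∀ f ∈ C, ∀ f', ef e f → ef e f' → f' ∈ C) →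
    ∀ f, f ∈ C
  exists_coboundary : ∀ c : E → ZMod 2, (∀ v, ∃ g : F → ZMod 2, ∀ e, ve v e →
    ∀ f f', f ≠ f' → ef e f → ef e f' → g f + g f' = c e) →
    ∃ g : F → ZMod 2, ∀ e f f', f ≠ f' → ef e f → ef e f' → g f + g f' = c e
  three_le_degree : ∀ v, 3 ≤ {e | ve v e}.ncard

namespace PentagonalSphere

variable {V E F : Type*} (M : PentagonalSphere V E F)

/-- Incidence of vertices and faces. -/
def Touches (v : V) (f : F) : Prop := ∃ e, M.ve v e ∧ M.ef e f

/-- The closed chain of vertices `p i` and edges `q i` around the face `f`; the edge `q i` runs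
from `p i` to `p (i + 1)`. -/
structure IsFrame (f : F) (p : ZMod 5 → V) (q : ZMod 5 → E) : Prop where
  inj_p : p.Injective
  inj_q : q.Injective
  ef_iff : ∀ e, M.ef e f ↔ ∃ i, q i = e
  ve_iff : ∀ i v, M.ve v (q i) ↔ v = p i ∨ v = p (i + 1)

variable {M} {v : V} {e e' : E} {f f' : F} {p : ZMod 5 → V} {q : ZMod 5 → E}

theorem exists_isFrame (M : PentagonalSphere V E F) (f : F) : ∃ p q, M.IsFrame f p q := by
  obtain ⟨p, q, h1, h2, h3, h4⟩ := M.exists_cycle f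
  exact ⟨p, q, h1, h2, h3, h4⟩

namespace IsFrame

theorem ef_self (h : M.IsFrame f p q) (i : ZMod 5) : M.ef (q i) f := (h.ef_iff _).2 ⟨i, rfl⟩

theorem ve_left (h : M.IsFrame f p q) (i : ZMod 5) : M.ve (p i) (q i) :=
  (h.ve_iff _ _).2 (Or.inl rfl)

theorem ve_right (h : M.IsFrame f p q) (i : ZMod 5) : M.ve (p (i + 1)) (q i) :=
  (h.ve_iff _ _).2 (Or.inr rfl)

theorem exists_of_touches (h : M.IsFrame f p q) (hv : M.Touches v f) : ∃ i, p i = v := by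
  obtain ⟨e, hve, hef⟩ := hv
  obtain ⟨i, rfl⟩ := (h.ef_iff e).1 hef
  rcases (h.ve_iff _ _).1 hve with rfl | rfl
  · exact ⟨i, rfl⟩
  · exact ⟨i + 1, rfl⟩

theorem isPair_verts (h : M.IsFrame f p q) (i : ZMod 5) : IsPair fun v => M.ve v (q i) :=
  ⟨p i, p (i + 1), fun h' => (by decide : ∀ j : ZMod 5, j ≠ j + 1) i (h.inj_p h'), h.ve_iff i⟩

theorem edge_iff (h : M.IsFrame f p q) (i : ZMod 5) (e : E) :
    M.ve (p i) e ∧ M.ef e f ↔ e = q i ∨ e = q (i - 1) := by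
  constructor
  · rintro ⟨hve, hef⟩
    obtain ⟨j, rfl⟩ := (h.ef_iff e).1 hef
    rcases (h.ve_iff _ _).1 hve with h' | h'
    · exact Or.inl (by rw [h.inj_p h'])
    · exact Or.inr (by rw [h.inj_p h', add_sub_cancel_right])
  · rintro (rfl | rfl)
    · exact ⟨h.ve_left i, h.ef_self i⟩
    · refine ⟨?_, h.ef_self _⟩
      simpa using h.ve_right (i - 1)

theorem isPair_edges (h : M.IsFrame f p q) (i : ZMod 5) :
    IsPair fun e => M.ve (p i) e ∧ M.ef e f :=
  ⟨q i, q (i - 1), fun h' => (by decide : ∀ j : ZMod 5, j ≠ j - 1) i (h.inj_q h'), h.edge_iff i⟩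

/-- A frame may start with any edge, in any of the two directions. -/
theorem exists_of_ve_of_ef (h : M.IsFrame f p q) (hve : M.ve v e) (hef : M.ef e f) :
    ∃ p' q', M.IsFrame f p' q' ∧ p' 0 = v ∧ q' 0 = e := by
  obtain ⟨k, rfl⟩ := (h.ef_iff e).1 hef
  rcases (h.ve_iff _ _).1 hve with rfl | rfl
  · refine ⟨fun i => p (k + i), fun i => q (k + i), ⟨?_, ?_, ?_, ?_⟩, by simp, by simp⟩
    · exact h.inj_p.comp (add_right_injective k)
    · exact h.inj_q.comp (add_right_injective k)
    · intro e
      rw [h.ef_iff]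
      exact ⟨fun ⟨i, hi⟩ => ⟨i - k, by simpa using hi⟩, fun ⟨i, hi⟩ => ⟨_, hi⟩⟩
    · intro i v
      rw [h.ve_iff, add_assoc]
  · refine ⟨fun i => p (k + 1 - i), fun i => q (k - i), ⟨?_, ?_, ?_, ?_⟩, by simp, by simp⟩
    · exact h.inj_p.comp sub_right_injective
    · exact h.inj_q.comp sub_right_injective
    · intro e
      rw [h.ef_iff]
      exact ⟨fun ⟨i, hi⟩ => ⟨k - i, by simpa using hi⟩, fun ⟨i, hi⟩ => ⟨_, hi⟩⟩
    · intro i v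
      rw [h.ve_iff, or_comm, show k - i + 1 = k + 1 - i by ring,
        show k + 1 - (i + 1) = k - i by ring]

end IsFrame

theorem isPair_edges (h : M.Touches v f) : IsPair fun e => M.ve v e ∧ M.ef e f := by
  obtain ⟨p, q, hf⟩ := M.exists_isFrame f
  obtain ⟨i, rfl⟩ := hf.exists_of_touches h
  exact hf.isPair_edges i

theorem isPair_verts (M : PentagonalSphere V E F) (e : E) : IsPair fun v => M.ve v e := by
  obtain ⟨f, f', -, hf⟩ := M.isPair_faces e
  obtain ⟨p, q, h⟩ := M.exists_isFrame f
  obtain ⟨i, rfl⟩ := (h.ef_iff e).1 ((hf f).2 (Or.inl rfl))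
  exact h.isPair_verts i

variable [Fintype E] [Fintype F]

open Classical in
theorem card_edges (M : PentagonalSphere V E F) : Fintype.card E * 2 = Fintype.card F * 5 := by
  refine card_mul_eq_card_mul (R := M.ef) (fun e => (M.isPair_faces e).card_filter) fun f => ?_
  obtain ⟨p, q, h⟩ := M.exists_isFrame f
  have : (Finset.univ.filter fun e => M.ef e f) = Finset.univ.image q := by
    ext e
    simp [h.ef_iff]
  rw [this, Finset.card_image_of_injective _ h.inj_q]
  rfl

open Classical in
/-- A function on the edges with sum zero around the vertex `v` is a difference around `v`. -/
theorem exists_local_coboundary (M : PentagonalSphere V E F) (v : V) {c : E → ZMod 2}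
    (hc : ∑ e with M.ve v e, c e = 0) : ∃ g : F → ZMod 2, ∀ e, M.ve v e →
    ∀ f f', f ≠ f' → M.ef e f → M.ef e f' → g f + g f' = c e := by
  let A := {e // M.ve v e}
  let B := {f // M.Touches v f}
  let R : A → B → Prop := fun e f => M.ef e.1 f.1
  have hA : ∀ a, IsPair (R a) := by
    rintro ⟨e, he⟩
    obtain ⟨f, f', hne, h⟩ := M.isPair_faces e
    refine ⟨⟨f, e, he, (h f).2 (Or.inl rfl)⟩, ⟨f', e, he, (h f').2 (Or.inr rfl)⟩,
      fun h => hne (congrArg Subtype.val h), fun x => ?_⟩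
    rw [Subtype.ext_iff, Subtype.ext_iff]
    exact h x.1
  have hB : ∀ b, IsPair fun a => R a b := by
    rintro ⟨f, hf⟩
    obtain ⟨e, e', hne, h⟩ := isPair_edges hf
    refine ⟨⟨e, ((h e).2 (Or.inl rfl)).1⟩, ⟨e', ((h e').2 (Or.inr rfl)).1⟩,
      fun h => hne (congrArg Subtype.val h), fun x => ?_⟩
    rw [Subtype.ext_iff, Subtype.ext_iff, ← h x.1]
    exact ⟨fun h => ⟨x.2, h⟩, fun h => h.2⟩
  obtain ⟨e₀, he₀⟩ : {e | M.ve v e}.Nonempty :=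
    nonempty_of_ncard_ne_zero (by have := M.three_le_degree v; omega)
  have : Nonempty A := ⟨⟨e₀, he₀⟩⟩
  obtain ⟨g, hg⟩ := exists_incidenceMap_eq (c := fun a : A => c a.1) hA hB (by
    intro C hC hCadj b
    have := M.link_connected v (Subtype.val '' C) (hC.image _) (by
      rintro _ ⟨f, -, rfl⟩
      exact f.2) (by
      rintro e he _ ⟨f, hf, rfl⟩ f' h h'
      exact ⟨⟨f', e, he, h'⟩, hCadj ⟨e, he⟩ f hf ⟨f', e, he, h'⟩ h h', rfl⟩) b.1 b.2
    obtain ⟨b', hb', h⟩ := this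
    exact Subtype.ext h ▸ hb') (by
    rw [← hc, Finset.sum_subtype (p := M.ve v) _ (by simp)])
  refine ⟨fun f => if h : M.Touches v f then g ⟨f, h⟩ else 0, fun e he f f' hne hf hf' => ?_⟩
  have := incidenceMap_apply_of_ne (hA ⟨e, he⟩) (b := ⟨f, e, he, hf⟩) (b' := ⟨f', e, he, hf'⟩)
    hf hf' (fun h => hne (congrArg Subtype.val h)) g
  rw [hg] at this
  beta_reduce
  rw [dif_pos ⟨e, he, hf⟩, dif_pos ⟨e, he, hf'⟩]
  exact this.symm

variable [Fintype V]

/-- One half of Euler's formula, the one that says that the genus is zero. Modulo two, a function on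
the edges with sum zero at every vertex is a difference of a function on the faces. The space of the
former has dimension at least `|E| - |V| + 1`, that of the latter at most `|F| - 1`. -/
theorem euler_le [Nonempty V] [Nonempty F] (M : PentagonalSphere V E F) :
    Fintype.card E + 2 ≤ Fintype.card V + Fintype.card F := by
  classical
  have h1 := LinearMap.finrank_range_add_finrank_ker (incidenceMap M.ve)
  have h2 := LinearMap.finrank_range_add_finrank_ker (incidenceMap M.ef)
  rw [Module.finrank_fintype_fun_eq_card] at h1 h2
  have h3 := finrank_ker_sumMap (A := V)
  have h4 := Submodule.finrank_mono (range_incidenceMap_le (R := M.ve) M.isPair_verts)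
  have h5 : 1 ≤ Module.finrank (ZMod 2) (LinearMap.ker (incidenceMap M.ef)) := by
    rw [Nat.one_le_iff_ne_zero, Ne, Submodule.finrank_eq_zero]
    intro h
    have : (fun _ => 1 : F → ZMod 2) ∈ LinearMap.ker (incidenceMap M.ef) :=
      incidenceMap_const M.isPair_faces
    rw [h, Submodule.mem_bot] at this
    obtain ⟨f⟩ := (inferInstance : Nonempty F)
    exact one_ne_zero (congrFun this f)
  have h6 : LinearMap.ker (incidenceMap M.ve) ≤ LinearMap.range (incidenceMap M.ef) := by
    intro c hc
    obtain ⟨g, hg⟩ := M.exists_coboundary c fun v =>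
      M.exists_local_coboundary v (congrFun hc v)
    refine ⟨g, ?_⟩
    ext e
    obtain ⟨f, f', hne, h⟩ := M.isPair_faces e
    have hf := (h f).2 (Or.inl rfl)
    have hf' := (h f').2 (Or.inr rfl)
    rw [incidenceMap_apply_of_ne (M.isPair_faces e) hf hf' hne, hg e f f' hne hf hf']
  have h7 := Submodule.finrank_mono h6
  omega

open Classical in
/-- If there are twelve faces, there are thirty edges and twenty vertices, all of degree three. -/
theorem card_eq (M : PentagonalSphere V E F) (hF : Fintype.card F = 12) :
    Fintype.card E = 30 ∧ Fintype.card V = 20 ∧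
      ∀ v, (Finset.univ.filter fun e => M.ve v e).card = 3 := by
  have hE : Fintype.card E = 30 := by
    have := M.card_edges
    omega
  have : Nonempty F := Fintype.card_pos_iff.1 (by omega)
  have : Nonempty V := by
    obtain ⟨p, -, -⟩ := M.exists_isFrame (Classical.arbitrary F)
    exact ⟨p 0⟩
  have hV := M.euler_le
  have hsum : ∑ v, (Finset.univ.filter fun e => M.ve v e).card = 60 := by
    have := Finset.sum_card_bipartiteAbove_eq_sum_card_bipartiteBelow (s := Finset.univ)
      (t := Finset.univ) M.ve
    simp only [Finset.bipartiteAbove, Finset.bipartiteBelow, (M.isPair_verts _).card_filter]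
      at this
    rw [this]
    simp [hE]
  have h3 : ∀ v, 3 ≤ (Finset.univ.filter fun e => M.ve v e).card := fun v => by
    have := M.three_le_degree v
    rwa [← Set.ncard_coe_finset, Finset.coe_filter_univ]
  -- the bound on the degrees gives `|V| ≤ 20`, and Euler's inequality `|V| ≥ 20`
  have hle : Fintype.card V * 3 ≤ 60 := by
    rw [← hsum, ← smul_eq_mul]
    exact Finset.card_nsmul_le_sum _ _ _ fun v _ => h3 v
  have hV20 : Fintype.card V = 20 := by omega
  refine ⟨hE, hV20, fun v => ?_⟩
  by_contra hne
  have : ∑ _v : V, 3 < ∑ v, (Finset.univ.filter fun e => M.ve v e).card :=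
    Finset.sum_lt_sum (fun v _ => h3 v) ⟨v, Finset.mem_univ v, lt_of_le_of_ne (h3 v) (Ne.symm hne)⟩
  rw [hsum] at this
  simp [hV20] at this

end PentagonalSphere

/-! ### Developing the dodecahedron -/

namespace PentagonalSphere

variable {V E F : Type*} {M : PentagonalSphere V E F} {v : V} {e e' : E} {f f' : F}
  {p : ZMod 5 → V} {q : ZMod 5 → E}

namespace IsFrame

theorem next_vertex (h : M.IsFrame f p q) (i : ZMod 5) (hv : M.ve v (q i)) (hne : v ≠ p i) :
    p (i + 1) = v :=
  (((h.ve_iff i v).1 hv).resolve_left hne).symm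

theorem prev_vertex (h : M.IsFrame f p q) (i : ZMod 5) (hv : M.ve v (q i))
    (hne : v ≠ p (i + 1)) : p i = v :=
  (((h.ve_iff i v).1 hv).resolve_right hne).symm

theorem next_edge (h : M.IsFrame f p q) (i : ZMod 5) (he : M.ve (p (i + 1)) e) (hf : M.ef e f)
    (hne : e ≠ q i) : q (i + 1) = e := by
  refine (((h.edge_iff (i + 1) e).1 ⟨he, hf⟩).resolve_right ?_).symm
  rwa [add_sub_cancel_right]

theorem prev_edge (h : M.IsFrame f p q) (i : ZMod 5) (he : M.ve (p (i + 1)) e) (hf : M.ef e f)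
    (hne : e ≠ q (i + 1)) : q i = e := by
  have := ((h.edge_iff (i + 1) e).1 ⟨he, hf⟩).resolve_left hne
  rw [this, add_sub_cancel_right]

end IsFrame

/-- Exactly the faces `f`, `g` and `h` meet at the vertex `v`, and any two of them share an edge
at `v`. -/
structure IsCorner (M : PentagonalSphere V E F) (v : V) (f g h : F) : Prop where
  touches_iff : ∀ k, M.Touches v k ↔ k = f ∨ k = g ∨ k = h
  edge_fg : ∃ e, M.ve v e ∧ M.ef e f ∧ M.ef e g
  edge_fh : ∃ e, M.ve v e ∧ M.ef e f ∧ M.ef e h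
  edge_gh : ∃ e, M.ve v e ∧ M.ef e g ∧ M.ef e h

/-- At a vertex of degree three, the two edges of a face determine everything: the third edge is
between the faces on their other sides. -/
theorem exists_third_edge (hdeg : {e | M.ve v e}.ncard = 3) {a b : E} {g h : F} (hab : a ≠ b)
    (ha : M.ve v a) (hb : M.ve v b) (haf : M.ef a f) (hbf : M.ef b f) (hag : M.ef a g)
    (hgf : g ≠ f) (hbh : M.ef b h) (hhf : h ≠ f) :
    ∃ c, c ≠ a ∧ c ≠ b ∧ M.ve v c ∧ M.ef c g ∧ M.ef c h ∧ g ≠ h ∧ M.IsCorner v f g h := by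
  obtain ⟨c, hc⟩ : ∃ c, {e | M.ve v e} \ {a, b} = {c} := by
    rw [← ncard_eq_one, ncard_sdiff (by rintro x (rfl | rfl) <;> assumption), hdeg,
      ncard_pair hab]
  have hcmem : c ∈ {e | M.ve v e} \ {a, b} := hc ▸ rfl
  have hcv : M.ve v c := hcmem.1
  have hca : c ≠ a := fun h => hcmem.2 (Or.inl h)
  have hcb : c ≠ b := fun h => hcmem.2 (Or.inr h)
  have hall : ∀ e, M.ve v e → e = a ∨ e = b ∨ e = c := by
    intro e he
    by_contra! hne
    exact hne.2.2 (hc ▸ (⟨he, by rintro (h | h); exacts [hne.1 h, hne.2.1 h]⟩ :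
      e ∈ {e | M.ve v e} \ {a, b}) : e ∈ ({c} : Set E))
  have hcf : ¬ M.ef c f := by
    intro h
    rcases (isPair_edges ⟨a, ha, haf⟩).eq_or_eq ⟨ha, haf⟩ ⟨hb, hbf⟩ ⟨hcv, h⟩ hab.symm with h | h
    · exact hca h
    · exact hcb h
  have hor : ∀ k, M.ef c k → k = g ∨ k = h := by
    intro k hk
    have hkf : k ≠ f := by
      rintro rfl
      exact hcf hk
    obtain ⟨d, hd, ⟨hdv, hdk⟩, -⟩ :=
      (isPair_edges ⟨c, hcv, hk⟩).exists_other (a := c) ⟨hcv, hk⟩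
    rcases hall d hdv with rfl | rfl | rfl
    · exact Or.inl ((M.isPair_faces d).eq_of_ne haf hdk hag hkf hgf)
    · exact Or.inr ((M.isPair_faces d).eq_of_ne hbf hdk hbh hkf hhf)
    · exact absurd rfl hd
  obtain ⟨k, l, hkl, hfc⟩ := M.isPair_faces c
  have hk := (hfc k).2 (Or.inl rfl)
  have hl := (hfc l).2 (Or.inr rfl)
  obtain ⟨hcg, hch, hgh⟩ : M.ef c g ∧ M.ef c h ∧ g ≠ h := by
    rcases hor k hk with rfl | rfl <;> rcases hor l hl with rfl | rfl
    · exact absurd rfl hkl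
    · exact ⟨hk, hl, hkl⟩
    · exact ⟨hl, hk, hkl.symm⟩
    · exact absurd rfl hkl
  refine ⟨c, hca, hcb, hcv, hcg, hch, hgh, ⟨fun k => ⟨?_, ?_⟩, ⟨a, ha, haf, hag⟩, ⟨b, hb, hbf, hbh⟩,
    ⟨c, hcv, hcg, hch⟩⟩⟩
  · rintro ⟨d, hdv, hdk⟩
    rcases hall d hdv with rfl | rfl | rfl
    · rcases (M.isPair_faces d).eq_or_eq haf hag hdk hgf with h | h <;> simp [h]
    · rcases (M.isPair_faces d).eq_or_eq hbf hbh hdk hhf with h | h <;> simp [h]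
    · exact Or.inr (hor k hdk)
  · rintro (rfl | rfl | rfl)
    · exact ⟨a, ha, haf⟩
    · exact ⟨a, ha, hag⟩
    · exact ⟨b, hb, hbh⟩

theorem exists_other_face (h : M.ef e f) : ∃ f', f' ≠ f ∧ M.ef e f' := by
  obtain ⟨f', hne, hf', -⟩ := (M.isPair_faces e).exists_other h
  exact ⟨f', hne, hf'⟩

/-- The dodecahedron can be developed in every map of pentagons whose vertices have degree three.
Here `f` is any face, the `A i` are the faces adjacent to it, `B i` is the next face at the far end
of the edge between `A i` and `A (i + 1)`, and `R` is the face opposite `f`. The faces need not be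
different, but every vertex of one of them is among the vertices `v i`, `w i`, `u i`, `z i`. -/
theorem exists_development (hdeg : ∀ v, {e | M.ve v e}.ncard = 3) (f : F) :
    ∃ (A B : ZMod 5 → F) (R : F) (v w u z : ZMod 5 → V),
      (∀ i, M.IsCorner (v i) f (A i) (A (i + 1))) ∧
      (∀ i, M.IsCorner (w i) (A (i + 1)) (A i) (B i)) ∧
      (∀ i, M.IsCorner (u i) (A (i + 1)) (B (i + 1)) (B i)) ∧
      (∀ i, M.IsCorner (z i) (B (i + 1)) (B i) R) ∧
      ∀ x g, (g = f ∨ g ∈ range A ∨ g ∈ range B ∨ g = R) → M.Touches x g →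
        x ∈ range v ∪ range w ∪ range u ∪ range z := by
  have h01 : ∀ i : ZMod 5, i ≠ i + 1 := by decide
  have hsub : ∀ i : ZMod 5, i - 1 + 1 = i := by decide
  have hfive : ∀ j : ZMod 5, j = 0 ∨ j = 1 ∨ j = 2 ∨ j = 3 ∨ j = 4 := by decide
  obtain ⟨p, q, hf⟩ := M.exists_isFrame f
  -- the faces around `f`
  choose A hAf hqA using fun i => exists_other_face (hf.ef_self i)
  have hcv := fun i => exists_third_edge (hdeg (p (i + 1))) (hf.inj_q.ne (h01 i))
    (hf.ve_right i) (hf.ve_left (i + 1)) (hf.ef_self i) (hf.ef_self (i + 1)) (hqA i) (hAf i)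
    (hqA (i + 1)) (hAf (i + 1))
  choose s hsq hsq' hps hsA hsA' hAA hcornerv using hcv
  choose pA qA hA hpA0 hqA0 using fun i =>
    (M.exists_isFrame (A i)).elim fun _ h => h.elim fun _ h =>
      h.exists_of_ve_of_ef (hf.ve_left i) (hqA i)
  have hpA1 : ∀ i, pA i 1 = p (i + 1) := fun i =>
    (hA i).next_vertex 0 (by rw [hqA0]; exact hf.ve_right i)
      (by rw [hpA0]; exact hf.inj_p.ne (h01 i).symm)
  have hqA1 : ∀ i, qA i 1 = s i := fun i =>
    (hA i).next_edge 0 (by rw [zero_add, hpA1]; exact hps i) (hsA i) (by rw [hqA0]; exact hsq i)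
  have hqA4 : ∀ i, qA (i + 1) 4 = s i := fun i =>
    (hA (i + 1)).prev_edge 4 (by rw [show (4 + 1 : ZMod 5) = 0 from rfl, hpA0]; exact hps i)
      (hsA' i) (by rw [show (4 + 1 : ZMod 5) = 0 from rfl, hqA0]; exact hsq' i)
  have hpA4 : ∀ i, pA (i + 1) 4 = pA i 2 := fun i =>
    (hA (i + 1)).prev_vertex 4 (by rw [hqA4, ← hqA1]; exact (hA i).ve_right 1)
      (by
        rw [show (4 + 1 : ZMod 5) = 0 from rfl, hpA0, ← hpA1]
        exact (hA i).inj_p.ne (by decide))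
  -- the faces of the second ring
  choose B hBA hqB using fun i => exists_other_face ((hA (i + 1)).ef_self 3)
  have hcw := fun i => exists_third_edge (hdeg (pA i 2)) (a := s i) (b := qA (i + 1) 3)
    (f := A (i + 1)) (g := A i) (h := B i)
    (by rw [← hqA4]; exact (hA (i + 1)).inj_q.ne (by decide))
    (by rw [← hqA1]; exact (hA i).ve_right 1)
    (by rw [← hpA4]; exact (hA (i + 1)).ve_right 3) (hsA' i) ((hA (i + 1)).ef_self 3) (hsA i)
    (hAA i) (hqB i) (hBA i)
  choose c hcs hcq hcv hcA hcB hAB hcornerw using hcw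
  have hc : ∀ i, qA i 2 = c i := fun i =>
    (hA i).next_edge 1 (hcv i) (hcA i) (by rw [hqA1]; exact hcs i)
  have hcu := fun i => exists_third_edge (hdeg (pA (i + 1) 3)) (a := qA (i + 1) 2)
    (b := qA (i + 1) 3) (f := A (i + 1)) (g := B (i + 1)) (h := B i)
    ((hA (i + 1)).inj_q.ne (by decide)) ((hA (i + 1)).ve_right 2) ((hA (i + 1)).ve_left 3)
    ((hA (i + 1)).ef_self 2) ((hA (i + 1)).ef_self 3) (by rw [hc]; exact hcB (i + 1))
    (hAB (i + 1)).symm (hqB i) (hBA i)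
  choose t htq2 htq3 hpt htB' htB hBB hcorneru using hcu
  choose pB qB hB hpB0 hqB0 using fun i =>
    (M.exists_isFrame (B i)).elim fun _ h => h.elim fun _ h =>
      h.exists_of_ve_of_ef (v := pA i 3) (e := qA i 2) ((hA i).ve_right 2)
        (by rw [hc]; exact hcB i)
  have hpB1 : ∀ i, pB i 1 = pA i 2 := fun i =>
    (hB i).next_vertex 0 (by rw [hqB0]; exact (hA i).ve_left 2)
      (by rw [hpB0]; exact (hA i).inj_p.ne (by decide))
  have hqB1 : ∀ i, qB i 1 = qA (i + 1) 3 := fun i =>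
    (hB i).next_edge 0 (by rw [zero_add, hpB1, ← hpA4]; exact (hA (i + 1)).ve_right 3) (hqB i)
      (by rw [hqB0, hc]; exact (hcq i).symm)
  have hpB2 : ∀ i, pB i 2 = pA (i + 1) 3 := fun i =>
    (hB i).next_vertex 1 (by rw [hqB1]; exact (hA (i + 1)).ve_left 3)
      (by rw [hpB1, ← hpA4]; exact (hA (i + 1)).inj_p.ne (by decide))
  have hqB2 : ∀ i, qB i 2 = t i := fun i =>
    (hB i).next_edge 1 (by rw [show (1 + 1 : ZMod 5) = 2 from rfl, hpB2]; exact hpt i) (htB i)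
      (by rw [hqB1]; exact htq3 i)
  have hqB4 : ∀ i, qB (i + 1) 4 = t i := fun i =>
    (hB (i + 1)).prev_edge 4 (by rw [show (4 + 1 : ZMod 5) = 0 from rfl, hpB0]; exact hpt i)
      (htB' i) (by rw [show (4 + 1 : ZMod 5) = 0 from rfl, hqB0]; exact htq2 i)
  have hpB4 : ∀ i, pB (i + 1) 4 = pB i 3 := fun i =>
    (hB (i + 1)).prev_vertex 4 (by rw [hqB4, ← hqB2]; exact (hB i).ve_right 2)
      (by
        rw [show (4 + 1 : ZMod 5) = 0 from rfl, hpB0, ← hpB2]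
        exact (hB i).inj_p.ne (by decide))
  -- the opposite face
  choose R hRB hqR using fun i => exists_other_face ((hB i).ef_self 3)
  have hcz := fun i => exists_third_edge (hdeg (pB i 3)) (a := t i) (b := qB (i + 1) 3)
    (f := B (i + 1)) (g := B i) (h := R (i + 1))
    (by rw [← hqB4]; exact (hB (i + 1)).inj_q.ne (by decide))
    (by rw [← hqB2]; exact (hB i).ve_right 2)
    (by rw [← hpB4]; exact (hB (i + 1)).ve_right 3) (htB' i) ((hB (i + 1)).ef_self 3) (htB i)
    (hBB i).symm (hqR (i + 1)) (hRB (i + 1))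
  choose d hdt hdq hdv hdB hdR hBR hcornerz using hcz
  have hd : ∀ i, qB i 3 = d i := fun i =>
    (hB i).next_edge 2 (hdv i) (hdB i) (by rw [hqB2]; exact hdt i)
  have hRsucc : ∀ i, R (i + 1) = R i := fun i =>
    (M.isPair_faces (qB i 3)).eq_of_ne ((hB i).ef_self 3) (by rw [hd]; exact hdR i) (hqR i)
      (hBR i).symm (hRB i)
  have hnat : ∀ i : ZMod 5, ∃ n : ℕ, (n : ZMod 5) = i := fun i => ⟨i.val, ZMod.natCast_zmod_val i⟩
  have hRconst : ∀ i, R i = R 0 := by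
    intro i
    obtain ⟨n, rfl⟩ := hnat i
    induction n with
    | zero => simp
    | succ n ih => rw [Nat.cast_succ, hRsucc, ih]
  obtain ⟨pR, qR, hR, hpR0, hqR0⟩ : ∃ pR qR, M.IsFrame (R 0) pR qR ∧ pR 0 = pB 0 4 ∧
      qR 0 = qB 0 3 := by
    obtain ⟨_, _, h⟩ := M.exists_isFrame (R 0)
    exact h.exists_of_ve_of_ef ((hB 0).ve_right 3) (hqR 0)
  have hpR : ∀ n : ℕ, qR n = qB n 3 ∧ pR (n + 1) = pB n 3 := by
    intro n
    induction n with
    | zero =>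
      refine ⟨by simpa using hqR0, ?_⟩
      rw [Nat.cast_zero]
      refine hR.next_vertex 0 (by rw [hqR0]; exact (hB 0).ve_left 3) ?_
      rw [hpR0]
      exact (hB 0).inj_p.ne (by decide)
    | succ n ih =>
      have h1 : qR (n + 1) = qB (n + 1) 3 :=
        hR.next_edge n (by rw [ih.2, ← hpB4]; exact (hB (n + 1)).ve_right 3)
          (by rw [← hRconst (n + 1)]; exact hqR (n + 1)) (by rw [ih.1, hd n]; exact (hdq n).symm)
      rw [Nat.cast_succ]
      refine ⟨h1, hR.next_vertex _ (by rw [h1]; exact (hB _).ve_left 3) ?_⟩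
      rw [ih.2, ← hpB4 n]
      exact (hB (n + 1)).inj_p.ne (by decide)
  refine ⟨A, B, R 0, fun i => p (i + 1), fun i => pA i 2, fun i => pA (i + 1) 3, fun i => pB i 3,
    hcornerv, hcornerw, hcorneru, fun i => by rw [← hRconst (i + 1)]; exact hcornerz i, ?_⟩
  have hv : ∀ i, p i ∈ range fun i => p (i + 1) := fun i => ⟨i - 1, by simp⟩
  have hu : ∀ i, pA i 3 ∈ range fun i => pA (i + 1) 3 := fun i => ⟨i - 1, by simp⟩
  have hw : ∀ i, pA i 4 ∈ range fun i => pA i 2 := fun i =>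
    ⟨i - 1, by beta_reduce; rw [← hpA4, hsub]⟩
  have hz : ∀ i, pB i 4 ∈ range fun i => pB i 3 := fun i =>
    ⟨i - 1, by beta_reduce; rw [← hpB4, hsub]⟩
  rintro x g (rfl | ⟨i, rfl⟩ | ⟨i, rfl⟩ | rfl) hx
  · obtain ⟨j, rfl⟩ := hf.exists_of_touches hx
    exact Or.inl (Or.inl (Or.inl (hv j)))
  · obtain ⟨j, rfl⟩ := (hA i).exists_of_touches hx
    rcases hfive j with rfl | rfl | rfl | rfl | rfl
    · rw [hpA0]
      exact Or.inl (Or.inl (Or.inl (hv i)))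
    · rw [hpA1]
      exact Or.inl (Or.inl (Or.inl (hv _)))
    · exact Or.inl (Or.inl (Or.inr ⟨i, rfl⟩))
    · exact Or.inl (Or.inr (hu i))
    · exact Or.inl (Or.inl (Or.inr (hw i)))
  · obtain ⟨j, rfl⟩ := (hB i).exists_of_touches hx
    rcases hfive j with rfl | rfl | rfl | rfl | rfl
    · rw [hpB0]
      exact Or.inl (Or.inr (hu i))
    · rw [hpB1]
      exact Or.inl (Or.inl (Or.inr ⟨i, rfl⟩))
    · rw [hpB2]
      exact Or.inl (Or.inr (hu _))
    · exact Or.inr ⟨i, rfl⟩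
    · exact Or.inr (hz i)
  · obtain ⟨j, rfl⟩ := hR.exists_of_touches hx
    obtain ⟨n, hn⟩ := hnat (j - 1)
    have : pR j = pB n 3 := by
      rw [← (hpR n).2, hn, hsub]
    rw [this]
    exact Or.inr ⟨n, rfl⟩

/-- The labels of the five faces `A i` of the dodecahedron around the face `0`. -/
def upperLabel : ZMod 5 → Fin 12 := ![1, 2, 3, 4, 5]

/-- The labels of the five faces `B i` of the dodecahedron around the face `11`. -/
def lowerLabel : ZMod 5 → Fin 12 := ![6, 7, 8, 9, 10]

theorem mem_dodecahedronVertices : ∀ τ ∈ dodecahedronVertices, ∃ i : ZMod 5,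
    τ = {0, upperLabel i, upperLabel (i + 1)} ∨
    τ = {upperLabel (i + 1), upperLabel i, lowerLabel i} ∨
    τ = {upperLabel (i + 1), lowerLabel (i + 1), lowerLabel i} ∨
    τ = {lowerLabel (i + 1), lowerLabel i, 11} := by
  intro τ hτ
  simp only [dodecahedronVertices, Finset.mem_insert, Finset.mem_singleton] at hτ
  rcases hτ with h | h | h | h | h | h | h | h | h | h | h | h | h | h | h | h | h | h | h | h <;>
    subst h
  · exact ⟨0, Or.inl (by decide)⟩
  · exact ⟨1, Or.inl (by decide)⟩
  · exact ⟨2, Or.inl (by decide)⟩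
  · exact ⟨3, Or.inl (by decide)⟩
  · exact ⟨4, Or.inl (by decide)⟩
  · exact ⟨0, Or.inr (Or.inl (by decide))⟩
  · exact ⟨1, Or.inr (Or.inl (by decide))⟩
  · exact ⟨2, Or.inr (Or.inl (by decide))⟩
  · exact ⟨3, Or.inr (Or.inl (by decide))⟩
  · exact ⟨4, Or.inr (Or.inl (by decide))⟩
  · exact ⟨0, Or.inr (Or.inr (Or.inl (by decide)))⟩
  · exact ⟨1, Or.inr (Or.inr (Or.inl (by decide)))⟩
  · exact ⟨2, Or.inr (Or.inr (Or.inl (by decide)))⟩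
  · exact ⟨3, Or.inr (Or.inr (Or.inl (by decide)))⟩
  · exact ⟨4, Or.inr (Or.inr (Or.inl (by decide)))⟩
  · exact ⟨0, Or.inr (Or.inr (Or.inr (by decide)))⟩
  · exact ⟨1, Or.inr (Or.inr (Or.inr (by decide)))⟩
  · exact ⟨2, Or.inr (Or.inr (Or.inr (by decide)))⟩
  · exact ⟨3, Or.inr (Or.inr (Or.inr (by decide)))⟩
  · exact ⟨4, Or.inr (Or.inr (Or.inr (by decide)))⟩

theorem card_dodecahedronVertices : dodecahedronVertices.card = 20 := by decide

theorem card_dodecahedronEdges : dodecahedronEdges.card = 30 := by decide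

theorem IsCorner.ef_pair {P : Fin 12 → F} (hP : P.Injective) {i j k : Fin 12}
    (h : M.IsCorner v (P i) (P j) (P k)) {σ : Finset (Fin 12)} (hσ : σ ⊆ {i, j, k})
    (hσ2 : σ.card = 2) : ∃ e, M.ve v e ∧ ∀ l, M.ef e (P l) ↔ l ∈ σ := by
  obtain ⟨a, b, hab, rfl⟩ := Finset.card_eq_two.1 hσ2
  have key : ∃ e, M.ve v e ∧ M.ef e (P a) ∧ M.ef e (P b) := by
    have ha := hσ (Finset.mem_insert_self _ _)
    have hb := hσ (Finset.mem_insert_of_mem (Finset.mem_singleton_self _))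
    simp only [Finset.mem_insert, Finset.mem_singleton] at ha hb
    obtain ⟨e₁, h₁, h₁', h₁''⟩ := h.edge_fg
    obtain ⟨e₂, h₂, h₂', h₂''⟩ := h.edge_fh
    obtain ⟨e₃, h₃, h₃', h₃''⟩ := h.edge_gh
    rcases ha with rfl | rfl | rfl <;> rcases hb with rfl | rfl | rfl
    · exact absurd rfl hab
    · exact ⟨e₁, h₁, h₁', h₁''⟩
    · exact ⟨e₂, h₂, h₂', h₂''⟩
    · exact ⟨e₁, h₁, h₁'', h₁'⟩
    · exact absurd rfl hab
    · exact ⟨e₃, h₃, h₃', h₃''⟩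
    · exact ⟨e₂, h₂, h₂'', h₂'⟩
    · exact ⟨e₃, h₃, h₃'', h₃'⟩
    · exact absurd rfl hab
  obtain ⟨e, hv, ha, hb⟩ := key
  refine ⟨e, hv, fun l => ?_⟩
  simp only [Finset.mem_insert, Finset.mem_singleton]
  constructor
  · intro hl
    rcases (M.isPair_faces e).eq_or_eq ha hb hl (hP.ne hab.symm) with h | h
    · exact Or.inl (hP h)
    · exact Or.inr (hP h)
  · rintro (rfl | rfl) <;> assumption

/-- A spherical map of twelve pentagons is the dodecahedron. The developed faces are all faces because
they are closed under adjacency; counting then shows that the labellings of the faces, vertices and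
edges are bijective. -/
theorem exists_dodecahedral [Fintype V] [Fintype E] [Fintype F] (M : PentagonalSphere V E F)
    (hF : Fintype.card F = 12) :
    ∃ (P : Fin 12 ≃ F) (Q : dodecahedronEdges ≃ E) (W : dodecahedronVertices ≃ V),
      (∀ e i, M.ef (Q e) (P i) ↔ i ∈ e.1) ∧ (∀ v i, M.Touches (W v) (P i) ↔ i ∈ v.1) ∧
      ∀ v e, M.ve (W v) (Q e) ↔ e.1 ⊆ v.1 := by
  classical
  obtain ⟨hE, hV, hdeg⟩ := M.card_eq hF
  have hdeg' : ∀ v, {e | M.ve v e}.ncard = 3 := fun v => by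
    rw [← hdeg v, ← Set.ncard_coe_finset, Finset.coe_filter_univ]
  obtain ⟨f⟩ : Nonempty F := Fintype.card_pos_iff.1 (by omega)
  obtain ⟨A, B, R, v, w, u, z, hv, hw, hu, hz, hcl⟩ := exists_development hdeg' f
  let P : Fin 12 → F := ![f, A 0, A 1, A 2, A 3, A 4, B 0, B 1, B 2, B 3, B 4, R]
  have hPA : ∀ i, A i = P (upperLabel i) := fun i => by fin_cases i <;> rfl
  have hPB : ∀ i, B i = P (lowerLabel i) := fun i => by fin_cases i <;> rfl
  have hrange : ∀ g, g ∈ range P → g = f ∨ g ∈ range A ∨ g ∈ range B ∨ g = R := by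
    rintro _ ⟨k, rfl⟩
    fin_cases k
    · exact Or.inl rfl
    · exact Or.inr (Or.inl ⟨0, rfl⟩)
    · exact Or.inr (Or.inl ⟨1, rfl⟩)
    · exact Or.inr (Or.inl ⟨2, rfl⟩)
    · exact Or.inr (Or.inl ⟨3, rfl⟩)
    · exact Or.inr (Or.inl ⟨4, rfl⟩)
    · exact Or.inr (Or.inr (Or.inl ⟨0, rfl⟩))
    · exact Or.inr (Or.inr (Or.inl ⟨1, rfl⟩))
    · exact Or.inr (Or.inr (Or.inl ⟨2, rfl⟩))
    · exact Or.inr (Or.inr (Or.inl ⟨3, rfl⟩))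
    · exact Or.inr (Or.inr (Or.inl ⟨4, rfl⟩))
    · exact Or.inr (Or.inr (Or.inr rfl))
  have hAP : ∀ i, A i ∈ range P := fun i => ⟨_, (hPA i).symm⟩
  have hBP : ∀ i, B i ∈ range P := fun i => ⟨_, (hPB i).symm⟩
  have hfP : f ∈ range P := ⟨0, rfl⟩
  have hRP : R ∈ range P := ⟨11, rfl⟩
  have hsurj : P.Surjective := by
    refine M.dual_connected (range P) ⟨f, hfP⟩ ?_
    intro e g hg g' hge hge'
    obtain ⟨x, y, -, hx⟩ := M.isPair_verts e
    have hx := (hx x).2 (Or.inl rfl)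
    have hxg' : M.Touches x g' := ⟨e, hx, hge'⟩
    rcases hcl x g (hrange g hg) ⟨e, hx, hge⟩ with ((⟨i, rfl⟩ | ⟨i, rfl⟩) | ⟨i, rfl⟩) | ⟨i, rfl⟩
    · rcases ((hv i).touches_iff g').1 hxg' with rfl | rfl | rfl
      exacts [hfP, hAP _, hAP _]
    · rcases ((hw i).touches_iff g').1 hxg' with rfl | rfl | rfl
      exacts [hAP _, hAP _, hBP _]
    · rcases ((hu i).touches_iff g').1 hxg' with rfl | rfl | rfl
      exacts [hAP _, hBP _, hBP _]
    · rcases ((hz i).touches_iff g').1 hxg' with rfl | rfl | rfl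
      exacts [hBP _, hBP _, hRP]
  have hbij : P.Bijective :=
    (Fintype.bijective_iff_surjective_and_card P).2 ⟨hsurj, by simp [hF]⟩
  have hcorner : ∀ τ : dodecahedronVertices, ∃ x, ∃ i j k : Fin 12, τ.1 = {i, j, k} ∧
      M.IsCorner x (P i) (P j) (P k) := by
    rintro ⟨τ, hτ⟩
    obtain ⟨i, rfl | rfl | rfl | rfl⟩ := mem_dodecahedronVertices τ hτ
    · exact ⟨v i, _, _, _, rfl, hPA i ▸ hPA (i + 1) ▸ hv i⟩
    · exact ⟨w i, _, _, _, rfl, hPA i ▸ hPA (i + 1) ▸ hPB i ▸ hw i⟩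
    · exact ⟨u i, _, _, _, rfl, hPA (i + 1) ▸ hPB i ▸ hPB (i + 1) ▸ hu i⟩
    · exact ⟨z i, _, _, _, rfl, hPB i ▸ hPB (i + 1) ▸ hz i⟩
  have htouch : ∀ τ : dodecahedronVertices, ∃ x, (∀ i, M.Touches x (P i) ↔ i ∈ τ.1) ∧
      ∀ σ ⊆ τ.1, σ.card = 2 → ∃ e, M.ve x e ∧ ∀ l, M.ef e (P l) ↔ l ∈ σ := by
    intro τ
    obtain ⟨x, i, j, k, hτ, hx⟩ := hcorner τ
    refine ⟨x, fun l => ?_, fun σ hσ h2 => hx.ef_pair hbij.1 (hτ ▸ hσ) h2⟩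
    rw [hx.touches_iff, hτ]
    simp [hbij.1.eq_iff]
  choose W hW hWσ using htouch
  have hWbij : W.Bijective := by
    refine (Fintype.bijective_iff_injective_and_card W).2 ⟨fun τ τ' h => ?_, ?_⟩
    · ext i
      rw [← hW, ← hW, h]
    · rw [Fintype.card_coe, card_dodecahedronVertices, hV]
  have hedge : ∀ σ : dodecahedronEdges, ∃ e, ∀ l, M.ef e (P l) ↔ l ∈ σ.1 := by
    rintro ⟨σ, hσ⟩
    obtain ⟨τ, hτ, hσ⟩ := Finset.mem_biUnion.1 hσ
    rw [Finset.mem_powersetCard] at hσ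
    obtain ⟨e, -, he⟩ := hWσ ⟨τ, hτ⟩ σ hσ.1 hσ.2
    exact ⟨e, he⟩
  choose Q hQ using hedge
  have hQbij : Q.Bijective := by
    refine (Fintype.bijective_iff_injective_and_card Q).2 ⟨fun σ σ' h => ?_, ?_⟩
    · ext i
      rw [← hQ, ← hQ, h]
    · rw [Fintype.card_coe, card_dodecahedronEdges, hE]
  refine ⟨.ofBijective P hbij, .ofBijective Q hQbij, .ofBijective W hWbij, hQ, hW,
    fun τ σ => ⟨fun h i hi => (hW τ i).1 ⟨Q σ, h, (hQ σ i).2 hi⟩, fun h => ?_⟩⟩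
  obtain ⟨τ', -, hσ⟩ := Finset.mem_biUnion.1 σ.2
  obtain ⟨e, hev, he⟩ := hWσ τ σ.1 h (Finset.mem_powersetCard.1 hσ).2
  obtain ⟨σ', rfl⟩ := hQbij.2 e
  have : σ' = σ := by
    ext i
    rw [← hQ, he]
  exact this ▸ hev

end PentagonalSphere

/-! ### Uniqueness -/

namespace SphericalTiling

variable {T : SphericalTiling}

theorem exists_edge_of_mem_verts (T : SphericalTiling) :
    ∀ v ∈ T.verts, ∃ e ∈ T.edges, v ∈ e := by
  intro v hv
  by_contra! h
  have h1 : {e ∈ T.edges | v ∈ e} = ∅ := by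
    rw [eq_empty_iff_forall_notMem]
    exact fun e he => h e he.1 he.2
  have h2 : {e ∈ T.edges | e ∩ T.verts = {v}} = ∅ := by
    rw [eq_empty_iff_forall_notMem]
    exact fun e he => h e he.1 (he.2.symm ▸ rfl : v ∈ e ∩ T.verts).1
  have := T.three_le_degree v hv
  rw [SphereGraph.degree, h1, h2] at this
  simp at this

/-- The boundary of a tile as a cycle indexed by `ZMod 5`. -/
theorem exists_pentagon (hT : T.IsCombinatoriallyMonohedral 5) {F : Set Sphere2}
    (hF : F ∈ T.faces) :
    ∃ (p : ZMod 5 → T.verts) (q : ZMod 5 → T.edges), p.Injective ∧ q.Injective ∧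
      (∀ e : T.edges, e.1 ⊆ closure F ↔ ∃ i, q i = e) ∧
      (∀ i (v : T.verts), v.1 ∈ (q i).1 ↔ v = p i ∨ v = p (i + 1)) ∧
      ∀ v : T.verts, v.1 ∈ closure F → ∃ i, p i = v := by
  obtain ⟨p, q, hp5, hp, hq, hqim, hpim, hpq⟩ :=
    SphereGraph.exists_boundary_cycle (fun F hF => (hT F hF).2) hF (hT F hF).1 (by norm_num)
  have hlt : ∀ i : ZMod 5, i.val ∈ Iio 5 := fun i => ZMod.val_lt i
  have hpm : ∀ i : ZMod 5, p i.val ∈ T.verts ∩ closure F := fun i => hpim ▸ ⟨_, hlt i, rfl⟩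
  have hqm : ∀ i : ZMod 5, q i.val ∈ T.toSphereGraph.sides F := fun i => hqim ▸ ⟨_, hlt i, rfl⟩
  have hval : ∀ n : ℕ, n ∈ Iio 5 → ((n : ZMod 5)).val = n := fun n hn => ZMod.val_cast_of_lt hn
  have hsucc : ∀ i : ZMod 5, p (i + 1).val = p (i.val + 1) := by
    intro i
    rcases (by revert i; decide : ∀ i : ZMod 5, (i + 1).val = i.val + 1 ∨
      (i.val + 1 = 5 ∧ (i + 1).val = 0)) i with h | ⟨h, h'⟩
    · rw [h]
    · rw [h, h', hp5]
  refine ⟨fun i => ⟨p i.val, (hpm i).1⟩, fun i => ⟨q i.val, (hqm i).1⟩, ?_, ?_, ?_, ?_, ?_⟩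
  · intro i j h
    exact ZMod.val_injective 5 (hp (hlt i) (hlt j) (congrArg Subtype.val h))
  · intro i j h
    exact ZMod.val_injective 5 (hq (hlt i) (hlt j) (congrArg Subtype.val h))
  · rintro ⟨e, he⟩
    rw [← SphereGraph.subset_closure_diff_iff hF he]
    constructor
    · intro h
      obtain ⟨n, hn, rfl⟩ := hqim.symm ▸ (show e ∈ T.toSphereGraph.sides F from ⟨he, h⟩)
      exact ⟨n, Subtype.ext (by simp only [hval n hn])⟩
    · rintro ⟨i, h⟩
      have h' : q i.val = e := congrArg Subtype.val h
      exact h' ▸ (hqm i).2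
  · rintro i ⟨v, hv⟩
    rw [Subtype.ext_iff (a2 := ⟨p i.val, (hpm i).1⟩), Subtype.ext_iff (a2 := ⟨p (i + 1).val, _⟩)]
    change v ∈ q i.val ↔ v = p i.val ∨ v = p (i + 1).val
    rw [hsucc]
    have : v ∈ q i.val ↔ v ∈ q i.val ∩ T.verts := ⟨fun h => ⟨h, hv⟩, fun h => h.1⟩
    rw [this, hpq _ (hlt i)]
    rfl
  · rintro ⟨v, hv⟩ h
    obtain ⟨n, hn, rfl⟩ := hpim.symm ▸ (show v ∈ T.verts ∩ closure F from ⟨hv, h⟩)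
    exact ⟨n, Subtype.ext (by simp only [hval n hn])⟩

/-- There are no loops, because the ends of a side of a pentagon are different. So the degree of a
vertex is the number of edges at it. -/
theorem three_le_ncard (hT : T.IsCombinatoriallyMonohedral 5) (v : T.verts) :
    3 ≤ {e : T.edges | v.1 ∈ e.1}.ncard := by
  have h1 := T.three_le_degree v.1 v.2
  have hloop : {e ∈ T.edges | e ∩ T.verts = {v.1}} = ∅ := by
    rw [eq_empty_iff_forall_notMem]
    rintro e ⟨he, hev⟩
    obtain ⟨F, hF, F', -, -, h⟩ :=
      SphereGraph.exists_faces_of_edge (fun F hF => (hT F hF).2) he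
    obtain ⟨p, q, hp, -, hq, hpq, -⟩ := exists_pentagon hT hF
    obtain ⟨i, hi⟩ := (hq ⟨e, he⟩).1 ((h F hF).2 (Or.inl rfl))
    have hmem : ∀ w : T.verts, w = p i ∨ w = p (i + 1) → w = v := fun w hw => by
      have h' := (hpq i w).2 hw
      rw [hi] at h'
      have h'' : w.1 ∈ e ∩ T.verts := ⟨h', w.2⟩
      rw [hev] at h''
      exact Subtype.ext h''
    exact (by decide : ∀ i : ZMod 5, i ≠ i + 1) i
      (hp ((hmem _ (Or.inl rfl)).trans (hmem _ (Or.inr rfl)).symm))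
  rw [SphereGraph.degree, hloop, ncard_empty, add_zero] at h1
  rw [← ncard_image_of_injective _ Subtype.val_injective]
  convert h1 using 2
  ext e
  constructor
  · rintro ⟨e, he, rfl⟩
    exact ⟨e.2, he⟩
  · rintro ⟨he, hv⟩
    exact ⟨⟨e, he⟩, hv, rfl⟩

/-- The incidences of a spherical tiling by combinatorially congruent pentagons. -/
def toPentagonalSphere (hT : T.IsCombinatoriallyMonohedral 5) (hfin : T.faces.Finite) :
    PentagonalSphere T.verts T.edges T.faces where
  ve v e := v.1 ∈ e.1
  ef e f := e.1 ⊆ closure f.1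
  exists_cycle f := by
    obtain ⟨p, q, hp, hq, h1, h2, -⟩ := exists_pentagon hT f.2
    exact ⟨p, q, hp, hq, h1, h2⟩
  isPair_faces e := by
    obtain ⟨F, hF, F', hF', hne, h⟩ :=
      SphereGraph.exists_faces_of_edge (fun F hF => (hT F hF).2) e.2
    refine ⟨⟨F, hF⟩, ⟨F', hF'⟩, fun h => hne (congrArg Subtype.val h), fun f => ?_⟩
    beta_reduce
    rw [h f.1 f.2, Subtype.ext_iff, Subtype.ext_iff]
  link_connected v C hC hCv hadj f hf := by
    obtain ⟨e, hve, hef⟩ := hf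
    obtain ⟨g, hg, hgf⟩ := SphereGraph.link_connected (C := Subtype.val '' C) (v := v.1) hfin
      (fun F hF => (hT F hF).2) T.exists_edge_of_mem_verts (by
        rintro _ ⟨g, hg, rfl⟩
        obtain ⟨e, he, h⟩ := hCv g hg
        exact ⟨g.2, h he⟩) (by
        rintro _ ⟨g, hg, rfl⟩ F' hF' e he hve h h'
        exact ⟨⟨F', hF'⟩, hadj ⟨e, he⟩ hve g hg ⟨F', hF'⟩ h h', rfl⟩) (hC.image _) v.2 f.2
      (hef hve)
    exact Subtype.ext hgf ▸ hg
  dual_connected C hC hadj f := by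
    obtain ⟨g, hg, hgf⟩ := SphereGraph.dual_connected (C := Subtype.val '' C) hfin
      (fun F hF => (hT F hF).2) T.exists_edge_of_mem_verts (by
        rintro _ ⟨g, hg, rfl⟩
        exact g.2) (by
        rintro _ ⟨g, hg, rfl⟩ F' hF' e he h h'
        exact ⟨⟨F', hF'⟩, hadj ⟨e, he⟩ g hg ⟨F', hF'⟩ h h', rfl⟩) (hC.image _) f.2
    exact Subtype.ext hgf ▸ hg
  exists_coboundary c hc := by
    classical
    let c' : Set Sphere2 → ZMod 2 := fun e => if h : e ∈ T.edges then c ⟨e, h⟩ else 0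
    have hc' : ∀ e (he : e ∈ T.edges), c' e = c ⟨e, he⟩ := fun e he => dif_pos he
    obtain ⟨g, hg⟩ := SphereGraph.exists_coboundary hfin (fun F hF => (hT F hF).2)
      T.exists_edge_of_mem_verts c' (by
        intro v hv
        obtain ⟨g, hg⟩ := hc ⟨v, hv⟩
        refine ⟨fun F => if h : F ∈ T.faces then g ⟨F, h⟩ else 0, ?_⟩
        intro e he hve F hF F' hF' hne h h'
        beta_reduce
        rw [dif_pos hF, dif_pos hF', hc' e he]
        exact hg ⟨e, he⟩ hve ⟨F, hF⟩ ⟨F', hF'⟩ (fun h => hne (congrArg Subtype.val h)) h h')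
    refine ⟨fun f => g f.1, fun e f f' hne h h' => ?_⟩
    rw [← hc' e.1 e.2]
    exact hg e.1 e.2 f.1 f.2 f'.1 f'.2 (fun h => hne (Subtype.ext h)) h h'
  three_le_degree := three_le_ncard hT

theorem isDodecahedral (hT : T.IsCombinatoriallyMonohedral 5) (hcard : T.tiles.ncard = 12) :
    T.IsDodecahedral := by
  have hinj := T.closure_injOn_faces
  have hfc : T.faces.ncard = 12 := by
    rw [← hcard, SphereGraph.tiles, hinj.ncard_image]
  have hfin : T.faces.Finite := finite_of_ncard_ne_zero (by omega)
  let _ : Fintype T.faces := hfin.fintype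
  let _ : Fintype T.edges := T.finite_edges.fintype
  let _ : Fintype T.verts := T.finite_verts.fintype
  obtain ⟨P, Q, W, hQP, hWP, hWQ⟩ := (toPentagonalSphere hT hfin).exists_dodecahedral (by
    rw [← hfc, ← Nat.card_coe_set_eq, Nat.card_eq_fintype_card])
  refine ⟨P.trans (BijOn.equiv closure hinj.bijOn_image), Q, W, hQP, fun v i => ?_, hWQ⟩
  rw [← hWP]
  change (W v).1 ∈ closure (P i).1 ↔ ∃ e : T.edges, (W v).1 ∈ e.1 ∧ e.1 ⊆ closure (P i).1
  constructor
  · intro h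
    obtain ⟨p, q, -, -, hq, hpq, hp⟩ := exists_pentagon hT (P i).2
    obtain ⟨j, hj⟩ := hp (W v) h
    exact ⟨q j, (hpq j _).2 (Or.inl hj.symm), (hq _).2 ⟨j, rfl⟩⟩
  · rintro ⟨e, hve, he⟩
    exact he hve

end SphericalTiling

/-! ### A convex dodecahedron -/

namespace Pyritohedron

/-- The outer normals of the twelve faces of a convex dodecahedron with integral vertices, the
faces being numbered as in `dodecahedronVertices`. -/
def normal : Fin 12 → Fin 3 → ℤ :=
  ![![1, 2, 0], ![-1, 2, 0], ![0, 1, 2], ![2, 0, 1], ![2, 0, -1], ![0, 1, -2], ![-2, 0, 1],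
    ![0, -1, 2], ![1, -2, 0], ![0, -1, -2], ![-2, 0, -1], ![-1, -2, 0]]

/-- The twenty vertices of the convex dodecahedron. The scalar product of a normal with a vertex
is `12` if the vertex is on the face, and smaller otherwise. -/
def corner : Fin 20 → Fin 3 → ℤ :=
  ![![0, 6, 3], ![4, 4, 4], ![6, 3, 0], ![4, 4, -4], ![0, 6, -3], ![-4, 4, 4], ![3, 0, 6],
    ![6, -3, 0], ![3, 0, -6], ![-4, 4, -4], ![-3, 0, 6], ![4, -4, 4], ![4, -4, -4], ![-3, 0, -6],
    ![-6, 3, 0], ![-4, -4, 4], ![0, -6, 3], ![0, -6, -3], ![-4, -4, -4], ![-6, -3, 0]]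

/-- The first face at each of the thirty edges. -/
def face₁ : Fin 30 → Fin 12 :=
  ![0, 0, 1, 0, 2, 0, 3, 0, 4, 1, 2, 1, 2, 3, 3, 4, 4, 5, 5, 1, 6, 7, 8, 9, 6, 7, 6, 8, 9, 10]

/-- The second face at each edge. -/
def face₂ : Fin 30 → Fin 12 :=
  ![2, 1, 2, 3, 3, 4, 4, 5, 5, 5, 6, 6, 7, 7, 8, 8, 9, 9, 10, 10, 7, 8, 9, 10, 10, 11, 11, 11, 11,
    11]

/-- The third face at the first end point of each edge. -/
def cap₁ : Fin 30 → Fin 12 :=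
  ![1, 2, 0, 2, 0, 3, 0, 4, 0, 0, 1, 2, 3, 2, 4, 3, 5, 4, 1, 5, 2, 3, 4, 5, 1, 6, 7, 7, 8, 9]

/-- The third face at the second end point of each edge. -/
def cap₂ : Fin 30 → Fin 12 :=
  ![3, 5, 6, 4, 7, 5, 8, 1, 9, 10, 7, 10, 6, 8, 7, 9, 8, 10, 9, 6, 11, 11, 11, 11, 11, 8, 10, 9, 10,
    6]

/-- The first end point of each edge. -/
def end₁ : Fin 30 → Fin 20 :=
  ![0, 0, 0, 1, 1, 2, 2, 3, 3, 4, 5, 5, 6, 6, 7, 7, 8, 8, 9, 9, 10, 11, 12, 13, 14, 15, 15, 16, 17,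
    18]

/-- The second end point of each edge. -/
def end₂ : Fin 30 → Fin 20 :=
  ![1, 4, 5, 2, 6, 3, 7, 4, 8, 9, 10, 14, 10, 11, 11, 12, 12, 13, 13, 14, 15, 16, 17, 18, 19, 16,
    19, 17, 18, 19]

/-- The scalar product of integral vectors. -/
def dot (a b : Fin 3 → ℤ) : ℤ := a 0 * b 0 + a 1 * b 1 + a 2 * b 2

/-- The determinant with the given rows. -/
def det₃ (p q r : Fin 3 → ℤ) : ℤ :=
  p 0 * (q 1 * r 2 - q 2 * r 1) - p 1 * (q 0 * r 2 - q 2 * r 0) + p 2 * (q 0 * r 1 - q 1 * r 0)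

theorem dot_le : ∀ j k, dot (normal k) (corner j) ≤ 12 := by decide +kernel

theorem dot_normal_self : ∀ k, dot (normal k) (normal k) = 5 := by decide +kernel

theorem dot_normal_lt : ∀ k i, k ≠ i → dot (normal k) (normal i) < 5 := by decide +kernel

theorem dot_ends : ∀ e,
    dot (normal (face₁ e)) (corner (end₁ e)) = 12 ∧ dot (normal (face₂ e)) (corner (end₁ e)) = 12 ∧
    dot (normal (face₁ e)) (corner (end₂ e)) = 12 ∧ dot (normal (face₂ e)) (corner (end₂ e)) = 12 ∧
    dot (normal (cap₁ e)) (corner (end₁ e)) = 12 ∧ dot (normal (cap₁ e)) (corner (end₂ e)) < 12 ∧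
    dot (normal (cap₂ e)) (corner (end₂ e)) = 12 ∧ dot (normal (cap₂ e)) (corner (end₁ e)) < 12 := by
  decide +kernel

theorem det_ne : ∀ e, det₃ (normal (face₁ e) - normal (face₂ e))
    (normal (face₁ e) - normal (cap₁ e)) (normal (face₁ e) - normal (cap₂ e)) ≠ 0 := by
  decide +kernel

theorem eq_end : ∀ e j, dot (normal (face₁ e)) (corner j) = 12 →
    dot (normal (face₂ e)) (corner j) = 12 → j = end₁ e ∨ j = end₂ e := by
  decide +kernel

theorem dot_lt_of_ne : ∀ e r, r ≠ face₁ e → r ≠ face₂ e →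
    dot (normal r) (corner (end₁ e)) < 12 ∨ dot (normal r) (corner (end₂ e)) < 12 := by
  decide +kernel

theorem exists_face_ne : ∀ e e', e ≠ e' → (face₁ e' ≠ face₁ e ∧ face₁ e' ≠ face₂ e) ∨
    (face₂ e' ≠ face₁ e ∧ face₂ e' ≠ face₂ e) := by
  decide +kernel

theorem eq_of_ends : ∀ e e', (end₁ e = end₁ e' ∨ end₁ e = end₂ e') →
    (end₂ e = end₁ e' ∨ end₂ e = end₂ e') → e = e' := by
  decide +kernel

theorem exists_smaller_neighbour : ∀ j, j ≠ 0 → ∃ e, (end₁ e = j ∧ end₂ e < j) ∨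
    (end₂ e = j ∧ end₁ e < j) := by
  decide +kernel

theorem card_edges_of_face : ∀ i,
    (Finset.univ.filter fun e => i = face₁ e ∨ i = face₂ e).card = 5 := by
  decide +kernel

theorem card_edges_of_vertex : ∀ j,
    (Finset.univ.filter fun e => j = end₁ e ∨ j = end₂ e).card = 3 := by
  decide +kernel

/-- The value of the linear form with the given normal. -/
def val (k : Fin 12) (x : EuclideanSpace ℝ (Fin 3)) : ℝ :=
  normal k 0 * x 0 + normal k 1 * x 1 + normal k 2 * x 2

/-- An integral vector as an element of Euclidean space. -/
noncomputable def vec (a : Fin 3 → ℤ) : EuclideanSpace ℝ (Fin 3) :=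
  WithLp.toLp 2 fun c => (a c : ℝ)

theorem val_vec (k : Fin 12) (a : Fin 3 → ℤ) : val k (vec a) = dot (normal k) a := by
  simp [val, vec, dot]

theorem val_add (k : Fin 12) (x y : EuclideanSpace ℝ (Fin 3)) :
    val k (x + y) = val k x + val k y := by
  simp [val]
  ring

theorem val_smul (k : Fin 12) (c : ℝ) (x : EuclideanSpace ℝ (Fin 3)) :
    val k (c • x) = c * val k x := by
  simp [val]
  ring

theorem val_sub (k : Fin 12) (x y : EuclideanSpace ℝ (Fin 3)) :
    val k (x - y) = val k x - val k y := by
  simp [val]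
  ring

@[simp]
theorem val_zero (k : Fin 12) : val k 0 = 0 := by
  simp [val]

theorem continuous_val (k : Fin 12) : Continuous (val k) := by
  unfold val
  fun_prop

theorem val_eq_inner (k : Fin 12) (x : EuclideanSpace ℝ (Fin 3)) :
    val k x = inner ℝ (vec (normal k)) x := by
  simp [val, vec, PiLp.inner_apply, Fin.sum_univ_three]
  ring

theorem eq_zero_of_coords {x : EuclideanSpace ℝ (Fin 3)} (h0 : x 0 = 0) (h1 : x 1 = 0)
    (h2 : x 2 = 0) : x = 0 := by
  ext c
  fin_cases c <;> assumption

theorem val_cases {x : EuclideanSpace ℝ (Fin 3)} {P : ℝ → Prop} (h : ∀ k, P (val k x)) :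
    P (x 0 + 2 * x 1) ∧ P (-x 0 + 2 * x 1) ∧ P (x 1 + 2 * x 2) ∧ P (2 * x 0 + x 2) ∧
    P (2 * x 0 - x 2) ∧ P (x 1 - 2 * x 2) ∧ P (-2 * x 0 + x 2) ∧ P (-x 1 + 2 * x 2) ∧
    P (x 0 - 2 * x 1) ∧ P (-x 1 - 2 * x 2) ∧ P (-2 * x 0 - x 2) ∧ P (-x 0 - 2 * x 1) := by
  refine ⟨?_, ?_, ?_, ?_, ?_, ?_, ?_, ?_, ?_, ?_, ?_, ?_⟩
  · convert h 0 using 1; simp [val, normal]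
  · convert h 1 using 1; simp [val, normal]
  · convert h 2 using 1; simp [val, normal]
  · convert h 3 using 1; simp [val, normal]
  · convert h 4 using 1; simp [val, normal]; ring
  · convert h 5 using 1; simp [val, normal]; ring
  · convert h 6 using 1; simp [val, normal]
  · convert h 7 using 1; simp [val, normal]
  · convert h 8 using 1; simp [val, normal]; ring
  · convert h 9 using 1; simp [val, normal]; ring
  · convert h 10 using 1; simp [val, normal]; ring
  · convert h 11 using 1; simp [val, normal]; ring

/-- The normals positively span the space. -/
theorem eq_zero_of_val_nonpos {x : EuclideanSpace ℝ (Fin 3)} (h : ∀ k, val k x ≤ 0) : x = 0 := by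
  obtain ⟨h0, h1, h2, h3, h4, h5, h6, h7, h8, h9, h10, h11⟩ := val_cases (P := (· ≤ 0)) h
  exact eq_zero_of_coords (by linarith) (by linarith) (by linarith)

theorem abs_coord_le {x : EuclideanSpace ℝ (Fin 3)} (h : ∀ k, val k x ≤ 5) (c : Fin 3) :
    |x c| ≤ 5 := by
  obtain ⟨h0, h1, h2, h3, h4, h5, h6, h7, h8, h9, h10, h11⟩ := val_cases (P := (· ≤ 5)) h
  rw [abs_le]
  fin_cases c
  · constructor <;> simp only [Fin.zero_eta] <;> linarith
  · constructor <;> simp only [Fin.mk_one] <;> linarith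
  · constructor <;> simp only [Fin.reduceFinMk] <;> linarith

/-- Two different linear forms can only both be maximal at a point if their faces are adjacent. -/
theorem exists_edge_of_val_eq {x : EuclideanSpace ℝ (Fin 3)} (hx : x ≠ 0) {i k : Fin 12}
    (hik : i ≠ k) (h : ∀ l, val l x ≤ val i x) (hk : val k x = val i x) :
    ∃ e, (face₁ e = i ∧ face₂ e = k) ∨ (face₁ e = k ∧ face₂ e = i) := by
  by_contra hne
  apply hx
  apply eq_zero_of_val_nonpos
  suffices val i x ≤ 0 from fun l => (h l).trans this
  obtain ⟨m, hm⟩ : ∃ m, val i x = m := ⟨_, rfl⟩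
  rw [hm] at h hk ⊢
  obtain ⟨h0, h1, h2, h3, h4, h5, h6, h7, h8, h9, h10, h11⟩ := val_cases (P := (· ≤ m)) h
  clear h hx
  fin_cases i <;> fin_cases k <;> first
    | exact absurd rfl hik
    | exact absurd (by decide +kernel) hne
    | (simp [val, normal] at hm hk; linarith)

theorem eq_zero_of_det_ne {p q r : Fin 3 → ℤ} (hdet : det₃ p q r ≠ 0)
    {y : EuclideanSpace ℝ (Fin 3)} (hp : p 0 * y 0 + p 1 * y 1 + p 2 * y 2 = 0)
    (hq : q 0 * y 0 + q 1 * y 1 + q 2 * y 2 = 0) (hr : r 0 * y 0 + r 1 * y 1 + r 2 * y 2 = 0) :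
    y = 0 := by
  have hd : ((det₃ p q r : ℤ) : ℝ) ≠ 0 := by exact_mod_cast hdet
  simp only [det₃, Int.cast_add, Int.cast_sub, Int.cast_mul] at hd
  refine eq_zero_of_coords (mul_left_cancel₀ hd ?_) (mul_left_cancel₀ hd ?_)
    (mul_left_cancel₀ hd ?_)
  · linear_combination (q 1 * r 2 - q 2 * r 1 : ℝ) * hp - (p 1 * r 2 - p 2 * r 1 : ℝ) * hq +
      (p 1 * q 2 - p 2 * q 1 : ℝ) * hr
  · linear_combination -(q 0 * r 2 - q 2 * r 0 : ℝ) * hp + (p 0 * r 2 - p 2 * r 0 : ℝ) * hq -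
      (p 0 * q 2 - p 2 * q 0 : ℝ) * hr
  · linear_combination (q 0 * r 1 - q 1 * r 0 : ℝ) * hp - (p 0 * r 1 - p 1 * r 0 : ℝ) * hq +
      (p 0 * q 1 - p 1 * q 0 : ℝ) * hr

/-- The linear forms `val i` and `val k` are maximal at `x`. -/
def InWall (i k : Fin 12) (x : EuclideanSpace ℝ (Fin 3)) : Prop :=
  ∀ l, val l x ≤ val i x ∧ val l x ≤ val k x

theorem InWall.val_eq {i k : Fin 12} {x : EuclideanSpace ℝ (Fin 3)} (h : InWall i k x) :
    val i x = val k x := le_antisymm (h i).2 (h k).1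

theorem inWall_smul_iff {i k : Fin 12} {x : EuclideanSpace ℝ (Fin 3)} {c : ℝ} (hc : 0 < c) :
    InWall i k (c • x) ↔ InWall i k x := by
  simp only [InWall, val_smul, mul_le_mul_iff_right₀ hc]

theorem InWall.val_pos {i k : Fin 12} {x : EuclideanSpace ℝ (Fin 3)} (h : InWall i k x)
    (hx : x ≠ 0) : 0 < val i x := by
  by_contra hle
  exact hx (eq_zero_of_val_nonpos fun l => (h l).1.trans (not_lt.1 hle))

theorem val_corner_le (k : Fin 12) (j : Fin 20) : val k (vec (corner j)) ≤ 12 := by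
  rw [val_vec]
  exact_mod_cast dot_le j k

theorem val_corner_lt {k : Fin 12} {j : Fin 20} (h : dot (normal k) (corner j) < 12) :
    val k (vec (corner j)) < 12 := by
  rw [val_vec]
  exact_mod_cast h

theorem val_corner_eq {k : Fin 12} {j : Fin 20} (h : dot (normal k) (corner j) = 12) :
    val k (vec (corner j)) = 12 := by
  rw [val_vec, h]
  norm_num

theorem inWall_combination (e : Fin 30) {s t : ℝ} (hs : 0 ≤ s) (ht : 0 ≤ t) :
    InWall (face₁ e) (face₂ e) (s • vec (corner (end₁ e)) + t • vec (corner (end₂ e))) := by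
  obtain ⟨h1, h2, h3, h4, -⟩ := dot_ends e
  intro l
  simp only [val_add, val_smul, val_corner_eq h1, val_corner_eq h2, val_corner_eq h3,
    val_corner_eq h4]
  have := mul_le_mul_of_nonneg_left (val_corner_le l (end₁ e)) hs
  have := mul_le_mul_of_nonneg_left (val_corner_le l (end₂ e)) ht
  constructor <;> linarith

/-- The cone where two adjacent linear forms are maximal is spanned by the end points of the
edge. -/
theorem InWall.exists_combination {e : Fin 30} {x : EuclideanSpace ℝ (Fin 3)}
    (h : InWall (face₁ e) (face₂ e) x) : ∃ s t : ℝ, 0 ≤ s ∧ 0 ≤ t ∧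
      x = s • vec (corner (end₁ e)) + t • vec (corner (end₂ e)) := by
  obtain ⟨h1, h2, h3, h4, h5, h6, h7, h8⟩ := dot_ends e
  have h6' := val_corner_lt h6
  have h8' := val_corner_lt h8
  set a := vec (corner (end₁ e))
  set b := vec (corner (end₂ e))
  set s := (val (face₁ e) x - val (cap₂ e) x) / (12 - val (cap₂ e) a) with hs
  set t := (val (face₁ e) x - val (cap₁ e) x) / (12 - val (cap₁ e) b) with ht
  have hs' : s * (12 - val (cap₂ e) a) = val (face₁ e) x - val (cap₂ e) x :=
    div_mul_cancel₀ _ (by linarith)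
  have ht' : t * (12 - val (cap₁ e) b) = val (face₁ e) x - val (cap₁ e) x :=
    div_mul_cancel₀ _ (by linarith)
  refine ⟨s, t, div_nonneg (by linarith [(h (cap₂ e)).1]) (by linarith),
    div_nonneg (by linarith [(h (cap₁ e)).1]) (by linarith), ?_⟩
  rw [← sub_eq_zero]
  have key : ∀ i k : Fin 12, val i (x - (s • a + t • b)) = val k (x - (s • a + t • b)) →
      ((normal i - normal k) 0 : ℤ) * (x - (s • a + t • b)) 0 +
      ((normal i - normal k) 1 : ℤ) * (x - (s • a + t • b)) 1 +
      ((normal i - normal k) 2 : ℤ) * (x - (s • a + t • b)) 2 = 0 := by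
    intro i k hik
    rw [val, val] at hik
    simp only [Pi.sub_apply, Int.cast_sub]
    linear_combination hik
  refine eq_zero_of_det_ne (det_ne e) (key _ _ ?_) (key _ _ ?_) (key _ _ ?_) <;>
    simp only [val_sub, val_add, val_smul, a, b, val_corner_eq h1, val_corner_eq h2,
      val_corner_eq h3, val_corner_eq h4, val_corner_eq h5, val_corner_eq h7]
  · linarith [h.val_eq]
  · linarith
  · linarith

end Pyritohedron

/-! ### Radial projection, charts and disks -/

/-- The radial projection to the sphere (with an arbitrary value at the origin). -/
noncomputable def dir (x : EuclideanSpace ℝ (Fin 3)) : Sphere2 :=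
  if h : x = 0 then ⟨EuclideanSpace.single 0 1, by simp⟩
  else ⟨‖x‖⁻¹ • x, by simp [norm_smul, h]⟩

theorem coe_dir {x : EuclideanSpace ℝ (Fin 3)} (hx : x ≠ 0) :
    (dir x : EuclideanSpace ℝ (Fin 3)) = ‖x‖⁻¹ • x := by
  simp [dir, hx]

theorem Sphere2.norm_eq (x : Sphere2) : ‖(x : EuclideanSpace ℝ (Fin 3))‖ = 1 :=
  norm_eq_of_mem_sphere x

theorem Sphere2.ne_zero (x : Sphere2) : (x : EuclideanSpace ℝ (Fin 3)) ≠ 0 := by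
  intro h
  have := Sphere2.norm_eq x
  simp [h] at this

theorem dir_coe (x : Sphere2) : dir x = x := by
  ext1
  rw [coe_dir x.ne_zero, x.norm_eq, inv_one, one_smul]

theorem dir_smul {x : EuclideanSpace ℝ (Fin 3)} {c : ℝ} (hx : x ≠ 0) (hc : 0 < c) :
    dir (c • x) = dir x := by
  ext1
  rw [coe_dir hx, coe_dir (smul_ne_zero hc.ne' hx), norm_smul, Real.norm_of_nonneg hc.le, smul_smul]
  congr 1
  field_simp

theorem continuousOn_dir : ContinuousOn dir {0}ᶜ := by
  rw [continuousOn_iff_continuous_domRestrict, continuous_induced_rng]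
  have : (Subtype.val ∘ ({0}ᶜ : Set (EuclideanSpace ℝ (Fin 3))).domRestrict dir) =
      fun x => ‖x.1‖⁻¹ • x.1 := by
    ext1 x
    exact coe_dir x.2
  rw [this]
  exact (continuous_subtype_val.norm.inv₀ fun x => norm_ne_zero_iff.2 x.2).smul
    continuous_subtype_val

theorem exists_smul_of_dir_eq {x y : EuclideanSpace ℝ (Fin 3)} (hx : x ≠ 0) (hy : y ≠ 0)
    (h : dir x = dir y) : ∃ c : ℝ, 0 < c ∧ x = c • y := by
  have h' := congrArg Subtype.val h
  rw [coe_dir hx, coe_dir hy] at h'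
  refine ⟨‖x‖ * ‖y‖⁻¹, by positivity, ?_⟩
  rw [← smul_smul, ← h', smul_smul, mul_inv_cancel₀ (norm_ne_zero_iff.2 hx), one_smul]

/-- The plane orthogonal to a nonzero vector is isometric to the complex plane. -/
noncomputable def planeEquiv {v : EuclideanSpace ℝ (Fin 3)} (hv : v ≠ 0) :
    (Submodule.span ℝ {v})ᗮ ≃ₗᵢ[ℝ] ℂ :=
  (OrthonormalBasis.fromOrthogonalSpanSingleton 2 hv).equiv Complex.orthonormalBasisOneI
    (Equiv.refl _)

/-- Near each of its points, a great circle is a straight line in a suitable chart: in the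
stereographic projection from the antipode. -/
theorem exists_chart_of_greatCircle (x : Sphere2) {w : EuclideanSpace ℝ (Fin 3)} (hw : w ≠ 0)
    (hwx : inner ℝ w (x : EuclideanSpace ℝ (Fin 3)) = 0) :
    ∃ φ : OpenPartialHomeomorph Sphere2 ℂ, x ∈ φ.source ∧
      ∀ y ∈ φ.source, (inner ℝ w (y : EuclideanSpace ℝ (Fin 3)) = 0 ↔ (φ y).im = 0) := by
  have hn : ‖((-x : Sphere2) : EuclideanSpace ℝ (Fin 3))‖ = 1 := (-x).norm_eq
  have hw' : w ∈ (Submodule.span ℝ {((-x : Sphere2) : EuclideanSpace ℝ (Fin 3))})ᗮ := by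
    rw [Submodule.mem_orthogonal_singleton_iff_inner_right, real_inner_comm]
    simp [hwx]
  let L := planeEquiv (-x).ne_zero
  let c : ℂ := L ⟨w, hw'⟩
  have hc : c ≠ 0 := by
    simp only [c, Ne, LinearIsometryEquiv.map_eq_zero_iff, Submodule.mk_eq_zero]
    exact hw
  have hc' : (starRingEnd ℂ) c * Complex.I ≠ 0 :=
    mul_ne_zero ((map_ne_zero _).2 hc) Complex.I_ne_zero
  refine ⟨(stereographic hn).transHomeomorph
    (L.toHomeomorph.trans (Homeomorph.mulRight₀ _ hc')), ?_, fun y hy => ?_⟩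
  · change x ≠ _
    intro h
    have h1 := congrArg Subtype.val h
    have h2 : (x : EuclideanSpace ℝ (Fin 3)) = -x := h1
    have h3 : (2 : ℝ) • (x : EuclideanSpace ℝ (Fin 3)) = 0 := by
      rw [two_smul]
      exact add_eq_zero_iff_eq_neg.2 h2
    exact x.ne_zero ((smul_eq_zero.1 h3).resolve_left two_ne_zero)
  · have hy' : (y : EuclideanSpace ℝ (Fin 3)) ≠ (-x : Sphere2) := fun h => hy (Subtype.ext h)
    have hlt := (inner_lt_one_iff_real_of_norm_eq_one hn y.norm_eq).2 hy'.symm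
    have hval : ((stereographic hn).transHomeomorph
        (L.toHomeomorph.trans (Homeomorph.mulRight₀ _ hc'))) y =
        L (stereographic hn y) * ((starRingEnd ℂ) c * Complex.I) := rfl
    have him : ∀ z : ℂ, (z * ((starRingEnd ℂ) c * Complex.I)).im = inner ℝ c z := by
      intro z
      rw [Complex.inner, ← mul_assoc, Complex.mul_I_im]
    rw [hval, him, L.inner_map_map, stereographic_apply, inner_smul_right,
      Submodule.inner_orthogonalProjectionOnto_eq_of_mem_left]
    have : (2 / (1 - inner ℝ ((-x : Sphere2) : EuclideanSpace ℝ (Fin 3)) y) : ℝ) ≠ 0 :=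
      div_ne_zero two_ne_zero (by linarith)
    rw [mul_eq_zero, or_iff_right this]

namespace Pyritohedron

theorem vec_normal_ne_zero (i : Fin 12) : vec (normal i) ≠ 0 := by
  intro h
  have := val_vec i (normal i)
  rw [h, dot_normal_self] at this
  norm_num at this

theorem val_normal_self (i : Fin 12) : val i (vec (normal i)) = 5 := by
  rw [val_vec, dot_normal_self]
  norm_num

theorem val_normal_lt {k i : Fin 12} (h : k ≠ i) : val k (vec (normal i)) < 5 := by
  rw [val_vec]
  exact_mod_cast dot_normal_lt k i h

theorem val_dir {x : EuclideanSpace ℝ (Fin 3)} (hx : x ≠ 0) (k : Fin 12) :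
    val k (dir x) = ‖x‖⁻¹ * val k x := by
  rw [coe_dir hx, val_smul]

/-- The open tile with normal `normal i`. -/
def tileInterior (i : Fin 12) : Set Sphere2 := {x | ∀ k, k ≠ i → val k x < val i x}

/-- The part of the sphere where the linear forms `val i` and `val k` are maximal: a closed tile
if `i = k`, and an edge if the faces are adjacent. -/
def wall (i k : Fin 12) : Set Sphere2 := {x | InWall i k x}

theorem continuous_val_coe (k : Fin 12) : Continuous fun x : Sphere2 => val k x :=
  (continuous_val k).comp continuous_subtype_val

theorem isOpen_tileInterior (i : Fin 12) : IsOpen (tileInterior i) := by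
  have : tileInterior i = ⋂ k, {x : Sphere2 | k ≠ i → val k x < val i x} := by
    ext
    simp [tileInterior]
  rw [this]
  refine isOpen_iInter_of_finite fun k => ?_
  by_cases hk : k = i
  · simp [hk]
  · simpa [hk] using isOpen_lt (continuous_val_coe k) (continuous_val_coe i)

theorem isClosed_wall (i k : Fin 12) : IsClosed (wall i k) := by
  have : wall i k = ⋂ l, ({x : Sphere2 | val l x ≤ val i x} ∩ {x : Sphere2 | val l x ≤ val k x}) := by
    ext
    simp [wall, InWall]
  rw [this]
  exact isClosed_iInter fun l =>
    (isClosed_le (continuous_val_coe l) (continuous_val_coe i)).inter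
      (isClosed_le (continuous_val_coe l) (continuous_val_coe k))

theorem dir_mem_wall {i k : Fin 12} {x : EuclideanSpace ℝ (Fin 3)} (hx : x ≠ 0) :
    dir x ∈ wall i k ↔ InWall i k x := by
  change InWall i k (dir x) ↔ _
  rw [coe_dir hx, inWall_smul_iff (by positivity)]

theorem dir_mem_tileInterior {i : Fin 12} {x : EuclideanSpace ℝ (Fin 3)} (hx : x ≠ 0) :
    dir x ∈ tileInterior i ↔ ∀ k, k ≠ i → val k x < val i x := by
  have : 0 < ‖x‖⁻¹ := by positivity
  change (∀ k, k ≠ i → val k (dir x) < val i (dir x)) ↔ _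
  simp only [val_dir hx, mul_lt_mul_iff_right₀ this]

theorem isPreconnected_tileInterior (i : Fin 12) : IsPreconnected (tileInterior i) := by
  let C : Set (EuclideanSpace ℝ (Fin 3)) := {x | ∀ k, k ≠ i → val k x < val i x}
  have h0 : ∀ x ∈ C, x ≠ 0 := by
    rintro x hx rfl
    obtain ⟨k, hk⟩ := exists_ne i
    simpa using hx k hk
  have hC : Convex ℝ C := by
    intro x hx y hy a b ha hb hab k hk
    simp only [val_add, val_smul]
    rcases ha.eq_or_lt with rfl | ha
    · have hb1 : b = 1 := by linarith
      subst hb1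
      linarith [hy k hk]
    · have := mul_lt_mul_of_pos_left (hx k hk) ha
      have := mul_le_mul_of_nonneg_left (hy k hk).le hb
      linarith
  have : tileInterior i = dir '' C := by
    ext x
    constructor
    · intro hx
      exact ⟨x, hx, dir_coe x⟩
    · rintro ⟨y, hy, rfl⟩
      exact (dir_mem_tileInterior (h0 y hy)).2 hy
  rw [this]
  exact hC.isPreconnected.image _ (continuousOn_dir.mono fun x hx => h0 x hx)

theorem dir_normal_mem (i : Fin 12) : dir (vec (normal i)) ∈ tileInterior i := by
  rw [dir_mem_tileInterior (vec_normal_ne_zero i), val_normal_self]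
  exact fun k hk => val_normal_lt hk

theorem closure_tileInterior (i : Fin 12) : closure (tileInterior i) = wall i i := by
  apply subset_antisymm
  · refine (isClosed_wall i i).closure_subset_iff.2 fun x hx l => ?_
    by_cases hl : l = i
    · simp [hl]
    · exact ⟨(hx l hl).le, (hx l hl).le⟩
  · intro x hx
    have hcont : Continuous fun t : ℝ => (x : EuclideanSpace ℝ (Fin 3)) + t • vec (normal i) := by
      fun_prop
    have hne : ∀ t : ℝ, 0 ≤ t → (x : EuclideanSpace ℝ (Fin 3)) + t • vec (normal i) ≠ 0 := by
      intro t ht h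
      have h1 := congrArg (val i) h
      have h2 : 0 < val i x := InWall.val_pos hx x.ne_zero
      rw [val_add, val_smul, val_normal_self, val_zero] at h1
      linarith
    have h0 : (x : EuclideanSpace ℝ (Fin 3)) + (0 : ℝ) • vec (normal i) ≠ 0 := hne 0 le_rfl
    have hc : ContinuousAt dir ((x : EuclideanSpace ℝ (Fin 3)) + (0 : ℝ) • vec (normal i)) :=
      continuousOn_dir.continuousAt (isOpen_compl_singleton.mem_nhds h0)
    have ht : Filter.Tendsto (fun t : ℝ => dir ((x : EuclideanSpace ℝ (Fin 3)) +
        t • vec (normal i))) (𝓝[>] 0) (𝓝 x) := by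
      have := (hc.comp (f := fun t : ℝ => (x : EuclideanSpace ℝ (Fin 3)) + t • vec (normal i))
        hcont.continuousAt).tendsto.mono_left (nhdsWithin_le_nhds (s := Ioi 0))
      simpa [Function.comp_def, dir_coe] using this
    refine mem_closure_of_tendsto ht ?_
    filter_upwards [self_mem_nhdsWithin] with t (ht : 0 < t)
    rw [dir_mem_tileInterior (hne t ht.le)]
    intro k hk
    simp only [val_add, val_smul, val_normal_self]
    have h1 : val k x ≤ val i x := (hx k).1
    have h2 := mul_lt_mul_of_pos_left (val_normal_lt hk) ht
    linarith

/-- A convex polygon is homeomorphic to a disk, and a closed tile is the radial projection of a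
convex polygon in the plane of the corresponding face. -/
theorem noBoundaryIdentification_tileInterior (i : Fin 12) :
    NoBoundaryIdentification (tileInterior i) := by
  -- `A` parametrizes the plane of the face, and `Q` is the face as a subset of this plane
  let n := vec (normal i)
  let L := (planeEquiv (vec_normal_ne_zero i)).symm
  let A : ℂ → EuclideanSpace ℝ (Fin 3) := fun z => n + L z
  have hAc : Continuous A := continuous_const.add (continuous_subtype_val.comp L.continuous)
  have hLi : ∀ z, val i (L z) = 0 := fun z => by
    rw [val_eq_inner]
    exact Submodule.mem_orthogonal_singleton_iff_inner_right.1 (L z).2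
  have hAi : ∀ z, val i (A z) = 5 := fun z => by
    simp only [A, n, val_add, val_normal_self, hLi, add_zero]
  have hA0 : ∀ z, A z ≠ 0 := fun z h => by
    have := hAi z
    rw [h, val_zero] at this
    norm_num at this
  have hvalc : ∀ k, Continuous fun z => val k (A z) := fun k => (continuous_val k).comp hAc
  have hAlin : ∀ k, IsLinearMap ℝ fun z => val k (L z) := fun k =>
    ⟨fun x y => by simp [val_add], fun c x => by
      rw [L.map_smul, Submodule.coe_smul, val_smul, smul_eq_mul]⟩
  let Q : Set ℂ := {z | ∀ k, val k (A z) ≤ 5}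
  have hQ : ∀ z, dir (A z) ∈ wall i i ↔ z ∈ Q := fun z => by
    rw [dir_mem_wall (hA0 z)]
    simp only [InWall, hAi, and_self]
    exact Iff.rfl
  have hQI : Q = ⋂ k, {z | val k (A z) ≤ 5} := by
    ext
    simp [Q]
  have hQc : IsClosed Q := by
    rw [hQI]
    exact isClosed_iInter fun k => isClosed_le (hvalc k) continuous_const
  have hQconv : Convex ℝ Q := by
    rw [hQI]
    refine convex_iInter fun k => ?_
    have : {z | val k (A z) ≤ 5} = {z | val k (L z) ≤ 5 - val k n} := by
      ext z
      simp only [A, val_add, mem_ofPred_eq]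
      constructor <;> intro h <;> linarith
    rw [this]
    exact convex_halfSpace_le (hAlin k) _
  have hint : interior Q = {z | ∀ k, k ≠ i → val k (A z) < 5} := by
    apply subset_antisymm
    · intro z hz k hk
      refine lt_of_le_of_ne (interior_subset hz k) fun h => ?_
      -- moving away from the centre of the polygon leaves it
      have ht : Filter.Tendsto (fun t : ℝ => (1 + t) • z) (𝓝[>] 0) (𝓝 z) := by
        have : Continuous fun t : ℝ => (1 + t) • z := by fun_prop
        simpa using (this.tendsto 0).mono_left nhdsWithin_le_nhds
      obtain ⟨t, h1, h2⟩ := ((ht.eventually (isOpen_interior.mem_nhds hz)).and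
        self_mem_nhdsWithin).exists
      have h2 : 0 < t := h2
      have h3 := interior_subset (show (1 + t) • z ∈ interior Q from h1) k
      have h4 : val k (L ((1 + t) • z)) = (1 + t) * val k (L z) := (hAlin k).map_smul _ _
      have h5 := val_normal_lt hk
      simp only [A, val_add, n, h4] at h h3
      nlinarith
    · refine interior_maximal (fun z hz k => ?_) ?_
      · by_cases hk : k = i
        · rw [hk, hAi]
        · exact (hz k hk).le
      · have : {z | ∀ k, k ≠ i → val k (A z) < 5} = ⋂ k, {z | k ≠ i → val k (A z) < 5} := by
          ext
          simp
        rw [this]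
        refine isOpen_iInter_of_finite fun k => ?_
        by_cases hk : k = i
        · simp [hk]
        · simpa [hk] using isOpen_lt (hvalc k) continuous_const
  have hintQ : ∀ z, dir (A z) ∈ tileInterior i ↔ z ∈ interior Q := fun z => by
    rw [dir_mem_tileInterior (hA0 z), hint]
    simp only [hAi]
    exact Iff.rfl
  have h0 : (0 : ℂ) ∈ interior Q := by
    rw [hint]
    intro k hk
    simpa [A, n] using val_normal_lt hk
  have hbdd : Bornology.IsBounded Q := by
    rw [isBounded_iff_forall_norm_le]
    refine ⟨9 + ‖n‖, fun z hz => ?_⟩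
    have h1 : ‖A z‖ ≤ 9 := by
      rw [EuclideanSpace.norm_eq, Real.sqrt_le_left (by norm_num), Fin.sum_univ_three]
      have h := fun c => abs_coord_le hz c
      have h' : ∀ c, ‖A z c‖ ^ 2 ≤ 5 ^ 2 := fun c =>
        pow_le_pow_left₀ (norm_nonneg _) (h c) 2
      linarith [h' 0, h' 1, h' 2]
    have h2 : ‖z‖ = ‖A z - n‖ := by
      have h3 : A z - n = L z := add_sub_cancel_left _ _
      rw [h3]
      exact (L.norm_map z).symm
    rw [h2]
    exact (norm_sub_le _ _).trans (add_le_add_left h1 _)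
  obtain ⟨h, hb, hcb, -⟩ :=
    exists_homeomorph_image_interior_closure_frontier_eq_unitBall hQconv ⟨0, h0⟩ hbdd
  rw [hQc.closure_eq] at hcb
  have hb' : h.symm '' Metric.ball 0 1 = interior Q := by
    rw [← hb, ← image_comp]
    simp
  have hcb' : h.symm '' Metric.closedBall 0 1 = Q := by
    rw [← hcb, ← image_comp]
    simp
  have hdA : Continuous fun z => dir (A z) :=
    continuousOn_dir.comp_continuous hAc hA0
  have hsurj : ∀ x : Sphere2, 0 < val i x → ∃ z, dir (A z) = x := by
    intro x hx
    set s := 5 / val i x with hs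
    have hs0 : 0 < s := by positivity
    have hmem : s • (x : EuclideanSpace ℝ (Fin 3)) - n ∈
        (Submodule.span ℝ {vec (normal i)})ᗮ := by
      rw [Submodule.mem_orthogonal_singleton_iff_inner_right, ← val_eq_inner, val_sub, val_smul,
        val_normal_self, hs, div_mul_cancel₀ _ hx.ne', sub_self]
    refine ⟨L.symm ⟨_, hmem⟩, ?_⟩
    simp only [A, LinearIsometryEquiv.apply_symm_apply, add_sub_cancel]
    rw [dir_smul x.ne_zero hs0, dir_coe]
  refine ⟨fun z => dir (A (h.symm z)), (hdA.comp h.symm.continuous).continuousOn, ?_, ?_, ?_⟩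
  · refine Function.Injective.injOn fun z w hzw => h.symm.injective ?_
    obtain ⟨c, -, hc⟩ := exists_smul_of_dir_eq (hA0 _) (hA0 _) hzw
    have h1 := congrArg (val i) hc
    rw [val_smul, hAi, hAi] at h1
    have hc1 : c = 1 := by linarith
    rw [hc1, one_smul] at hc
    exact L.injective (Subtype.ext (add_left_cancel hc))
  · have : (fun z => dir (A (h.symm z))) '' Metric.ball 0 1 =
        (fun z => dir (A z)) '' (h.symm '' Metric.ball 0 1) := by
      rw [← image_comp]
      rfl
    rw [this, hb']
    ext x
    constructor
    · rintro ⟨z, hz, rfl⟩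
      exact (hintQ z).2 hz
    · intro hx
      have hx' : x ∈ wall i i := closure_tileInterior i ▸ subset_closure hx
      obtain ⟨z, rfl⟩ := hsurj x (InWall.val_pos hx' x.ne_zero)
      exact ⟨z, (hintQ z).1 hx, rfl⟩
  · have : (fun z => dir (A (h.symm z))) '' Metric.closedBall 0 1 =
        (fun z => dir (A z)) '' (h.symm '' Metric.closedBall 0 1) := by
      rw [← image_comp]
      rfl
    rw [this, hcb', closure_tileInterior]
    ext x
    constructor
    · rintro ⟨z, hz, rfl⟩
      exact (hQ z).2 hz
    · intro hx
      obtain ⟨z, rfl⟩ := hsurj x (InWall.val_pos hx x.ne_zero)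
      exact ⟨z, (hQ z).1 hx, rfl⟩

end Pyritohedron

/-! ### Existence -/

namespace Pyritohedron

theorem corner_ne_zero (j : Fin 20) : vec (corner j) ≠ 0 := by
  intro h
  obtain ⟨e, he⟩ : ∃ e, j = end₁ e ∨ j = end₂ e := by
    have := card_edges_of_vertex j
    obtain ⟨e, he⟩ := Finset.card_pos.1 (by omega :
      0 < (Finset.univ.filter fun e => j = end₁ e ∨ j = end₂ e).card)
    exact ⟨e, (Finset.mem_filter.1 he).2⟩
  have h12 : val (face₁ e) (vec (corner j)) = 12 := by
    rcases he with rfl | rfl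
    · exact val_corner_eq (dot_ends e).1
    · exact val_corner_eq (dot_ends e).2.2.1
  rw [h, val_zero] at h12
  norm_num at h12

/-- The vertices of the tiling. -/
noncomputable def vertex (j : Fin 20) : Sphere2 := dir (vec (corner j))

/-- The edges of the tiling. -/
def edge (e : Fin 30) : Set Sphere2 := wall (face₁ e) (face₂ e)

theorem vertex_mem_wall {i k : Fin 12} {j : Fin 20} (hi : dot (normal i) (corner j) = 12)
    (hk : dot (normal k) (corner j) = 12) : vertex j ∈ wall i k := by
  rw [vertex, dir_mem_wall (corner_ne_zero j)]
  intro l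
  rw [val_corner_eq hi, val_corner_eq hk]
  exact ⟨val_corner_le l j, val_corner_le l j⟩

theorem exists_dot_eq (j : Fin 20) : ∃ e, dot (normal (face₁ e)) (corner j) = 12 ∧
    dot (normal (face₂ e)) (corner j) = 12 := by
  have := card_edges_of_vertex j
  obtain ⟨e, he⟩ := Finset.card_pos.1 (by omega :
    0 < (Finset.univ.filter fun e => j = end₁ e ∨ j = end₂ e).card)
  obtain ⟨h1, h2, h3, h4, -⟩ := dot_ends e
  refine ⟨e, ?_⟩
  rcases (Finset.mem_filter.1 he).2 with rfl | rfl
  · exact ⟨h1, h2⟩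
  · exact ⟨h3, h4⟩

theorem dot_eq_of_vertex_mem_wall {i k : Fin 12} {j : Fin 20} (h : vertex j ∈ wall i k) :
    dot (normal i) (corner j) = 12 ∧ dot (normal k) (corner j) = 12 := by
  rw [vertex, dir_mem_wall (corner_ne_zero j)] at h
  obtain ⟨e, he, -⟩ := exists_dot_eq j
  have h1 := h (face₁ e)
  rw [val_corner_eq he, val_vec, val_vec] at h1
  exact ⟨le_antisymm (dot_le j i) (by exact_mod_cast h1.1),
    le_antisymm (dot_le j k) (by exact_mod_cast h1.2)⟩

theorem vertex_mem_edge {e : Fin 30} {j : Fin 20} :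
    vertex j ∈ edge e ↔ j = end₁ e ∨ j = end₂ e := by
  constructor
  · intro h
    obtain ⟨h1, h2⟩ := dot_eq_of_vertex_mem_wall h
    exact eq_end e j h1 h2
  · obtain ⟨h1, h2, h3, h4, -⟩ := dot_ends e
    rintro (rfl | rfl)
    · exact vertex_mem_wall h1 h2
    · exact vertex_mem_wall h3 h4

theorem combination_ne_zero (e : Fin 30) {s t : ℝ} (h : 0 < s + t) :
    s • vec (corner (end₁ e)) + t • vec (corner (end₂ e)) ≠ 0 := by
  intro h0
  have h1 := congrArg (val (face₁ e)) h0
  obtain ⟨h2, -, h3, -⟩ := dot_ends e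
  rw [val_add, val_smul, val_smul, val_corner_eq h2, val_corner_eq h3, val_zero] at h1
  linarith

theorem vertex_end_ne (e : Fin 30) : vertex (end₁ e) ≠ vertex (end₂ e) := by
  intro h
  obtain ⟨-, -, -, -, h1, h2, -⟩ := dot_ends e
  have hm : vertex (end₂ e) ∈ wall (cap₁ e) (cap₁ e) := h ▸ vertex_mem_wall h1 h1
  exact h2.ne (dot_eq_of_vertex_mem_wall hm).1

theorem exists_combination_of_mem_edge {e : Fin 30} {x : Sphere2} (hx : x ∈ edge e) :
    ∃ s t : ℝ, 0 ≤ s ∧ 0 ≤ t ∧ 0 < s + t ∧ (x : EuclideanSpace ℝ (Fin 3)) =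
      s • vec (corner (end₁ e)) + t • vec (corner (end₂ e)) := by
  obtain ⟨s, t, hs, ht, h⟩ := InWall.exists_combination hx
  refine ⟨s, t, hs, ht, lt_of_le_of_ne (by positivity) fun h0 => x.ne_zero ?_, h⟩
  rw [h, (by linarith : s = 0), (by linarith : t = 0), zero_smul, zero_smul, add_zero]

/-- A point of an edge where a third linear form is maximal is an end point of the edge. -/
theorem eq_vertex_of_val_eq {e : Fin 30} {x : Sphere2} (hx : x ∈ edge e) {r : Fin 12}
    (h1 : r ≠ face₁ e) (h2 : r ≠ face₂ e) (hr : val r x = val (face₁ e) x) :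
    x = vertex (end₁ e) ∨ x = vertex (end₂ e) := by
  obtain ⟨s, t, hs, ht, hst, hxst⟩ := exists_combination_of_mem_edge hx
  obtain ⟨d1, -, d2, -⟩ := dot_ends e
  rw [hxst] at hr
  simp only [val_add, val_smul, val_corner_eq d1, val_corner_eq d2] at hr
  have l1 := val_corner_le r (end₁ e)
  have l2 := val_corner_le r (end₂ e)
  rw [← dir_coe x, hxst]
  rcases dot_lt_of_ne e r h1 h2 with h | h
  · have hs0 : s = 0 := by
      have := val_corner_lt h
      by_contra hne
      have hs' : 0 < s := lt_of_le_of_ne hs (Ne.symm hne)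
      nlinarith
    subst hs0
    right
    rw [zero_smul, zero_add, dir_smul (corner_ne_zero _) (by linarith), vertex]
  · have ht0 : t = 0 := by
      have := val_corner_lt h
      by_contra hne
      have ht' : 0 < t := lt_of_le_of_ne ht (Ne.symm hne)
      nlinarith
    subst ht0
    left
    rw [zero_smul, add_zero, dir_smul (corner_ne_zero _) (by linarith), vertex]

/-- An edge is parametrized by the radial projection of the segment between two corners. -/
theorem isSimpleCurve_edge (e : Fin 30) :
    IsSimpleCurve (edge e) (vertex (end₁ e)) (vertex (end₂ e)) := by
  let a := vec (corner (end₁ e))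
  let b := vec (corner (end₂ e))
  let f : unitInterval → EuclideanSpace ℝ (Fin 3) := fun t => (1 - (t : ℝ)) • a + (t : ℝ) • b
  have hf0 : ∀ t, f t ≠ 0 := fun t => combination_ne_zero e (by linarith)
  have hfc : Continuous f := by fun_prop
  obtain ⟨d1, -, d2, -⟩ := dot_ends e
  have hval : ∀ t, val (face₁ e) (f t) = 12 := fun t => by
    simp only [f, a, b, val_add, val_smul, val_corner_eq d1, val_corner_eq d2]
    ring
  let γ : Path (vertex (end₁ e)) (vertex (end₂ e)) :=
    { toFun := fun t => dir (f t)
      continuous_toFun := continuousOn_dir.comp_continuous hfc hf0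
      source' := by simp [f, a, vertex]
      target' := by simp [f, b, vertex] }
  refine ⟨γ, ?_, fun s t h => Or.inl ?_⟩
  · ext x
    constructor
    · rintro ⟨t, rfl⟩
      exact (dir_mem_wall (hf0 t)).2 (inWall_combination e (by linarith [t.2.2]) t.2.1)
    · intro hx
      obtain ⟨s, t, hs, ht, hst, hxst⟩ := exists_combination_of_mem_edge hx
      refine ⟨⟨t / (s + t), by positivity, by rw [div_le_one hst]; linarith⟩, ?_⟩
      change dir (f _) = x
      rw [← dir_smul (hf0 _) hst, ← dir_coe x, hxst]
      congr 1
      simp only [f, smul_add, smul_smul]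
      congr 2
      · field_simp
        ring
      · field_simp
  · obtain ⟨c, -, hc⟩ := exists_smul_of_dir_eq (hf0 s) (hf0 t) h
    have h1 := congrArg (val (face₁ e)) hc
    rw [val_smul, hval, hval] at h1
    have hc1 : c = 1 := by linarith
    rw [hc1, one_smul] at hc
    have h2 : ((t : ℝ) - s) • (b - a) = 0 := by
      have : ((t : ℝ) - s) • (b - a) = f t - f s := by
        simp only [f]
        module
      rw [this, hc, sub_self]
    rcases smul_eq_zero.1 h2 with h3 | h3
    · exact Subtype.ext (by linarith)
    · have : b = a := sub_eq_zero.1 h3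
      exact absurd (congrArg dir this.symm) (vertex_end_ne e)

theorem edge_inter_range_vertex (e : Fin 30) :
    edge e ∩ range vertex = {vertex (end₁ e), vertex (end₂ e)} := by
  ext x
  constructor
  · rintro ⟨hx, j, rfl⟩
    rcases vertex_mem_edge.1 hx with rfl | rfl
    · exact Or.inl rfl
    · exact Or.inr rfl
  · rintro (rfl | rfl)
    · exact ⟨vertex_mem_edge.2 (Or.inl rfl), _, rfl⟩
    · exact ⟨vertex_mem_edge.2 (Or.inr rfl), _, rfl⟩

theorem edge_injective {e e' : Fin 30} (h : edge e = edge e') : e = e' := by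
  apply eq_of_ends
  · exact vertex_mem_edge.1 (h ▸ vertex_mem_edge.2 (Or.inl rfl))
  · exact vertex_mem_edge.1 (h ▸ vertex_mem_edge.2 (Or.inr rfl))

theorem normal_sub_ne_zero {i k : Fin 12} (h : i ≠ k) : vec (normal i) - vec (normal k) ≠ 0 := by
  intro h0
  have := congrArg (val i) h0
  rw [val_sub, val_normal_self, val_zero] at this
  linarith [val_normal_lt h]

theorem face_ne (e : Fin 30) : face₁ e ≠ face₂ e := by
  revert e
  decide +kernel

theorem isLocallyFlatAt_edge {e : Fin 30} {x : Sphere2} (hx : x ∈ edge e)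
    (hxv : x ∉ range vertex) : IsLocallyFlatAt (edge e) x := by
  have heq : val (face₁ e) x = val (face₂ e) x := InWall.val_eq hx
  obtain ⟨φ, hφx, hφ⟩ := exists_chart_of_greatCircle x (normal_sub_ne_zero (face_ne e)) (by
    rw [inner_sub_left, ← val_eq_inner, ← val_eq_inner, heq, sub_self])
  -- the other linear forms are not maximal near `x`
  let O : Set Sphere2 := ⋂ r, {y | r ≠ face₁ e → r ≠ face₂ e →
    val r y < val (face₁ e) y ∧ val r y < val (face₂ e) y}
  have hO : IsOpen O := by
    refine isOpen_iInter_of_finite fun r => ?_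
    by_cases h1 : r = face₁ e
    · simp [h1]
    by_cases h2 : r = face₂ e
    · simp [h2]
    have h := (isOpen_lt (continuous_val_coe r) (continuous_val_coe (face₁ e))).inter
      (isOpen_lt (continuous_val_coe r) (continuous_val_coe (face₂ e)))
    convert h using 1
    ext y
    simp [h1, h2]
  have hxO : x ∈ O := by
    refine mem_iInter.2 fun r h1 h2 => ?_
    rw [← heq, and_self]
    refine lt_of_le_of_ne (hx r).1 fun h => hxv ?_
    rcases eq_vertex_of_val_eq hx h1 h2 h with rfl | rfl
    · exact ⟨_, rfl⟩
    · exact ⟨_, rfl⟩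
  refine ⟨φ.restrOpen O hO, ⟨hφx, hxO⟩, ?_⟩
  rintro y ⟨hyφ, hyO⟩
  change y ∈ edge e ↔ (φ y).im = 0
  rw [← hφ y hyφ, inner_sub_left, ← val_eq_inner, ← val_eq_inner, sub_eq_zero]
  constructor
  · intro h
    exact InWall.val_eq h
  · intro h l
    rw [← h, and_self]
    by_cases h1 : l = face₁ e
    · rw [h1]
    by_cases h2 : l = face₂ e
    · rw [h2, h]
    exact (mem_iInter.1 hyO l h1 h2).1.le

/-- The graph formed by the radial projection of the edges of the convex dodecahedron. -/
noncomputable def graph : SphereGraph where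
  verts := range vertex
  edges := range edge
  finite_verts := finite_range _
  finite_edges := finite_range _
  edge_curve := by
    rintro _ ⟨e, rfl⟩
    exact ⟨_, _, isSimpleCurve_edge e, edge_inter_range_vertex e⟩
  edge_inter := by
    rintro _ ⟨e, rfl⟩ _ ⟨e', rfl⟩ hne x ⟨hx, hx'⟩
    have hee : e ≠ e' := fun h => hne (h ▸ rfl)
    have key : ∃ r, r ≠ face₁ e ∧ r ≠ face₂ e ∧ val r x = val (face₁ e) x := by
      rcases exists_face_ne e e' hee with h | h
      · exact ⟨_, h.1, h.2, le_antisymm (hx _).1 (hx' _).1⟩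
      · exact ⟨_, h.1, h.2, le_antisymm (hx _).1 (hx' _).2⟩
    obtain ⟨r, h1, h2, h3⟩ := key
    rcases eq_vertex_of_val_eq hx h1 h2 h3 with rfl | rfl
    · exact ⟨_, rfl⟩
    · exact ⟨_, rfl⟩
  edge_flat := by
    rintro _ ⟨e, rfl⟩ x hx hxv
    exact isLocallyFlatAt_edge hx hxv

theorem support_eq : graph.support = ⋃ e, edge e := by
  change range vertex ∪ ⋃₀ range edge = _
  rw [sUnion_range, union_eq_right]
  rintro _ ⟨j, rfl⟩
  obtain ⟨e, h1, h2⟩ := exists_dot_eq j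
  exact mem_iUnion.2 ⟨e, vertex_mem_wall h1 h2⟩

theorem compl_support : graph.supportᶜ = ⋃ i, tileInterior i := by
  ext x
  rw [mem_compl_iff, support_eq, mem_iUnion, mem_iUnion]
  constructor
  · intro hx
    obtain ⟨i, hi⟩ := Finite.exists_max fun i => val i x
    refine ⟨i, fun k hk => lt_of_le_of_ne (hi k) fun h => hx ?_⟩
    obtain ⟨e, ⟨h1, h2⟩ | ⟨h1, h2⟩⟩ := exists_edge_of_val_eq x.ne_zero hk.symm hi h
    · refine ⟨e, fun l => ?_⟩
      rw [h1, h2, h, and_self]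
      exact hi l
    · refine ⟨e, fun l => ?_⟩
      rw [h1, h2, h, and_self]
      exact hi l
  · rintro ⟨i, hi⟩ ⟨e, he⟩
    by_cases h : face₁ e = i
    · have h2 : face₂ e ≠ i := fun h' => face_ne e (h.trans h'.symm)
      exact absurd (hi _ h2) (not_lt.2 (he i).2)
    · exact absurd (hi _ h) (not_lt.2 (he i).1)

theorem tileInterior_disjoint {i k : Fin 12} (h : i ≠ k) :
    Disjoint (tileInterior i) (tileInterior k) := by
  rw [disjoint_left]
  intro x hi hk
  exact lt_asymm (hi k h.symm) (hk i h)

theorem tileInterior_injective : Function.Injective tileInterior := by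
  intro i k h
  by_contra hne
  exact disjoint_left.1 (tileInterior_disjoint hne) (dir_normal_mem i) (h ▸ dir_normal_mem i)

theorem connectedComponentIn_eq {i : Fin 12} {x : Sphere2} (hx : x ∈ tileInterior i) :
    connectedComponentIn graph.supportᶜ x = tileInterior i := by
  have hsub : tileInterior i ⊆ graph.supportᶜ := compl_support ▸ subset_iUnion _ i
  apply subset_antisymm
  · refine isPreconnected_connectedComponentIn.subset_left_of_subset_union
      (v := ⋃ k ∈ {k | k ≠ i}, tileInterior k) (isOpen_tileInterior i)
      (isOpen_biUnion fun k _ => isOpen_tileInterior k) ?_ ?_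
      ⟨x, mem_connectedComponentIn (hsub hx), hx⟩
    · exact disjoint_iUnion₂_right.2 fun k hk => tileInterior_disjoint (Ne.symm hk)
    · refine (connectedComponentIn_subset _ _).trans ?_
      rw [compl_support]
      refine iUnion_subset fun k => ?_
      by_cases hk : k = i
      · exact hk ▸ subset_union_left
      · exact (subset_biUnion_of_mem (u := tileInterior) hk).trans subset_union_right
  · exact (isPreconnected_tileInterior i).subset_connectedComponentIn hx hsub

theorem faces_eq : graph.faces = range tileInterior := by
  ext F
  constructor
  · rintro ⟨x, hx, rfl⟩
    rw [compl_support, mem_iUnion] at hx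
    obtain ⟨i, hi⟩ := hx
    exact ⟨i, (connectedComponentIn_eq hi).symm⟩
  · rintro ⟨i, rfl⟩
    exact ⟨dir (vec (normal i)), (compl_support ▸ subset_iUnion tileInterior i) (dir_normal_mem i),
      (connectedComponentIn_eq (dir_normal_mem i)).symm⟩

theorem edge_subset_wall {e : Fin 30} {i : Fin 12} :
    edge e ⊆ wall i i ↔ i = face₁ e ∨ i = face₂ e := by
  constructor
  · intro h
    by_contra! hne
    have h1 := dot_eq_of_vertex_mem_wall (h (vertex_mem_edge.2 (Or.inl rfl)))
    have h2 := dot_eq_of_vertex_mem_wall (h (vertex_mem_edge.2 (Or.inr rfl)))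
    rcases dot_lt_of_ne e i hne.1 hne.2 with h' | h'
    · exact h'.ne h1.1
    · exact h'.ne h2.1
  · rintro (rfl | rfl) x hx l
    · exact ⟨(hx l).1, (hx l).1⟩
    · exact ⟨(hx l).2, (hx l).2⟩

theorem ncard_image_edge (s : Finset (Fin 30)) : (edge '' (s : Set (Fin 30))).ncard = s.card := by
  rw [ncard_image_of_injective _ fun _ _ h => edge_injective h, ncard_coe_finset]

theorem ncard_sides (i : Fin 12) : (graph.sides (tileInterior i)).ncard = 5 := by
  rw [← card_edges_of_face i, ← ncard_image_edge]
  congr 1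
  have hF : tileInterior i ∈ graph.faces := faces_eq ▸ ⟨i, rfl⟩
  ext E
  constructor
  · rintro ⟨⟨e, rfl⟩, he⟩
    have := (SphereGraph.subset_closure_diff_iff hF ⟨e, rfl⟩).1 he
    rw [closure_tileInterior, edge_subset_wall] at this
    exact ⟨e, by simpa using this, rfl⟩
  · rintro ⟨e, he, rfl⟩
    refine ⟨⟨e, rfl⟩, (SphereGraph.subset_closure_diff_iff hF ⟨e, rfl⟩).2 ?_⟩
    rw [closure_tileInterior, edge_subset_wall]
    simpa using he

theorem ncard_edges_at_vertex (j : Fin 20) :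
    {E ∈ graph.edges | vertex j ∈ E}.ncard = 3 := by
  rw [← card_edges_of_vertex j, ← ncard_image_edge]
  congr 1
  ext E
  constructor
  · rintro ⟨⟨e, rfl⟩, he⟩
    exact ⟨e, by simpa using vertex_mem_edge.1 he, rfl⟩
  · rintro ⟨e, he, rfl⟩
    exact ⟨⟨e, rfl⟩, vertex_mem_edge.2 (by simpa using he)⟩

theorem isConnected_support : IsConnected graph.support := by
  have hedge : ∀ e, IsPreconnected (edge e) := fun e => by
    obtain ⟨γ, h, -⟩ := isSimpleCurve_edge e
    exact h ▸ isPreconnected_range γ.continuous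
  have hsub : ∀ e, edge e ⊆ graph.support := fun e => support_eq ▸ subset_iUnion edge e
  have hv0 : vertex 0 ∈ graph.support := Or.inl ⟨0, rfl⟩
  let C := connectedComponentIn graph.support (vertex 0)
  have hstep : ∀ e, ∀ y ∈ edge e, y ∈ C → edge e ⊆ C := fun e y hy hyC => by
    have := (hedge e).subset_connectedComponentIn hy (hsub e)
    rwa [← _root_.connectedComponentIn_eq hyC] at this
  have hvert : ∀ n (hn : n < 20), vertex ⟨n, hn⟩ ∈ C := by
    intro n
    induction n using Nat.strong_induction_on with
    | _ n ih =>
      intro hn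
      by_cases h0 : (⟨n, hn⟩ : Fin 20) = 0
      · rw [h0]
        exact mem_connectedComponentIn hv0
      · obtain ⟨e, ⟨h1, h2⟩ | ⟨h1, h2⟩⟩ := exists_smaller_neighbour _ h0
        · exact hstep e _ (vertex_mem_edge.2 (Or.inr rfl)) (ih _ h2 (end₂ e).2)
            (vertex_mem_edge.2 (Or.inl h1.symm))
        · exact hstep e _ (vertex_mem_edge.2 (Or.inl rfl)) (ih _ h2 (end₁ e).2)
            (vertex_mem_edge.2 (Or.inr h1.symm))
  have hall : graph.support ⊆ C := by
    rw [support_eq]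
    exact iUnion_subset fun e =>
      hstep e _ (vertex_mem_edge.2 (Or.inl rfl)) (hvert _ (end₁ e).2)
  refine ⟨⟨_, hv0⟩, ?_⟩
  rw [subset_antisymm hall (connectedComponentIn_subset _ _)]
  exact isPreconnected_connectedComponentIn

/-- The dodecahedral tiling of the sphere. -/
noncomputable def tiling : SphericalTiling where
  toSphereGraph := graph
  connected := isConnected_support
  three_le_degree := by
    rintro _ ⟨j, rfl⟩
    rw [SphereGraph.degree, ncard_edges_at_vertex]
    exact Nat.le_add_right _ _

theorem isCombinatoriallyMonohedral_tiling : tiling.IsCombinatoriallyMonohedral 5 := by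
  intro F hF
  obtain ⟨i, rfl⟩ : F ∈ range tileInterior := faces_eq ▸ hF
  exact ⟨ncard_sides i, noBoundaryIdentification_tileInterior i⟩

theorem ncard_tiles_tiling : tiling.tiles.ncard = 12 := by
  change (closure '' graph.faces).ncard = 12
  rw [graph.closure_injOn_faces.ncard_image, faces_eq, ← image_univ,
    ncard_image_of_injective _ tileInterior_injective, ncard_univ, Nat.card_eq_fintype_card,
    Fintype.card_fin]

end Pyritohedron

theorem proposition5 :
    (∃ T : SphericalTiling, T.IsCombinatoriallyMonohedral 5 ∧ T.tiles.ncard = 12) ∧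
    (∀ T : SphericalTiling, T.IsCombinatoriallyMonohedral 5 → T.tiles.ncard = 12 →
      T.IsDodecahedral) :=
  ⟨⟨Pyritohedron.tiling, Pyritohedron.isCombinatoriallyMonohedral_tiling,
    Pyritohedron.ncard_tiles_tiling⟩, fun _ => SphericalTiling.isDodecahedral⟩
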